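/- An $\ell$-graph $G=(V,E)$ consists of a finite vertex set $V$ and a set $E\subseteq\binom{V}{\ell}$ of edges; $v(G)$ and $e(G)$ denote the numbers of its vertices and edges, and subgraphs need be neither induced nor spanning. If $v(G)\ge \ell+1$, put $d_\ell(G)=\frac{e(G)-1}{v(G)-\ell}$ and $m_\ell(G)=\max\{d_\ell(J): J\subseteq G,\ v(J)\ge \ell+1\}$. Call $G$ strictly $\ell$-balanced if $v(G)\ge\ell+1$, $m_\ell(G)=d_\ell(G)$, and $d_\ell(J)<m_\ell(G)$ for every proper subgraph $J\subsetneq G$ with $v(J)\ge\ell+1$. Let $K_r^{(\ell)}$ be the complete $\ell$-graph on $r$ vertices, $K_3=K_3^{(2)}$, and $C_4$ the cycle of length $4$. An edge colouring of $G$ (with any number of colours) is $2$-bounded if each colour is used on at most two edges; a copy of $F$ in $G$, i.e. a subgraph of $G$ isomorphic to $F$, is rainbow if its edges have pairwise different colours. Let $G^{(\ell)}(n,p)$ be the random $\ell$-graph on $n$ vertices in which each $\ell$-element set of vertices is an edge independently with probability $p$. Theorem. Let $\ell\ge 2$, let $F$ be an $\ell$-graph, and let $F'\subseteq F$ be a strictly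 $\ell$-balanced subgraph with $m_\ell(F')=m_\ell(F)$. Then there is a constant $c>0$ such that for every sequence $p=p(n)\in[0,1]$ satisfying one of the conditions (i) $\ell=2$, $F'$ contains a cycle, $F'\not\cong K_3$, $F'\not\cong C_4$, and $p\le c\,n^{-1/m_2(F)}$ for all large $n$; (ii) $\ell=2$, $F'\cong C_4$, and $p=o\bigl(n^{-1/m_2(C_4)}\bigr)$; (iii) $\ell\ge 3$, $F'\cong K_r^{(\ell)}$ for some $r\ge\ell+1$ with $(\ell,r)\ne(3,4)$, and $p\le c\,n^{-1/m_\ell(K_r^{(\ell)})}$ for all large $n$; the probability that $G\sim G^{(\ell)}(n,p)$ has a $2$-bounded edge colouring without a rainbow copy of $F$ tends to $1$ as $n\to\infty$. -/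

import Mathlib

open Filter Topology Asymptotics
open scoped unitInterval

namespace Hypergraph

/-- `H` is an `ℓ`-graph: a finite hypergraph all of whose edges have exactly `ℓ` vertices. -/
def IsLGraph {α : Type*} (ℓ : ℕ) (H : Hypergraph α) : Prop :=
  H.vertexSet.Finite ∧ ∀ e ∈ H.edgeSet, e.ncard = ℓ

/-- `J` is a (not necessarily induced, not necessarily spanning) subgraph of `H`. -/
def IsSubgraph {α : Type*} (J H : Hypergraph α) : Prop :=
  J.vertexSet ⊆ H.vertexSet ∧ J.edgeSet ⊆ H.edgeSet

/-- `G ≅ H`: there is a bijection between the vertex sets under which a set of vertices of `G` is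
an edge of `G` if and only if its image is an edge of `H`. -/
def IsIso {α β : Type*} (G : Hypergraph α) (H : Hypergraph β) : Prop :=
  ∃ f : G.vertexSet ≃ H.vertexSet, ∀ s : Set G.vertexSet,
    Subtype.val '' s ∈ G.edgeSet ↔ Subtype.val '' (f '' s) ∈ H.edgeSet

/-- The `ℓ`-density `d_ℓ(G) = (e(G) - 1) / (v(G) - ℓ)`, for `v(G) ≥ ℓ + 1`. -/
noncomputable def lDensity {α : Type*} (ℓ : ℕ) (G : Hypergraph α) : ℝ :=
  ((G.edgeSet.ncard : ℝ) - 1) / ((G.vertexSet.ncard : ℝ) - ℓ)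

/-- `m_ℓ(G)`, the maximum `ℓ`-density of a subgraph of `G` on at least `ℓ + 1` vertices
(for finite `G` the supremum is over a finite set). -/
noncomputable def maxLDensity {α : Type*} (ℓ : ℕ) (G : Hypergraph α) : ℝ :=
  sSup {d : ℝ | ∃ J : Hypergraph α, J.IsSubgraph G ∧ ℓ + 1 ≤ J.vertexSet.ncard ∧ d = J.lDensity ℓ}

/-- `G` is strictly `ℓ`-balanced: it has at least `ℓ + 1` vertices, `m_ℓ(G) = d_ℓ(G)`, and
`d_ℓ(J) < m_ℓ(G)` for every proper subgraph `J` of `G` on at least `ℓ + 1` vertices. -/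
def IsStrictlyBalanced {α : Type*} (ℓ : ℕ) (G : Hypergraph α) : Prop :=
  ℓ + 1 ≤ G.vertexSet.ncard ∧ G.maxLDensity ℓ = G.lDensity ℓ ∧
    ∀ J : Hypergraph α, J.IsSubgraph G → J ≠ G → ℓ + 1 ≤ J.vertexSet.ncard →
      J.lDensity ℓ < G.maxLDensity ℓ

/-- A `2`-graph viewed as a simple graph on its vertex set. -/
def toSimpleGraph {α : Type*} (G : Hypergraph α) : SimpleGraph G.vertexSet where
  Adj u v := u ≠ v ∧ ({(u : α), (v : α)} : Set α) ∈ G.edgeSet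
  symm := ⟨fun u v h => ⟨h.1.symm, by rw [Set.pair_comm]; exact h.2⟩⟩
  loopless := ⟨fun _ h => h.1 rfl⟩

/-- The hypergraph with vertex set the whole type and edge set `E`. -/
def onUniv {V : Type*} (E : Set (Set V)) : Hypergraph V where
  vertexSet := Set.univ
  edgeSet := E
  subset_vertexSet_of_mem_edgeSet' := fun _ _ => Set.subset_univ _

/-- The complete `ℓ`-graph `K_r^(ℓ)` on `r` vertices. -/
def complete (ℓ r : ℕ) : Hypergraph (Fin r) :=
  onUniv {e | e.ncard = ℓ}

/-- The cycle `C_k` as a `2`-graph (for `k ≥ 3`). -/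
def cycle (k : ℕ) : Hypergraph (Fin k) :=
  onUniv {e | ∃ u v, (SimpleGraph.cycleGraph k).Adj u v ∧ e = {u, v}}

/-- The edge colouring `c` of `G` is `r`-bounded: every colour is used on at most `r` edges. -/
def IsBoundedColouring {α : Type*} (r : ℕ) (G : Hypergraph α) (c : Set α → ℕ) : Prop :=
  ∀ k : ℕ, {e ∈ G.edgeSet | c e = k}.encard ≤ r

/-- `G` contains a rainbow copy of `F` under `c`: a subgraph of `G` isomorphic to `F` whose edges
have pairwise distinct colours. -/
def HasRainbowCopy {α β : Type*} (G : Hypergraph α) (c : Set α → ℕ) (F : Hypergraph β) : Prop :=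
  ∃ H : Hypergraph α, H.IsSubgraph G ∧ F.IsIso H ∧ Set.InjOn c H.edgeSet

/-- Every `r`-bounded edge colouring of `G` contains a rainbow copy of `F`. -/
def AntiRamsey {α β : Type*} (r : ℕ) (G : Hypergraph α) (F : Hypergraph β) : Prop :=
  ∀ c : Set α → ℕ, G.IsBoundedColouring r c → G.HasRainbowCopy c F

/-- The probability that the binomial random `ℓ`-graph `G^(ℓ)(n, p)` satisfies `P`: its vertex set
is `Fin n`, and each `ℓ`-element subset is an edge independently with probability `p`. -/
noncomputable def randomProb (ℓ n : ℕ) (p : I) (P : Hypergraph (Fin n) → Prop) : ℝ :=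
  (ProbabilityTheory.setBernoulli {e : Set (Fin n) | e.ncard = ℓ} p).real {E | P (onUniv E)}

end Hypergraph

/-!
A host hypergraph is *bad* if each of its `2`-bounded colourings has a rainbow copy of the pattern
`F'`. A colouring without a rainbow copy of `F'` has none of `F` either, so it suffices to show that
the random hypergraph contains no minimal bad host with high probability. This follows from two
facts.

*Sparse hosts are not bad.* If no subgraph of the host has more edges per vertex than the `ℓ`-density
of `F'`, then the host can be coloured. For graphs (`StrictBal.colourable_of_two`), a vertex of small
degree can be deleted after pairing up its edges, so a minimal bad host has minimum degree at least
`2 k + 1`, where `k + 1` bounds the degrees of `F'` from below. Conversely, an orientation with small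
out-degrees gives a colouring with few colours on each copy. The two bounds leave the density range
from `5 / 2` to `3`, which is ruled out by discharging, and `K₄` itself, where the host would have to
be `5`-regular and to have a component `K₆`; but `K₆` can be coloured. For `C₄` the same method needs a
strictly sparser host (`StrictBal.colourable_of_four`). For complete patterns
(`colourable_of_complete`), the links of a minimal bad family are bad for the next smaller complete
pattern, which yields a lower bound for the degrees by induction. This bound is too weak for
`r = ℓ + 1`. There, Hall's theorem gives two private edges to each clique, unless some family of cliques
is crowded, i.e., has a shadow of less than twice its size; and shadows of minimal crowded families are
shown to be dense.

*Dense minimal bad hosts do not occur.* Since a minimal bad host is not a union of parts that contain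
all copies they meet, it can be built from any of its copies by attaching further copies. If `F'` is
strictly balanced, then attaching a copy never increases the potential `pot`, which is negative exactly
for the hosts that are denser than `F'`. So the potential of a minimal bad host is at most that of any
of its subgraphs (`MinBad.pot_le`), and by the first fact the host is denser than `F'` (at least as dense
for `C₄`). In the construction
a copy is regular if it meets the previous ones in the vertices of a single edge. A regular copy changes
the expected number of hosts by a constant factor, which is small if `c` is small, and an irregular copy
gains a power of `n`. So it suffices to follow the construction until logarithmically many copies or a
bounded number of irregular copies have been attached. If it ends earlier, then it ends with the whole
host, and the surplus density gains a power of `n`, or for `C₄` the factor `o(1)` by which `p` is below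
the threshold (`StrictBal.exists_measure_le`).
-/

set_option linter.unusedSectionVars false

/-! ### Two-bounded colourings, minimal bad hosts and strict balance -/

namespace RainbowFree

open Finset

variable {V W κ : Type*} [DecidableEq V] [DecidableEq W]

/-- Every colour of `c` is used at most twice on `E`. -/
def TwoBounded (c : Finset V → κ) (E : Finset (Finset V)) : Prop :=
  ∀ e₁ ∈ E, ∀ e₂ ∈ E, ∀ e₃ ∈ E, c e₁ = c e₂ → c e₂ = c e₃ → e₁ = e₂ ∨ e₂ = e₃ ∨ e₁ = e₃

/-- The embedding `φ` of the vertices of the pattern `H` is a copy of `H` in `E`. -/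
def IsCopy (H : Finset (Finset W)) (E : Finset (Finset V)) (φ : W ↪ V) : Prop :=
  ∀ h ∈ H, h.map φ ∈ E

/-- The edges of the copy of `H` given by `φ`. -/
def copyEdges (H : Finset (Finset W)) (φ : W ↪ V) : Finset (Finset V) :=
  H.image fun h => h.map φ

/-- `E` has a `2`-bounded edge colouring without a rainbow copy of `H`. -/
def Colourable (H : Finset (Finset W)) (E : Finset (Finset V)) : Prop :=
  ∃ c : Finset V → ℕ, TwoBounded c E ∧ ∀ φ : W ↪ V, IsCopy H E φ →
    ∃ h₁ ∈ H, ∃ h₂ ∈ H, h₁ ≠ h₂ ∧ c (h₁.map φ) = c (h₂.map φ)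

/-- `E` is not colourable, but every proper subset of `E` is. -/
def MinBad (H : Finset (Finset W)) (E : Finset (Finset V)) : Prop :=
  ¬ Colourable H E ∧ ∀ E' ⊂ E, Colourable H E'

/-- The vertices covered by the edges in `E`. -/
def supp (E : Finset (Finset V)) : Finset V := E.biUnion id

/-- The degree of the vertex `x`. -/
def deg (E : Finset (Finset V)) (x : V) : ℕ := #{e ∈ E | x ∈ e}

variable {H : Finset (Finset W)} {E G : Finset (Finset V)}

lemma mem_supp {x : V} : x ∈ supp E ↔ ∃ e ∈ E, x ∈ e := by simp [supp]

lemma supp_mono (h : G ⊆ E) : supp G ⊆ supp E := biUnion_subset_biUnion_of_subset_left _ h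

lemma subset_supp {e : Finset V} (he : e ∈ E) : e ⊆ supp E := fun _ hx => mem_supp.2 ⟨e, he, hx⟩

lemma supp_union : supp (G ∪ E) = supp G ∪ supp E := union_biUnion

lemma mem_copyEdges {φ : W ↪ V} {e : Finset V} : e ∈ copyEdges H φ ↔ ∃ h ∈ H, h.map φ = e := by
  simp [copyEdges]

lemma isCopy_iff {φ : W ↪ V} : IsCopy H E φ ↔ copyEdges H φ ⊆ E := by
  simp [IsCopy, copyEdges, image_subset_iff]

lemma card_copyEdges (φ : W ↪ V) : #(copyEdges H φ) = #H :=
  card_image_of_injective _ (map_injective φ)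

/-- A colouring with colours of any type suffices. -/
lemma colourable_of [Finite V] (c : Finset V → κ) (hc : TwoBounded c E)
    (h : ∀ φ : W ↪ V, IsCopy H E φ → ∃ h₁ ∈ H, ∃ h₂ ∈ H, h₁ ≠ h₂ ∧ c (h₁.map φ) = c (h₂.map φ)) :
    Colourable H E := by
  obtain ⟨f, hf⟩ := Countable.exists_injective_nat (Set.range c)
  have key : ∀ e e', f ⟨c e, e, rfl⟩ = f ⟨c e', e', rfl⟩ ↔ c e = c e' := fun e e' =>
    ⟨fun h => congrArg Subtype.val (hf h), fun h => by simp [h]⟩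
  refine ⟨fun e => f ⟨c e, e, rfl⟩, fun e₁ h₁ e₂ h₂ e₃ h₃ => ?_, fun φ hφ => ?_⟩
  · simpa only [key] using hc e₁ h₁ e₂ h₂ e₃ h₃
  · simpa only [key] using h φ hφ

/-- If some of the edges have a `2`-bounded colouring in which every copy using one of these edges
has two edges of the same colour, then it remains to colour the other edges. -/
lemma Colourable.of_peel [Finite V] {E₁ : Finset (Finset V)} (c₁ : Finset V → κ)
    (h₁ : TwoBounded c₁ E₁)
    (hcopy : ∀ φ : W ↪ V, IsCopy H E φ → (∃ h ∈ H, h.map φ ∈ E₁) →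
      ∃ h₁ ∈ H, ∃ h₂ ∈ H, h₁ ≠ h₂ ∧ h₁.map φ ∈ E₁ ∧ h₂.map φ ∈ E₁ ∧
        c₁ (h₁.map φ) = c₁ (h₂.map φ))
    (h₂ : Colourable H (E \ E₁)) : Colourable H E := by
  obtain ⟨c₂, h₂, hcopy₂⟩ := h₂
  refine colourable_of (fun e => if e ∈ E₁ then (Sum.inl (c₁ e) : κ ⊕ ℕ) else Sum.inr (c₂ e)) ?_ ?_
  · intro a ha b hb d hd
    have k₁ := h₁ a
    have k₂ := h₂ a
    by_cases haE : a ∈ E₁ <;> by_cases hbE : b ∈ E₁ <;> by_cases hdE : d ∈ E₁ <;>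
      simp only [haE, hbE, hdE, if_true, if_false, Sum.inl.injEq, Sum.inr.injEq, reduceCtorEq,
        false_imp_iff, imp_true_iff]
    · exact k₁ haE b hbE d hdE
    · exact k₂ (by simp [*]) b (by simp [*]) d (by simp [*])
  · intro φ hφ
    by_cases h : ∃ h ∈ H, h.map φ ∈ E₁
    · obtain ⟨a, ha, b, hb, hab, haE, hbE, h⟩ := hcopy φ hφ h
      exact ⟨a, ha, b, hb, hab, by simp [haE, hbE, h]⟩
    · push Not at h
      obtain ⟨a, ha, b, hb, hab, h'⟩ := hcopy₂ φ fun x hx => mem_sdiff.2 ⟨hφ x hx, h x hx⟩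
      exact ⟨a, ha, b, hb, hab, by simp [h a ha, h b hb, h']⟩

lemma exists_minBad_subset (h : ¬ Colourable H E) : ∃ E' ⊆ E, MinBad H E' := by
  induction E using Finset.strongInduction with
  | H E ih =>
    by_cases h' : ∃ E' ⊂ E, ¬ Colourable H E'
    · obtain ⟨E', hE', hc⟩ := h'
      obtain ⟨E'', h₁, h₂⟩ := ih E' hE' hc
      exact ⟨E'', h₁.trans hE'.1, h₂⟩
    · push Not at h'
      exact ⟨E, Subset.rfl, h, h'⟩

lemma MinBad.colourable_sdiff (h : MinBad H E) (hG : G ⊆ E) (hne : G.Nonempty) :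
    Colourable H (E \ G) :=
  h.2 _ (sdiff_ssubset hG hne)

lemma MinBad.nonempty (h : MinBad H E) (hH : H.Nonempty) : E.Nonempty := by
  rw [nonempty_iff_ne_empty]
  rintro rfl
  refine h.1 ⟨fun _ => 0, fun e he => by simp at he, fun φ hφ => ?_⟩
  obtain ⟨x, hx⟩ := hH
  simpa using hφ x hx

lemma MinBad.exists_copy [Finite V] (h : MinBad H E) {e : Finset V} (he : e ∈ E) :
    ∃ φ : W ↪ V, IsCopy H E φ ∧ e ∈ copyEdges H φ := by
  by_contra! hcon
  refine h.1 (Colourable.of_peel (E₁ := {e}) (fun _ => 0) ?_ ?_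
    (h.colourable_sdiff (by simpa) (by simp)))
  · intro a ha b hb
    simp_all
  · rintro φ hφ ⟨x, hx, hxe⟩
    exact absurd (mem_copyEdges.2 ⟨x, hx, by simpa using hxe⟩) (hcon φ hφ)

lemma MinBad.card_eq [Finite V] (h : MinBad H E) {l : ℕ} (hl : ∀ h ∈ H, #h = l) {e : Finset V}
    (he : e ∈ E) : #e = l := by
  obtain ⟨φ, -, hφ⟩ := h.exists_copy he
  obtain ⟨x, hx, rfl⟩ := mem_copyEdges.1 hφ
  simpa using hl x hx

/-- A minimal non-colourable `E` cannot be split into parts such that each copy is contained in one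
of the parts: the parts could be coloured separately. -/
lemma MinBad.eq_of_closed [Finite V] (h : MinBad H E) (hG : G ⊆ E) (hne : G.Nonempty)
    (hcl : ∀ φ : W ↪ V, IsCopy H E φ → (∃ h ∈ H, h.map φ ∈ G) → IsCopy H G φ) : G = E := by
  by_contra hGE
  obtain ⟨c, hc, hcopy⟩ := h.2 G (hG.ssubset_of_ne hGE)
  refine h.1 (Colourable.of_peel c hc (fun φ hφ hx => ?_) (h.colourable_sdiff hG hne))
  have hφG := hcl φ hφ hx
  obtain ⟨a, ha, b, hb, hab, hc'⟩ := hcopy φ hφG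
  exact ⟨a, ha, b, hb, hab, hφG a ha, hφG b hb, hc'⟩

variable [Fintype W]

/-- Strict `l`-balancedness of an `l`-uniform pattern `H` with vertex type `W`, with the inequality
between densities written over the integers. A subgraph consists of a set `S` of vertices and a set
`T` of edges inside `S`. -/
def StrictBal (l : ℕ) (H : Finset (Finset W)) : Prop :=
  (∀ h ∈ H, #h = l) ∧ l + 1 ≤ Fintype.card W ∧
    ∀ S : Finset W, ∀ T ⊆ H, (∀ h ∈ T, h ⊆ S) → l + 1 ≤ #S → (S ≠ univ ∨ T ≠ H) →
      ((#T : ℤ) - 1) * (Fintype.card W - l) < (#H - 1) * (#S - l)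

/-- The potential `(e(H) - 1) v(G) - (v(H) - l) e(G)` of a host `G`: it is negative if and only if
the number of edges per vertex of `G` exceeds the `l`-density of `H`. -/
def pot (l : ℕ) (H : Finset (Finset W)) (G : Finset (Finset V)) : ℤ :=
  (#H - 1) * #(supp G) - (Fintype.card W - l) * #G

/-- The vertices of the pattern which a copy places on vertices of `G`. -/
def oldVerts (G : Finset (Finset V)) (φ : W ↪ V) : Finset W := {w | φ w ∈ supp G}

/-- The edges of the pattern which a copy places on edges of `G`. -/
def oldEdges (H : Finset (Finset W)) (G : Finset (Finset V)) (φ : W ↪ V) : Finset (Finset W) :=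
  {h ∈ H | h.map φ ∈ G}

lemma oldEdges_subset (φ : W ↪ V) : oldEdges H G φ ⊆ H := filter_subset _ _

lemma subset_oldVerts {φ : W ↪ V} {h : Finset W} (hh : h ∈ oldEdges H G φ) :
    h ⊆ oldVerts G φ := by
  intro w hw
  simp only [oldEdges, mem_filter] at hh
  simpa [oldVerts] using subset_supp hh.2 (mem_map_of_mem φ hw)

lemma card_union_copyEdges (φ : W ↪ V) :
    #(G ∪ copyEdges H φ) + #(oldEdges H G φ) = #G + #H := by
  have h : #(G ∩ copyEdges H φ) = #(oldEdges H G φ) := by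
    rw [← card_image_of_injective (oldEdges H G φ) (map_injective φ)]
    congr 1
    ext e
    simp only [mem_inter, mem_copyEdges, mem_image, oldEdges, mem_filter]
    constructor
    · rintro ⟨he, h, hh, rfl⟩; exact ⟨h, ⟨hh, he⟩, rfl⟩
    · rintro ⟨h, ⟨hh, he⟩, rfl⟩; exact ⟨he, h, hh, rfl⟩
  rw [← h, card_union_add_card_inter, card_copyEdges]

lemma card_supp_union_le (φ : W ↪ V) :
    #(supp (G ∪ copyEdges H φ)) + #(oldVerts G φ) ≤ #(supp G) + Fintype.card W := by
  have h₁ : supp (G ∪ copyEdges H φ) ⊆ supp G ∪ (oldVerts G φ)ᶜ.map φ := by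
    intro x hx
    rw [supp_union, mem_union] at hx
    by_cases hxG : x ∈ supp G
    · exact mem_union_left _ hxG
    · obtain ⟨e, he, hxe⟩ := mem_supp.1 (hx.resolve_left hxG)
      obtain ⟨h, hh, rfl⟩ := mem_copyEdges.1 he
      obtain ⟨w, hw, rfl⟩ := mem_map.1 hxe
      exact mem_union_right _ (mem_map_of_mem φ (by simpa [oldVerts] using hxG))
  have h₂ := (card_le_card h₁).trans (card_union_le _ _)
  rw [card_map] at h₂
  have h₃ := card_compl_add_card (oldVerts G φ)
  omega

/-- If every vertex of the pattern is in an edge, all new vertices of a copy are covered. -/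
lemma le_card_supp_union (hH : supp H = univ) (φ : W ↪ V) :
    #(supp G) + Fintype.card W ≤ #(supp (G ∪ copyEdges H φ)) + #(oldVerts G φ) := by
  have h₁ : supp G ∪ (oldVerts G φ)ᶜ.map φ ⊆ supp (G ∪ copyEdges H φ) := by
    rw [supp_union]
    refine union_subset_union_right fun x hx => ?_
    obtain ⟨w, -, rfl⟩ := mem_map.1 hx
    obtain ⟨h, hh, hw⟩ := mem_supp.1 (hH ▸ mem_univ w)
    exact mem_supp.2 ⟨_, mem_copyEdges.2 ⟨h, hh, rfl⟩, mem_map_of_mem φ hw⟩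
  have h₂ := card_le_card h₁
  rw [card_union_of_disjoint, card_map] at h₂
  · have h₃ := card_compl_add_card (oldVerts G φ)
    omega
  · rw [disjoint_left]
    rintro x hx hx'
    obtain ⟨w, hw, rfl⟩ := mem_map.1 hx'
    simp [oldVerts, hx] at hw

lemma StrictBal.le_card_oldVerts {l : ℕ} (hH : StrictBal l H) {φ : W ↪ V}
    (h : (oldEdges H G φ).Nonempty) : l ≤ #(oldVerts G φ) := by
  obtain ⟨x, hx⟩ := h
  rw [← hH.1 x (oldEdges_subset φ hx)]
  exact card_le_card (subset_oldVerts hx)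

/-- A copy that meets `G` in exactly the vertices of one edge meets `G` only in this edge. -/
lemma StrictBal.card_oldEdges {l : ℕ} (hH : StrictBal l H) {φ : W ↪ V}
    (h : (oldEdges H G φ).Nonempty) (hl : #(oldVerts G φ) = l) : #(oldEdges H G φ) = 1 := by
  obtain ⟨x, hx⟩ := h
  have key : ∀ y ∈ oldEdges H G φ, y = oldVerts G φ := fun y hy =>
    eq_of_subset_of_card_le (subset_oldVerts hy) (by rw [hl, hH.1 y (oldEdges_subset φ hy)])
  rw [card_eq_one]
  exact ⟨oldVerts G φ, eq_singleton_iff_unique_mem.2 ⟨key x hx ▸ hx, key⟩⟩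

/-- A copy that is not contained in `G` and meets `G` in more than the vertices of an edge decreases
the potential. -/
lemma StrictBal.old_lt {l : ℕ} (hH : StrictBal l H) {φ : W ↪ V}
    (hl : l + 1 ≤ #(oldVerts G φ)) (hφ : ¬ IsCopy H G φ) :
    ((#(oldEdges H G φ) : ℤ) - 1) * (Fintype.card W - l) < (#H - 1) * (#(oldVerts G φ) - l) := by
  refine hH.2.2 _ _ (oldEdges_subset φ) (fun h => subset_oldVerts) hl (Or.inr fun h => hφ ?_)
  intro x hx
  rw [← h] at hx
  exact (mem_filter.1 hx).2

/-- Adding to `G` a copy of `H` which shares an edge with `G` does not increase the potential. -/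
lemma StrictBal.pot_union_le {l : ℕ} (hH : StrictBal l H) (hne : 1 ≤ #H) {φ : W ↪ V}
    (h : (oldEdges H G φ).Nonempty) : pot l H (G ∪ copyEdges H φ) ≤ pot l H G := by
  have h₁ := card_union_copyEdges (H := H) (G := G) φ
  have h₂ := card_supp_union_le (H := H) (G := G) φ
  have key : ((#(oldEdges H G φ) : ℤ) - 1) * (Fintype.card W - l)
      ≤ (#H - 1) * (#(oldVerts G φ) - l) := by
    rcases (hH.le_card_oldVerts h).eq_or_lt with hl | hl
    · rw [hH.card_oldEdges h hl.symm, ← hl]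
      simp
    · by_cases hφ : IsCopy H G φ
      · have : oldEdges H G φ = H := filter_true_of_mem hφ
        rw [this]
        by_cases hS : oldVerts G φ = univ
        · rw [hS, card_univ]
        · have h₃ := card_union_copyEdges (H := H) (G := G) φ
          have := hH.2.2 (oldVerts G φ) H Subset.rfl
            (fun h hh => subset_oldVerts (by rwa [this])) hl (Or.inl hS)
          exact this.le
      · exact (hH.old_lt hl hφ).le
  unfold pot
  zify at h₁ h₂ hne
  have h₄ : (0 : ℤ) ≤ #H - 1 := by linarith
  nlinarith

/-- Starting from any part `G` of a minimal non-colourable `E` one reaches `E` by adding copies, so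
the potential of `E` is at most that of `G`. -/
lemma MinBad.pot_le [Finite V] {l : ℕ} (hH : StrictBal l H) (hne : 1 ≤ #H) (h : MinBad H E)
    (hG : G ⊆ E) (hGne : G.Nonempty) : pot l H E ≤ pot l H G := by
  classical
  obtain ⟨K, hK⟩ := (E.powerset.filter fun K => G ⊆ K ∧ pot l H K ≤ pot l H G).exists_maximal
    ⟨G, by simp [hG]⟩
  have hK₁ := hK.1
  simp only [mem_filter, mem_powerset] at hK₁
  have : K = E := by
    refine h.eq_of_closed hK₁.1 (hGne.mono hK₁.2.1) fun φ hφ ⟨x, hx, hxK⟩ => ?_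
    have hsub : K ∪ copyEdges H φ ⊆ K := by
      refine hK.2 ?_ subset_union_left
      simp only [mem_filter, mem_powerset]
      refine ⟨union_subset hK₁.1 (isCopy_iff.1 hφ), hK₁.2.1.trans subset_union_left, ?_⟩
      exact (hH.pot_union_le hne ⟨x, mem_filter.2 ⟨hx, hxK⟩⟩).trans hK₁.2.2
    exact isCopy_iff.2 (subset_union_right.trans hsub)
  exact this ▸ hK₁.2.2

end RainbowFree

/-! ### Exploring the copies in a random host -/

namespace RainbowFree

open Finset MeasureTheory

variable {V W Ω : Type*} [DecidableEq V] [DecidableEq W] [Fintype V] [Fintype W]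

/-- The exploration of the copies of `H` in `E`. The current graph is `G`, and `Q` is a queue of
edges of `G`. In each round some edges are removed from the front of the queue, then a copy of `H`
in `E` which contains the first edge of the queue but is not contained in `G` is added to `G`, and
its new edges are put at the end of the queue. `Reach l H E T k s Q G` says that in `k` rounds one
can reach a graph with the property `T`, and that exactly `s` of the added copies are irregular,
i.e., meet the current graph in more vertices than those of one edge. -/
def Reach (l : ℕ) (H : Finset (Finset W)) (E : Set (Finset V)) (T : Finset (Finset V) → Prop) :
    ℕ → ℕ → List (Finset V) → Finset (Finset V) → Prop
  | 0, s, _, G => s = 0 ∧ T G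
  | k + 1, s, Q, G => ∃ f Q', (f :: Q') <:+ Q ∧ f ∈ G ∧ ∃ φ : W ↪ V,
      (copyEdges H φ : Set (Finset V)) ⊆ E ∧ f ∈ copyEdges H φ ∧ ¬ copyEdges H φ ⊆ G ∧
      ((#(oldVerts G φ) = l ∧ Reach l H E T k s (f :: Q' ++ (copyEdges H φ \ G).toList)
          (G ∪ copyEdges H φ)) ∨
        (#(oldVerts G φ) ≠ l ∧ ∃ s', s = s' + 1 ∧
          Reach l H E T k s' (f :: Q' ++ (copyEdges H φ \ G).toList) (G ∪ copyEdges H φ)))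

variable {l : ℕ} {H : Finset (Finset W)} {T T' : Finset (Finset V) → Prop}

lemma Reach.mono {E E' : Set (Finset V)} (hE : E ⊆ E') (hT : ∀ G, T G → T' G) :
    ∀ {k s : ℕ} {Q : List (Finset V)} {G : Finset (Finset V)},
      Reach l H E T k s Q G → Reach l H E' T' k s Q G
  | 0, _, _, _, h => ⟨h.1, hT _ h.2⟩
  | _ + 1, _, _, _, ⟨f, Q', hQ, hf, φ, hφ, hfφ, hG, h⟩ =>
    ⟨f, Q', hQ, hf, φ, hφ.trans hE, hfφ, hG, h.imp (fun h => ⟨h.1, h.2.mono hE hT⟩)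
      fun ⟨h, s', hs, h'⟩ => ⟨h, s', hs, h'.mono hE hT⟩⟩

/-- The regular (`r = True`) or irregular (`r = False`) copies that can be attached to the edge
`f` of `G`. -/
noncomputable def attach (l : ℕ) (H : Finset (Finset W)) (r : Prop) (f : Finset V)
    (G : Finset (Finset V)) : Finset (W ↪ V) := by
  classical
  exact {φ | f ∈ copyEdges H φ ∧ ¬ copyEdges H φ ⊆ G ∧ (#(oldVerts G φ) = l ↔ r)}

lemma mem_attach {r : Prop} {f : Finset V} {G : Finset (Finset V)} {φ : W ↪ V} :
    φ ∈ attach l H r f G ↔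
      f ∈ copyEdges H φ ∧ ¬ copyEdges H φ ⊆ G ∧ (#(oldVerts G φ) = l ↔ r) := by
  simp [attach]

/-- A first moment bound for the exploration of a random edge set `X`: the queue costs a factor `2`
per edge, a regular round a factor `2 ^ (#H + 2) * ε` and an irregular one a further factor
`η / ε`. -/
theorem reach_measure_le [MeasurableSpace Ω] (μ : Measure Ω) [IsFiniteMeasure μ]
    (X : Ω → Set (Finset V)) (w : Finset (Finset V) → ℝ) {κ ε η : ℝ} {M : ℕ}
    (hw : ∀ G, 0 ≤ w G) (hκ : 0 ≤ κ) (hε : 0 < ε) (hη : 0 ≤ η)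
    (hbase : ∀ G, T G → μ.real {ω | (G : Set (Finset V)) ⊆ X ω} ≤ κ * w G)
    (hreg : ∀ G, #(supp G) ≤ M → ∀ f ∈ G,
      ∑ φ ∈ attach l H True f G, w (G ∪ copyEdges H φ) ≤ ε * w G)
    (hirr : ∀ G, #(supp G) ≤ M → ∀ f ∈ G,
      ∑ φ ∈ attach l H False f G, w (G ∪ copyEdges H φ) ≤ η * w G) :
    ∀ (k s : ℕ) (Q : List (Finset V)) (G : Finset (Finset V)),
      #(supp G) + k * Fintype.card W ≤ M →
      μ.real {ω | (G : Set (Finset V)) ⊆ X ω ∧ Reach l H (X ω) T k s Q G} ≤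
        κ * w G * 2 ^ Q.length * (2 ^ (#H + 2) * ε) ^ k * (η / ε) ^ s := by
  intro k
  induction k with
  | zero =>
    intro s Q G _
    by_cases hs : s = 0
    · by_cases hT : T G
      · subst hs
        have h₁ : {ω | (G : Set (Finset V)) ⊆ X ω ∧ Reach l H (X ω) T 0 0 Q G} =
            {ω | (G : Set (Finset V)) ⊆ X ω} := by
          ext ω; simp [Reach, hT]
        rw [h₁]
        have h₂ : (1 : ℝ) ≤ 2 ^ Q.length := one_le_pow₀ (by norm_num)
        have h₃ := mul_nonneg hκ (hw G)
        have := hbase G hT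
        simp only [pow_zero, mul_one]
        nlinarith
      · have : {ω | (G : Set (Finset V)) ⊆ X ω ∧ Reach l H (X ω) T 0 s Q G} = ∅ := by
          ext ω; simp [Reach, hT]
        rw [this, measureReal_empty]
        have := hw G
        positivity
    · have : {ω | (G : Set (Finset V)) ⊆ X ω ∧ Reach l H (X ω) T 0 s Q G} = ∅ := by
        ext ω; simp [Reach, hs]
      rw [this, measureReal_empty]
      have := hw G
      positivity
  | succ k ih =>
    intro s Q G hM
    have hMG : #(supp G) ≤ M := by omega
    induction Q with
    | nil =>
      have : {ω | (G : Set (Finset V)) ⊆ X ω ∧ Reach l H (X ω) T (k + 1) s [] G} = ∅ := by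
        ext ω; simp [Reach]
      rw [this, measureReal_empty]
      have := hw G
      positivity
    | cons f Q ihQ =>
      set y := 2 ^ (#H + 2) * ε with hy
      -- the rounds in which a copy is attached to the first edge of the queue
      set R : Prop → ℕ → Set Ω := fun r t => ⋃ φ ∈ attach l H r f G,
        {ω | ((G ∪ copyEdges H φ : Finset _) : Set (Finset V)) ⊆ X ω ∧
          Reach l H (X ω) T k t (f :: Q ++ (copyEdges H φ \ G).toList) (G ∪ copyEdges H φ)} with hR
      have hRle : ∀ (r : Prop) (t : ℕ) (δ : ℝ),
          ∑ φ ∈ attach l H r f G, w (G ∪ copyEdges H φ) ≤ δ * w G →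
          μ.real (R r t) ≤ κ * (δ * w G) * 2 ^ (Q.length + 1 + #H) * y ^ k * (η / ε) ^ t := by
        intro r t δ hδ
        refine (measureReal_biUnion_finset_le _ _).trans ?_
        calc _ ≤ ∑ φ ∈ attach l H r f G,
              κ * w (G ∪ copyEdges H φ) * 2 ^ (Q.length + 1 + #H) * y ^ k * (η / ε) ^ t := by
              refine sum_le_sum fun φ _ => (ih t _ _ ?_).trans ?_
              · have := card_supp_union_le (H := H) (G := G) φ
                rw [add_mul] at hM
                omega
              · have := hw (G ∪ copyEdges H φ)
                have hy0 : 0 ≤ y := by positivity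
                have hlen : (f :: Q ++ (copyEdges H φ \ G).toList).length ≤
                    Q.length + 1 + #H := by
                  have h₁ : #(copyEdges H φ \ G) ≤ #H :=
                    (card_le_card sdiff_subset).trans (card_copyEdges φ).le
                  simp only [List.cons_append, List.length_cons, List.length_append, length_toList]
                  omega
                gcongr
                norm_num
          _ = κ * (∑ φ ∈ attach l H r f G, w (G ∪ copyEdges H φ)) * 2 ^ (Q.length + 1 + #H) *
              y ^ k * (η / ε) ^ t := by
              rw [mul_sum, sum_mul, sum_mul, sum_mul]
          _ ≤ _ := by
              have hy0 : 0 ≤ y := by positivity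
              gcongr
      have hfirst : ∀ {ω r} {φ : W ↪ V}, (G : Set (Finset V)) ⊆ X ω →
          (copyEdges H φ : Set (Finset V)) ⊆ X ω → f ∈ copyEdges H φ → ¬ copyEdges H φ ⊆ G →
          (#(oldVerts G φ) = l ↔ r) → ∀ t, Reach l H (X ω) T k t
            (f :: Q ++ (copyEdges H φ \ G).toList) (G ∪ copyEdges H φ) → ω ∈ R r t := by
        intro ω r φ hG hφ hf hn hr t ht
        simp only [hR, Set.mem_iUnion]
        refine ⟨φ, mem_attach.2 ⟨hf, hn, hr⟩, ?_, ht⟩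
        rw [coe_union]
        exact Set.union_subset hG hφ
      have hyk : κ * (ε * w G) * 2 ^ (Q.length + 1 + #H) * y ^ k * (η / ε) ^ s * 2 =
          κ * w G * 2 ^ Q.length * y ^ (k + 1) * (η / ε) ^ s := by
        rw [pow_succ, hy]; ring
      have hwG := hw G
      have hy0 : 0 ≤ y := by positivity
      have hpos : 0 ≤ κ * (ε * w G) * 2 ^ (Q.length + 1 + #H) * y ^ k * (η / ε) ^ s := by
        positivity
      have hgoal : κ * w G * 2 ^ (f :: Q).length * y ^ (k + 1) * (η / ε) ^ s =
          κ * w G * 2 ^ Q.length * y ^ (k + 1) * (η / ε) ^ s +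
          (κ * (ε * w G) * 2 ^ (Q.length + 1 + #H) * y ^ k * (η / ε) ^ s +
          κ * (ε * w G) * 2 ^ (Q.length + 1 + #H) * y ^ k * (η / ε) ^ s) := by
        rw [← mul_two (κ * (ε * w G) * _ * _ * _), hyk, List.length_cons, pow_succ]; ring
      rw [hgoal]
      by_cases hf : f ∈ G
      · rcases Nat.eq_zero_or_pos s with rfl | hs
        · have hsub : {ω | (G : Set (Finset V)) ⊆ X ω ∧ Reach l H (X ω) T (k + 1) 0 (f :: Q) G} ⊆
              {ω | (G : Set (Finset V)) ⊆ X ω ∧ Reach l H (X ω) T (k + 1) 0 Q G} ∪ R True 0 := by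
            rintro ω ⟨hG, f', Q', hQ, hf', φ, hφ, hfφ, hn, h⟩
            rcases List.suffix_cons_iff.1 hQ with hQ | hQ
            · obtain ⟨rfl, rfl⟩ := List.cons.inj hQ
              rcases h with ⟨h₁, h₂⟩ | ⟨-, s', hs', -⟩
              · exact Or.inr (hfirst hG hφ hfφ hn (iff_true_intro h₁) _ h₂)
              · omega
            · exact Or.inl ⟨hG, f', Q', hQ, hf', φ, hφ, hfφ, hn, h⟩
          refine (measureReal_mono hsub).trans ((measureReal_union_le _ _).trans ?_)
          have := hRle True 0 ε (hreg G hMG f hf)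
          linarith
        · obtain ⟨s, rfl⟩ := Nat.exists_eq_succ_of_ne_zero hs.ne'
          rw [Nat.succ_eq_add_one] at *
          have hsub : {ω | (G : Set (Finset V)) ⊆ X ω ∧
                Reach l H (X ω) T (k + 1) (s + 1) (f :: Q) G} ⊆
              {ω | (G : Set (Finset V)) ⊆ X ω ∧ Reach l H (X ω) T (k + 1) (s + 1) Q G} ∪
                (R True (s + 1) ∪ R False s) := by
            rintro ω ⟨hG, f', Q', hQ, hf', φ, hφ, hfφ, hn, h⟩
            rcases List.suffix_cons_iff.1 hQ with hQ | hQ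
            · obtain ⟨rfl, rfl⟩ := List.cons.inj hQ
              rcases h with ⟨h₁, h₂⟩ | ⟨h₁, s', hs', h₂⟩
              · exact Or.inr (Or.inl (hfirst hG hφ hfφ hn (iff_true_intro h₁) _ h₂))
              · obtain rfl : s = s' := by omega
                exact Or.inr (Or.inr (hfirst hG hφ hfφ hn (iff_false_intro h₁) _ h₂))
            · exact Or.inl ⟨hG, f', Q', hQ, hf', φ, hφ, hfφ, hn, h⟩
          refine (measureReal_mono hsub).trans ((measureReal_union_le _ _).trans ?_)
          have h₁ := hRle True (s + 1) ε (hreg G hMG f hf)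
          have h₂ := hRle False s η (hirr G hMG f hf)
          have h₃ : κ * (η * w G) * 2 ^ (Q.length + 1 + #H) * y ^ k * (η / ε) ^ s =
              κ * (ε * w G) * 2 ^ (Q.length + 1 + #H) * y ^ k * (η / ε) ^ (s + 1) := by
            rw [pow_succ]; field_simp
          rw [h₃] at h₂
          exact add_le_add ihQ ((measureReal_union_le _ _).trans (add_le_add h₁ h₂))
      · have hsub : {ω | (G : Set (Finset V)) ⊆ X ω ∧ Reach l H (X ω) T (k + 1) s (f :: Q) G} ⊆
            {ω | (G : Set (Finset V)) ⊆ X ω ∧ Reach l H (X ω) T (k + 1) s Q G} := by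
          rintro ω ⟨hG, f', Q', hQ, hf', h⟩
          rcases List.suffix_cons_iff.1 hQ with hQ | hQ
          · obtain ⟨rfl, rfl⟩ := List.cons.inj hQ
            exact absurd hf' hf
          · exact ⟨hG, f', Q', hQ, hf', h⟩
        have := measureReal_mono (μ := μ) hsub
        linarith

/-- The exploration of a minimal non-colourable `E` ends with `E`, unless it is stopped after `L`
rounds or after `r + 1` irregular rounds. -/
theorem MinBad.reach {E : Finset (Finset V)} (hE : MinBad H E) :
    ∀ (L r : ℕ) (Q : List (Finset V)) (G : Finset (Finset V)), G ⊆ E → G.Nonempty →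
      (∀ e ∈ G, e ∈ Q ∨ ∀ φ : W ↪ V, IsCopy H E φ → e ∈ copyEdges H φ → copyEdges H φ ⊆ G) →
      (∃ s ≤ r, Reach l H (E : Set (Finset V)) (fun _ => True) L s Q G) ∨
      (∃ k ≤ L, Reach l H (E : Set (Finset V)) (fun _ => True) k (r + 1) Q G) ∨
      (∃ k < L, ∃ s ≤ r, Reach l H (E : Set (Finset V)) (fun G => G = E) k s Q G) := by
  intro L
  induction L with
  | zero => exact fun r Q G _ _ _ => Or.inl ⟨0, Nat.zero_le _, rfl, trivial⟩
  | succ L ih =>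
    intro r Q G hGE hne hQ
    -- split the queue at the first edge to which a copy can be attached
    have key : (∀ e ∈ Q, e ∈ G → ∀ φ : W ↪ V, IsCopy H E φ → e ∈ copyEdges H φ →
          copyEdges H φ ⊆ G) ∨
        ∃ f Q', (f :: Q') <:+ Q ∧ f ∈ G ∧ (∃ φ : W ↪ V, IsCopy H E φ ∧ f ∈ copyEdges H φ ∧
          ¬ copyEdges H φ ⊆ G) ∧ ∀ e ∈ Q, e ∈ G → e ∈ f :: Q' ∨
            ∀ φ : W ↪ V, IsCopy H E φ → e ∈ copyEdges H φ → copyEdges H φ ⊆ G := by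
      clear hQ
      induction Q with
      | nil => left; simp
      | cons f Q ihQ =>
        by_cases hf : f ∈ G ∧ ∃ φ : W ↪ V, IsCopy H E φ ∧ f ∈ copyEdges H φ ∧ ¬ copyEdges H φ ⊆ G
        · exact Or.inr ⟨f, Q, List.suffix_rfl, hf.1, hf.2, fun e he _ => Or.inl he⟩
        · have hf' : f ∈ G → ∀ φ : W ↪ V, IsCopy H E φ → f ∈ copyEdges H φ →
              copyEdges H φ ⊆ G := by
            push Not at hf; exact hf
          rcases ihQ with h | ⟨f', Q', h₁, h₂, h₃, h₄⟩
          · left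
            intro e he heG
            rcases List.mem_cons.1 he with rfl | he
            · exact hf' heG
            · exact h e he heG
          · refine Or.inr ⟨f', Q', h₁.trans (List.suffix_cons _ _), h₂, h₃, fun e he heG => ?_⟩
            rcases List.mem_cons.1 he with rfl | he
            · exact Or.inr (hf' heG)
            · exact h₄ e he heG
    rcases key with h | ⟨f, Q', hsuf, hf, ⟨φ, hφ, hfφ, hn⟩, hQ'⟩
    · have : G = E := by
        refine hE.eq_of_closed hGE hne fun φ hφ ⟨x, hx, hxG⟩ => isCopy_iff.2 ?_
        have hxφ : x.map φ ∈ copyEdges H φ := mem_copyEdges.2 ⟨x, hx, rfl⟩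
        rcases hQ _ hxG with h' | h'
        · exact h _ h' hxG φ hφ hxφ
        · exact h' φ hφ hxφ
      exact Or.inr (Or.inr ⟨0, Nat.succ_pos _, 0, Nat.zero_le _, rfl, this⟩)
    · have hφE : (copyEdges H φ : Set (Finset V)) ⊆ E := by exact_mod_cast isCopy_iff.1 hφ
      have hnew := fun r => ih r (f :: Q' ++ (copyEdges H φ \ G).toList) (G ∪ copyEdges H φ)
        (union_subset hGE (isCopy_iff.1 hφ)) (hne.mono subset_union_left) (by
          intro e he
          rw [List.mem_append]
          by_cases heG : e ∈ G
          · rcases hQ e heG with h | h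
            · rcases hQ' e h heG with h | h
              · exact Or.inl (Or.inl h)
              · exact Or.inr fun ψ h₁ h₂ => (h ψ h₁ h₂).trans subset_union_left
            · exact Or.inr fun ψ h₁ h₂ => (h ψ h₁ h₂).trans subset_union_left
          · exact Or.inl (Or.inr (Finset.mem_toList.2
              (mem_sdiff.2 ⟨(mem_union.1 he).resolve_left heG, heG⟩))))
      by_cases hl : #(oldVerts G φ) = l
      · have lift : ∀ {T k s}, Reach l H (E : Set (Finset V)) T k s
            (f :: Q' ++ (copyEdges H φ \ G).toList) (G ∪ copyEdges H φ) →
            Reach l H (E : Set (Finset V)) T (k + 1) s Q G := fun h =>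
          ⟨f, Q', hsuf, hf, φ, hφE, hfφ, hn, Or.inl ⟨hl, h⟩⟩
        rcases hnew r with ⟨s, hs, h⟩ | ⟨k, hk, h⟩ | ⟨k, hk, s, hs, h⟩
        · exact Or.inl ⟨s, hs, lift h⟩
        · exact Or.inr (Or.inl ⟨k + 1, by omega, lift h⟩)
        · exact Or.inr (Or.inr ⟨k + 1, by omega, s, hs, lift h⟩)
      · have lift : ∀ {T k s}, Reach l H (E : Set (Finset V)) T k s
            (f :: Q' ++ (copyEdges H φ \ G).toList) (G ∪ copyEdges H φ) →
            Reach l H (E : Set (Finset V)) T (k + 1) (s + 1) Q G := fun {T k s} h =>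
          ⟨f, Q', hsuf, hf, φ, hφE, hfφ, hn, Or.inr ⟨hl, s, rfl, h⟩⟩
        cases r with
        | zero =>
          exact Or.inr (Or.inl ⟨1, by omega, lift (k := 0) (s := 0) ⟨rfl, trivial⟩⟩)
        | succ r =>
          rcases hnew r with ⟨s, hs, h⟩ | ⟨k, hk, h⟩ | ⟨k, hk, s, hs, h⟩
          · exact Or.inl ⟨s + 1, by omega, lift h⟩
          · exact Or.inr (Or.inl ⟨k + 1, by omega, lift h⟩)
          · exact Or.inr (Or.inr ⟨k + 1, by omega, s + 1, by omega, lift h⟩)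

end RainbowFree

/-! ### Counting the ways to attach a copy -/

namespace RainbowFree

open Finset MeasureTheory

section Counting

variable {V W : Type*} [DecidableEq V] [DecidableEq W] [Fintype V] [Fintype W]
variable {l : ℕ} {H : Finset (Finset W)}

lemma card_embeddings_le (S : Finset W) (A : Finset V) :
    #{φ : W ↪ V | ∀ w ∈ S, φ w ∈ A} ≤ #A ^ #S * Fintype.card V ^ (Fintype.card W - #S) := by
  have h₁ : #{φ : W ↪ V | ∀ w ∈ S, φ w ∈ A} ≤
      #(Fintype.piFinset fun w : W => if w ∈ S then A else univ) := by
    refine card_le_card_of_injOn (fun φ => φ) (fun φ hφ => ?_)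
      (fun φ _ ψ _ h => DFunLike.coe_injective h)
    simp only [coe_filter, mem_univ, true_and, Set.mem_ofPred_eq] at hφ
    simp only [mem_coe, Fintype.mem_piFinset]
    intro w
    split_ifs with h
    · exact hφ w h
    · exact mem_univ _
  refine h₁.trans (le_of_eq ?_)
  rw [Fintype.card_piFinset]
  simp only [apply_ite Finset.card, card_univ]
  rw [prod_ite, prod_const, prod_const, filter_mem_eq_inter, univ_inter]
  congr 2
  rw [filter_not, filter_mem_eq_inter, univ_inter, card_sdiff_of_subset (subset_univ _), card_univ]

lemma card_attach_regular_le (hH : ∀ h ∈ H, #h = l) (f : Finset V) (G : Finset (Finset V)) :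
    #(attach l H True f G) ≤ #H * (l ^ l * Fintype.card V ^ (Fintype.card W - l)) := by
  have h₁ : attach l H True f G ⊆ H.biUnion fun h =>
      ({φ : W ↪ V | #f = l ∧ ∀ w ∈ h, φ w ∈ f} : Finset _) := by
    intro φ hφ
    obtain ⟨h, hh, rfl⟩ := mem_copyEdges.1 (mem_attach.1 hφ).1
    simp only [mem_biUnion, mem_filter, mem_univ, true_and]
    exact ⟨h, hh, by simp [hH h hh], fun w hw => mem_map_of_mem φ hw⟩
  refine (card_le_card h₁).trans (card_biUnion_le_card_mul _ _ _ fun h hh => ?_)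
  by_cases hf : #f = l
  · have := card_embeddings_le h f
    simpa [hf, hH h hh] using this
  · simp [hf]

variable {w : Finset (Finset V) → ℝ} {G : Finset (Finset V)}

lemma sum_attach_regular_le (hH : ∀ h ∈ H, #h = l) {a b : ℝ} (ha : 0 ≤ a) (hw : 0 ≤ w G)
    (f : Finset V) (h : ∀ φ ∈ attach l H True f G, w (G ∪ copyEdges H φ) ≤ a * w G)
    (hab : (Fintype.card V : ℝ) ^ (Fintype.card W - l) * a ≤ b) :
    ∑ φ ∈ attach l H True f G, w (G ∪ copyEdges H φ) ≤ #H * l ^ l * b * w G := by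
  have h₁ : (#(attach l H True f G) : ℝ) ≤
      #H * (l ^ l * (Fintype.card V : ℝ) ^ (Fintype.card W - l)) := by
    exact_mod_cast card_attach_regular_le hH f G
  calc _ ≤ #(attach l H True f G) * (a * w G) := by
        simpa using sum_le_card_nsmul _ _ _ h
    _ ≤ #H * (l ^ l * (Fintype.card V : ℝ) ^ (Fintype.card W - l)) * (a * w G) := by
        gcongr
    _ = #H * l ^ l * ((Fintype.card V : ℝ) ^ (Fintype.card W - l) * a) * w G := by ring
    _ ≤ _ := by gcongr

lemma sum_attach_irregular_le [Nonempty V] {M : ℕ} (hM : #(supp G) ≤ M) (hM₁ : 1 ≤ M) {τ : ℝ}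
    (hτ : 0 ≤ τ) (hw : 0 ≤ w G) (f : Finset V)
    (h : ∀ φ ∈ attach l H False f G, w (G ∪ copyEdges H φ) *
      (Fintype.card V : ℝ) ^ (Fintype.card W - #(oldVerts G φ)) ≤ τ * w G) :
    ∑ φ ∈ attach l H False f G, w (G ∪ copyEdges H φ) ≤
      2 ^ Fintype.card W * (M : ℝ) ^ Fintype.card W * τ * w G := by
  have hV : (0 : ℝ) < Fintype.card V := by exact_mod_cast Fintype.card_pos
  have key : ∀ S ∈ (univ : Finset (Finset W)),
      ∑ φ ∈ attach l H False f G with oldVerts G φ = S, w (G ∪ copyEdges H φ) ≤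
        (M : ℝ) ^ Fintype.card W * τ * w G := by
    intro S _
    have h₁ : #{φ ∈ attach l H False f G | oldVerts G φ = S} ≤
        M ^ Fintype.card W * Fintype.card V ^ (Fintype.card W - #S) := by
      calc _ ≤ #{φ : W ↪ V | ∀ w ∈ S, φ w ∈ supp G} := by
            refine card_le_card fun φ hφ => ?_
            simp only [mem_filter, mem_univ, true_and] at hφ ⊢
            intro x hx
            rw [← hφ.2] at hx
            simpa [oldVerts] using hx
        _ ≤ _ := card_embeddings_le S _
        _ ≤ _ := by
            gcongr ?_ * _
            exact (Nat.pow_le_pow_left hM _).trans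
              (Nat.pow_le_pow_right hM₁ (card_le_univ S))
    have h₂ : (#{φ ∈ attach l H False f G | oldVerts G φ = S} : ℝ) ≤
        (M : ℝ) ^ Fintype.card W * (Fintype.card V : ℝ) ^ (Fintype.card W - #S) := by
      exact_mod_cast h₁
    set t := (Fintype.card V : ℝ) ^ (Fintype.card W - #S) with ht
    have ht0 : 0 < t := by positivity
    calc _ ≤ #{φ ∈ attach l H False f G | oldVerts G φ = S} • (τ * w G / t) := by
          refine sum_le_card_nsmul _ _ _ fun φ hφ => ?_
          rw [mem_filter] at hφ
          have := h φ hφ.1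
          rw [hφ.2] at this
          rwa [le_div_iff₀ ht0]
      _ ≤ (M : ℝ) ^ Fintype.card W * t * (τ * w G / t) := by
          rw [nsmul_eq_mul]; gcongr
      _ = _ := by field_simp
  rw [← sum_fiberwise_of_maps_to (t := univ) (g := oldVerts G) (fun φ _ => mem_univ _)]
  refine (sum_le_card_nsmul _ _ _ key).trans (le_of_eq ?_)
  simp [card_univ, mul_assoc]

end Counting

section Weights

variable {V W : Type*} [DecidableEq V] [DecidableEq W] [Fintype V] [Fintype W]
variable {l : ℕ} {H : Finset (Finset W)} {G : Finset (Finset V)} {f : Finset V} {φ : W ↪ V}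

lemma oldEdges_nonempty {r : Prop} (hf : f ∈ G) (h : φ ∈ attach l H r f G) :
    (oldEdges H G φ).Nonempty := by
  obtain ⟨x, hx, rfl⟩ := mem_copyEdges.1 (mem_attach.1 h).1
  exact ⟨x, mem_filter.2 ⟨hx, hf⟩⟩

lemma StrictBal.card_union_of_regular (hH : StrictBal l H) (hf : f ∈ G)
    (h : φ ∈ attach l H True f G) : #(G ∪ copyEdges H φ) = #G + (#H - 1) := by
  have h₁ := hH.card_oldEdges (oldEdges_nonempty hf h) ((mem_attach.1 h).2.2.2 trivial)
  have h₂ := card_union_copyEdges (H := H) (G := G) φ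
  have h₃ := card_le_card (oldEdges_subset (H := H) (G := G) φ)
  omega

lemma StrictBal.irregular (hH : StrictBal l H) (hf : f ∈ G) (h : φ ∈ attach l H False f G) :
    ∃ b, #(G ∪ copyEdges H φ) = #G + b ∧
      (#H - 1) * (Fintype.card W - #(oldVerts G φ)) + 1 ≤ (Fintype.card W - l) * b := by
  have hne := oldEdges_nonempty hf h
  have h₀ := mem_attach.1 h
  have h₁ : l + 1 ≤ #(oldVerts G φ) :=
    lt_of_le_of_ne (hH.le_card_oldVerts hne) fun h' => by simpa using h₀.2.2.1 h'.symm
  have h₂ := hH.old_lt h₁ (fun h' => h₀.2.1 (isCopy_iff.1 h'))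
  have h₃ := card_union_copyEdges (H := H) (G := G) φ
  have h₄ := card_le_card (oldEdges_subset (H := H) (G := G) φ)
  have h₅ := card_le_univ (oldVerts G φ)
  have h₆ := hne.card_pos
  have h₇ := hH.2.1
  refine ⟨#H - #(oldEdges H G φ), by omega, ?_⟩
  zify [h₄, h₅, (by omega : 1 ≤ #H), (by omega : l ≤ Fintype.card W)]
  nlinarith

variable {c ν : ℝ}

/-- The weight `(c ν ^ (v(H) - l)) ^ e(G)` bounds the probability that `G` is present. -/
lemma StrictBal.edgeWeight_regular (hH : StrictBal l H) (hc : 0 ≤ c) (hν : 0 < ν)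
    (hνV : ν ^ (#H - 1) * Fintype.card V = 1) (hf : f ∈ G) :
    ∑ φ ∈ attach l H True f G, (c * ν ^ (Fintype.card W - l)) ^ #(G ∪ copyEdges H φ) ≤
      #H * l ^ l * c ^ (#H - 1) * (c * ν ^ (Fintype.card W - l)) ^ #G := by
  refine sum_attach_regular_le (w := fun G => (c * ν ^ (Fintype.card W - l)) ^ #G) hH.1
    (a := (c * ν ^ (Fintype.card W - l)) ^ (#H - 1)) (by positivity) (by positivity) f
    (fun φ hφ => ?_) ?_
  · rw [hH.card_union_of_regular hf hφ, pow_add, mul_comm]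
  · rw [mul_pow, mul_left_comm, ← pow_mul, mul_comm (Fintype.card W - l), pow_mul, ← mul_pow,
      mul_comm (Fintype.card V : ℝ), hνV, one_pow, mul_one]

lemma StrictBal.edgeWeight_irregular [Nonempty V] (hH : StrictBal l H) (hc : 0 ≤ c) (hc₁ : c ≤ 1)
    (hν : 0 < ν) (hν₁ : ν ≤ 1) (hνV : ν ^ (#H - 1) * Fintype.card V = 1) {M : ℕ}
    (hM : #(supp G) ≤ M) (hM₁ : 1 ≤ M) (hf : f ∈ G) :
    ∑ φ ∈ attach l H False f G, (c * ν ^ (Fintype.card W - l)) ^ #(G ∪ copyEdges H φ) ≤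
      2 ^ Fintype.card W * (M : ℝ) ^ Fintype.card W * ν *
        (c * ν ^ (Fintype.card W - l)) ^ #G := by
  refine sum_attach_irregular_le (w := fun G => (c * ν ^ (Fintype.card W - l)) ^ #G) hM hM₁ hν.le
    (by positivity) f fun φ hφ => ?_
  obtain ⟨b, hb, hb'⟩ := hH.irregular hf hφ
  rw [hb, pow_add, mul_assoc, mul_comm ν]
  gcongr
  set a := Fintype.card W - #(oldVerts G φ)
  calc (c * ν ^ (Fintype.card W - l)) ^ b * (Fintype.card V : ℝ) ^ a
      ≤ (1 * ν ^ (Fintype.card W - l)) ^ b * (Fintype.card V : ℝ) ^ a := by gcongr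
    _ = ν ^ ((Fintype.card W - l) * b) * (Fintype.card V : ℝ) ^ a := by rw [one_mul, pow_mul]
    _ ≤ ν ^ ((#H - 1) * a + 1) * (Fintype.card V : ℝ) ^ a := by
        gcongr ?_ * _
        exact pow_le_pow_of_le_one hν.le hν₁ hb'
    _ = (ν ^ (#H - 1) * Fintype.card V) ^ a * ν := by rw [pow_succ, pow_mul, mul_pow]; ring
    _ = ν := by rw [hνV, one_pow, one_mul]

/-- The weight `c ^ e(G) N ^ (- v(G))`, where `N` is the number of vertices of the host, bounds the
probability that `G` is present if `G` has potential at most `0`. -/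
lemma StrictBal.vertexWeight_regular [Nonempty V] (hH : StrictBal l H) (hHs : supp H = univ)
    (hc : 0 ≤ c) (hf : f ∈ G) :
    ∑ φ ∈ attach l H True f G, c ^ #(G ∪ copyEdges H φ) *
        (1 / (Fintype.card V : ℝ)) ^ #(supp (G ∪ copyEdges H φ)) ≤
      #H * l ^ l * c ^ (#H - 1) * (c ^ #G * (1 / (Fintype.card V : ℝ)) ^ #(supp G)) := by
  have hV : (0 : ℝ) < Fintype.card V := by exact_mod_cast Fintype.card_pos
  refine sum_attach_regular_le
    (w := fun G => c ^ #G * (1 / (Fintype.card V : ℝ)) ^ #(supp G)) hH.1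
    (a := c ^ (#H - 1) * (1 / (Fintype.card V : ℝ)) ^ (Fintype.card W - l)) (by positivity)
    (by positivity) f (fun φ hφ => ?_) ?_
  · have h₁ := le_card_supp_union (G := G) hHs φ
    have h₂ := card_supp_union_le (G := G) (H := H) φ
    have h₃ := (mem_attach.1 hφ).2.2.2 trivial
    have h₄ := hH.2.1
    have h₅ : #(supp (G ∪ copyEdges H φ)) = #(supp G) + (Fintype.card W - l) := by omega
    rw [hH.card_union_of_regular hf hφ, h₅, pow_add, pow_add]
    exact le_of_eq (by ring)
  · rw [mul_left_comm, ← mul_pow, mul_one_div_cancel hV.ne', one_pow, mul_one]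

lemma StrictBal.vertexWeight_irregular [Nonempty V] (hH : StrictBal l H) (hHs : supp H = univ)
    (hc : 0 ≤ c) (hc₁ : c ≤ 1) {M : ℕ} (hM : #(supp G) ≤ M) (hM₁ : 1 ≤ M) (hf : f ∈ G) :
    ∑ φ ∈ attach l H False f G, c ^ #(G ∪ copyEdges H φ) *
        (1 / (Fintype.card V : ℝ)) ^ #(supp (G ∪ copyEdges H φ)) ≤
      2 ^ Fintype.card W * (M : ℝ) ^ Fintype.card W * 1 *
        (c ^ #G * (1 / (Fintype.card V : ℝ)) ^ #(supp G)) := by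
  have hV : (0 : ℝ) < Fintype.card V := by exact_mod_cast Fintype.card_pos
  refine sum_attach_irregular_le
    (w := fun G => c ^ #G * (1 / (Fintype.card V : ℝ)) ^ #(supp G)) hM hM₁ zero_le_one
    (by positivity) f fun φ hφ => ?_
  obtain ⟨b, hb, -⟩ := hH.irregular hf hφ
  have h₁ := le_card_supp_union (G := G) hHs φ
  have h₂ := card_supp_union_le (G := G) (H := H) φ
  have h₃ := card_le_univ (oldVerts G φ)
  have h₅ : #(supp (G ∪ copyEdges H φ)) =
    #(supp G) + (Fintype.card W - #(oldVerts G φ)) := by omega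
  rw [hb, h₅, pow_add, pow_add]
  calc _ = c ^ b * (c ^ #G * (1 / (Fintype.card V : ℝ)) ^ #(supp G)) *
        ((1 / (Fintype.card V : ℝ)) * Fintype.card V) ^ (Fintype.card W - #(oldVerts G φ)) := by
        rw [mul_pow]; ring
    _ = c ^ b * (c ^ #G * (1 / (Fintype.card V : ℝ)) ^ #(supp G)) := by
        rw [one_div_mul_cancel hV.ne', one_pow, mul_one]
    _ ≤ _ := by
        gcongr
        exact pow_le_one₀ hc hc₁

end Weights

/-- Powers of a polynomial in `k` are bounded by a multiple of `2 ^ k`. -/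
lemma exists_pow_le_two_pow (a : ℝ) (v s : ℕ) :
    ∃ A : ℝ, 0 < A ∧ ∀ k : ℕ, (a * ((v * (k + 1) : ℕ) : ℝ) ^ v) ^ s ≤ A * 2 ^ k := by
  have h := tendsto_pow_const_mul_const_pow_of_abs_lt_one (v * s) (r := (1 / 2 : ℝ))
    (by rw [abs_of_pos] <;> norm_num)
  obtain ⟨B, hB⟩ := h.bddAbove_range
  have hB' : ∀ k : ℕ, (k : ℝ) ^ (v * s) ≤ B * 2 ^ k := fun k => by
    have := hB ⟨k, rfl⟩
    simp only [one_div, inv_pow] at this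
    rwa [← div_eq_mul_inv, div_le_iff₀ (by positivity)] at this
  refine ⟨|a| ^ s * (v : ℝ) ^ (v * s) * |B| * 2 + 1, by positivity, fun k => ?_⟩
  calc (a * ((v * (k + 1) : ℕ) : ℝ) ^ v) ^ s
      ≤ |(a * ((v * (k + 1) : ℕ) : ℝ) ^ v) ^ s| := le_abs_self _
    _ = |a| ^ s * (v : ℝ) ^ (v * s) * ((k + 1 : ℕ) : ℝ) ^ (v * s) := by
        rw [abs_pow, abs_mul, abs_of_nonneg (a := ((v * (k + 1) : ℕ) : ℝ) ^ v) (by positivity)]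
        push_cast
        rw [mul_pow, mul_pow, mul_pow, ← pow_mul, ← pow_mul]; ring
    _ ≤ |a| ^ s * (v : ℝ) ^ (v * s) * (|B| * 2 ^ (k + 1)) := by
        gcongr
        exact (hB' (k + 1)).trans (by gcongr; exact le_abs_self B)
    _ = (|a| ^ s * (v : ℝ) ^ (v * s) * |B| * 2) * 2 ^ k := by rw [pow_succ]; ring
    _ ≤ _ := by gcongr; linarith

end RainbowFree

/-! ### Dense minimal bad hosts do not occur -/

namespace RainbowFree

open Finset MeasureTheory

lemma sum_pow_le_two {y : ℝ} (hy : 0 ≤ y) (hy' : y ≤ 1 / 2) (L : ℕ) :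
    ∑ k ∈ range L, y ^ k ≤ 2 := by
  have h := (summable_geometric_of_lt_one hy (by linarith)).sum_le_tsum (range L)
    fun k _ => pow_nonneg hy k
  rw [tsum_geometric_of_lt_one hy (by linarith)] at h
  refine h.trans ?_
  rw [inv_le_comm₀ (by linarith) two_pos]
  linarith

variable {W : Type*} [DecidableEq W] [Fintype W] {l : ℕ} {H : Finset (Finset W)}

set_option maxHeartbeats 1000000 in
/-- If `p ≤ c ν ^ (v(H) - l)`, where `ν ^ (e(H) - 1) = 1 / n`, i.e., if `p ≤ c n ^ (-1 / d)` for the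
`l`-density `d` of `H`, then with high probability the random edge set `X` contains no minimal
non-colourable set `E` with property `T`, where `T` is such that the expected number of copies
of `E` is small. -/
theorem StrictBal.exists_measure_le (hH : StrictBal l H) (hHs : supp H = univ) (hl : 1 ≤ l)
    (he : 2 ≤ #H) :
    ∃ c : ℝ, 0 < c ∧ c ≤ 1 ∧ ∃ C : ℝ, 0 < C ∧ ∀ (n : ℕ), 1 ≤ n →
      ∀ {Ω : Type} [MeasurableSpace Ω] (μ : Measure Ω) [IsFiniteMeasure μ]
        (X : Ω → Set (Finset (Fin n))) (p ν κ : ℝ) (T : Finset (Finset (Fin n)) → Prop),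
        0 ≤ p → 0 < ν → ν ^ (#H - 1) * n = 1 → p ≤ c * ν ^ (Fintype.card W - l) → 0 ≤ κ →
        (∀ G : Finset (Finset (Fin n)),
          μ.real {ω | (G : Set (Finset (Fin n))) ⊆ X ω} ≤ p ^ #G) →
        (∀ G : Finset (Finset (Fin n)), T G →
          p ^ #G ≤ κ * (c ^ #G * (1 / (n : ℝ)) ^ #(supp G))) →
        μ.real {ω | ∃ E : Finset (Finset (Fin n)), (E : Set (Finset (Fin n))) ⊆ X ω ∧
          MinBad H E ∧ T E} ≤ C * (κ + 1 / n) := by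
  classical
  set v := Fintype.card W with hv
  set e := #H with hedef
  have hvl : l + 1 ≤ v := hH.2.1
  -- the factor for regular rounds
  set ε : ℝ := Real.exp (-(l + 1 : ℝ)) / 2 ^ (e + 3) with hε
  have hεpos : 0 < ε := by positivity
  have hK : (1 : ℝ) ≤ e * l ^ l := by
    have : 1 ≤ e * l ^ l := Nat.one_le_iff_ne_zero.2 (by positivity)
    exact_mod_cast this
  obtain ⟨A, hA, hAk⟩ := exists_pow_le_two_pow (2 ^ v / ε) v ((l + 1) * (e - 1))
  set c : ℝ := min 1 (ε / (e * l ^ l)) with hc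
  have hcpos : 0 < c := lt_min one_pos (by positivity)
  have hc₁ : c ≤ 1 := min_le_left _ _
  have hcε : e * l ^ l * c ^ (e - 1) ≤ ε := by
    calc (e : ℝ) * l ^ l * c ^ (e - 1) ≤ e * l ^ l * c ^ 1 :=
          mul_le_mul_of_nonneg_left (pow_le_pow_of_le_one hcpos.le hc₁ (by omega)) (by positivity)
      _ ≤ e * l ^ l * (ε / (e * l ^ l)) := by
          rw [pow_one]; gcongr; exact min_le_right _ _
      _ = ε := by field_simp
  -- `r + 1` irregular rounds gain `ν ^ (r + 1) = n ^ (- (l + 1))`; this makes up for the weight of the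
  -- first copy, which is too large by a factor `n ^ l`
  obtain ⟨r, hr⟩ : ∃ r, (l + 1) * (e - 1) = r + 1 :=
    Nat.exists_eq_succ_of_ne_zero (Nat.mul_ne_zero (by omega) (by omega))
  refine ⟨c, hcpos, hc₁, 2 ^ e * A * (2 * (r + 1) + 2), by positivity, ?_⟩
  intro n hn Ω _ μ _ X p ν κ T hp hν hνn hpc hκ hX hT
  have : NeZero n := ⟨by omega⟩
  have hn₀ : (0 : ℝ) < n := by exact_mod_cast hn
  have hn₁ : (1 : ℝ) ≤ n := by exact_mod_cast hn
  have hcard : (Fintype.card (Fin n) : ℝ) = n := by simp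
  have hν₁ : ν ≤ 1 := by
    by_contra! h
    have : 1 < ν ^ (e - 1) := one_lt_pow₀ h (by omega)
    nlinarith
  -- `L` regular rounds gain `n ^ (- (l + 1))` as well
  set L := ⌈Real.log n⌉₊ with hL
  obtain ⟨y, hy⟩ : ∃ y : ℝ, y = 2 ^ (e + 2) * ε := ⟨_, rfl⟩
  have hy2 : 2 * y = Real.exp (-(l + 1 : ℝ)) := by
    rw [hy, hε, pow_succ 2 (e + 2)]; field_simp
  have hy0 : 0 < y := by rw [hy]; positivity
  have hyhalf : 2 * y ≤ 1 / 2 := by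
    rw [hy2]
    calc Real.exp (-(l + 1 : ℝ)) ≤ Real.exp (-1) := by
          apply Real.exp_le_exp.2; linarith [(Nat.cast_nonneg l : (0 : ℝ) ≤ l)]
      _ ≤ 1 / 2 := by
          rw [Real.exp_neg, inv_le_comm₀ (Real.exp_pos _) (by norm_num)]
          have := Real.add_one_le_exp (1 : ℝ); norm_num at this ⊢; linarith
  have hyL : (2 * y) ^ L * (n : ℝ) ^ (l + 1) ≤ 1 := by
    rw [hy2, ← Real.exp_nat_mul]
    calc Real.exp (L * -(l + 1 : ℝ)) * (n : ℝ) ^ (l + 1)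
        ≤ Real.exp (Real.log n * -(l + 1 : ℝ)) * (n : ℝ) ^ (l + 1) := by
          gcongr ?_ * _
          apply Real.exp_le_exp.2
          have := Nat.le_ceil (Real.log n)
          nlinarith [(Nat.cast_nonneg l : (0 : ℝ) ≤ l)]
      _ = 1 := by
          rw [← Real.rpow_def_of_pos hn₀, Real.rpow_neg hn₀.le,
            show (l + 1 : ℝ) = ((l + 1 : ℕ) : ℝ) by push_cast; rfl, Real.rpow_natCast]
          exact inv_mul_cancel₀ (by positivity)
  have hM₁ : ∀ k : ℕ, 1 ≤ v * (k + 1) := fun k =>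
    Nat.one_le_iff_ne_zero.2 (Nat.mul_ne_zero (by omega) (by omega))
  -- the factors for irregular rounds
  have hbk : ∀ k s : ℕ, s ≤ r + 1 →
      (2 ^ v * ((v * (k + 1) : ℕ) : ℝ) ^ v / ε) ^ s ≤ A * 2 ^ k := by
    intro k s hs
    have h₁ : 1 ≤ 2 ^ v * ((v * (k + 1) : ℕ) : ℝ) ^ v / ε := by
      rw [le_div_iff₀ hεpos, one_mul]
      have h₁ : ε ≤ 1 := by
        rw [hε, div_le_one (by positivity)]
        calc Real.exp (-(l + 1 : ℝ)) ≤ 1 := Real.exp_le_one_iff.2 (by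
              linarith [(Nat.cast_nonneg l : (0 : ℝ) ≤ l)])
          _ ≤ _ := one_le_pow₀ (by norm_num)
      have h₂ : (1 : ℝ) ≤ ((v * (k + 1) : ℕ) : ℝ) ^ v :=
        one_le_pow₀ (by exact_mod_cast hM₁ k)
      have h₃ : (1 : ℝ) ≤ 2 ^ v := one_le_pow₀ (by norm_num)
      nlinarith
    refine (pow_le_pow_right₀ h₁ (hs.trans hr.ge)).trans (le_trans (le_of_eq ?_) (hAk k))
    congr 1; ring
  set w₀ : Finset (Finset (Fin n)) → ℝ := fun G => (c * ν ^ (v - l)) ^ #G with hw₀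
  set w₁ : Finset (Finset (Fin n)) → ℝ := fun G => c ^ #G * (1 / (n : ℝ)) ^ #(supp G) with hw₁
  have hw₀0 : ∀ G, 0 ≤ w₀ G := fun G => by positivity
  have hw₁0 : ∀ G, 0 ≤ w₁ G := fun G => by positivity
  set η : ℕ → ℝ := fun k => 2 ^ v * ((v * (k + 1) : ℕ) : ℝ) ^ v with hη
  have hη0 : ∀ k, 0 ≤ η k := fun k => by positivity
  -- the events for the three possible outcomes of the exploration from the copy `φ`
  set R : (W ↪ Fin n) → (Finset (Finset (Fin n)) → Prop) → ℕ → ℕ → Set Ω := fun φ T k s =>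
    {ω | (copyEdges H φ : Set (Finset (Fin n))) ⊆ X ω ∧
      Reach l H (X ω) T k s (copyEdges H φ).toList (copyEdges H φ)} with hR
  have hsuppφ : ∀ φ : W ↪ Fin n, #(supp (copyEdges H φ)) = v := by
    intro φ
    have h₁ := le_card_supp_union (G := ∅) hHs φ
    have h₂ := card_supp_union_le (G := ∅) (H := H) φ
    have h₃ : oldVerts (∅ : Finset (Finset (Fin n))) φ = ∅ := by ext; simp [oldVerts, supp]
    simp only [empty_union, h₃, card_empty, add_zero] at h₁ h₂
    simp only [supp, biUnion_empty, card_empty, zero_add] at h₁ h₂ ⊢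
    omega
  have hreg₀ : ∀ (M : ℕ) (G : Finset (Finset (Fin n))), #(supp G) ≤ M → ∀ f ∈ G,
      ∑ φ ∈ attach l H True f G, w₀ (G ∪ copyEdges H φ) ≤ ε * w₀ G := fun M G _ f hf =>
    (hH.edgeWeight_regular hcpos.le hν (by rw [hcard]; exact hνn) hf).trans (by gcongr)
  have hreg₁ : ∀ (M : ℕ) (G : Finset (Finset (Fin n))), #(supp G) ≤ M → ∀ f ∈ G,
      ∑ φ ∈ attach l H True f G, w₁ (G ∪ copyEdges H φ) ≤ ε * w₁ G := fun M G _ f hf => by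
    have := hH.vertexWeight_regular hHs hcpos.le hf
    rw [hcard] at this
    exact this.trans (by gcongr)
  have hirr₀ : ∀ (k : ℕ) (G : Finset (Finset (Fin n))), #(supp G) ≤ v * (k + 1) → ∀ f ∈ G,
      ∑ φ ∈ attach l H False f G, w₀ (G ∪ copyEdges H φ) ≤ (η k * ν) * w₀ G :=
    fun k G hG f hf => hH.edgeWeight_irregular hcpos.le hc₁ hν hν₁ (by rw [hcard]; exact hνn)
      hG (hM₁ k) hf
  have hirr₁ : ∀ (k : ℕ) (G : Finset (Finset (Fin n))), #(supp G) ≤ v * (k + 1) → ∀ f ∈ G,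
      ∑ φ ∈ attach l H False f G, w₁ (G ∪ copyEdges H φ) ≤ η k * w₁ G := fun k G hG f hf => by
    have := hH.vertexWeight_irregular hHs hcpos.le hc₁ hG (hM₁ k) hf
    rwa [hcard, mul_one] at this
  have hbase₀ : ∀ G : Finset (Finset (Fin n)), True →
      μ.real {ω | (G : Set (Finset (Fin n))) ⊆ X ω} ≤ 1 * w₀ G := fun G _ => by
    rw [one_mul]
    exact (hX G).trans (pow_le_pow_left₀ hp hpc _)
  have hbase₁ : ∀ G : Finset (Finset (Fin n)), T G →
      μ.real {ω | (G : Set (Finset (Fin n))) ⊆ X ω} ≤ κ * w₁ G := fun G hG =>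
    (hX G).trans (hT G hG)
  have hlen : ∀ φ : W ↪ Fin n, (copyEdges H φ).toList.length = e := fun φ => by
    rw [length_toList, card_copyEdges]
  have hMk : ∀ (φ : W ↪ Fin n) (k : ℕ), #(supp (copyEdges H φ)) + k * v ≤ v * (k + 1) :=
    fun φ k => by rw [hsuppφ]; exact le_of_eq (by ring)
  have hP₀ : ∀ (φ : W ↪ Fin n) (k s : ℕ), μ.real (R φ (fun _ => True) k s) ≤
      w₀ (copyEdges H φ) * 2 ^ e * y ^ k * (η k * ν / ε) ^ s := fun φ k s => by
    have := reach_measure_le (l := l) (H := H) (T := fun _ => True) μ X w₀ hw₀0 zero_le_one hεpos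
      (η := η k * ν) (by have := hη0 k; positivity) hbase₀ (hreg₀ (v * (k + 1))) (hirr₀ k) k s
      (copyEdges H φ).toList (copyEdges H φ) (hMk φ k)
    rwa [hlen, one_mul, ← hy] at this
  have hP₁ : ∀ (φ : W ↪ Fin n) (k s : ℕ), μ.real (R φ T k s) ≤
      κ * w₁ (copyEdges H φ) * 2 ^ e * y ^ k * (η k / ε) ^ s := fun φ k s => by
    have := reach_measure_le (l := l) (H := H) (T := T) μ X w₁ hw₁0 hκ hεpos
      (hη0 k) hbase₁ (hreg₁ (v * (k + 1))) (hirr₁ k) k s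
      (copyEdges H φ).toList (copyEdges H φ) (hMk φ k)
    rwa [hlen, ← hy] at this
  -- the union bound
  have hsub : {ω | ∃ E : Finset (Finset (Fin n)), (E : Set (Finset (Fin n))) ⊆ X ω ∧
      MinBad H E ∧ T E} ⊆ ⋃ φ ∈ (univ : Finset (W ↪ Fin n)),
        ((⋃ s ∈ range (r + 1), R φ (fun _ => True) L s) ∪
        (⋃ k ∈ range (L + 1), R φ (fun _ => True) k (r + 1))) ∪
        ⋃ k ∈ range L, ⋃ s ∈ range (r + 1), R φ T k s := by
    rintro ω ⟨E, hEX, hE, hTE⟩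
    obtain ⟨f, hf⟩ := hE.nonempty (card_pos.1 (by omega))
    obtain ⟨φ, hφ, hfφ⟩ := hE.exists_copy hf
    have hφ' := isCopy_iff.1 hφ
    have hφX : (copyEdges H φ : Set (Finset (Fin n))) ⊆ X ω :=
      subset_trans (by exact_mod_cast hφ') hEX
    refine Set.mem_biUnion (mem_univ φ) ?_
    rcases hE.reach L r (copyEdges H φ).toList (copyEdges H φ) hφ' ⟨f, hfφ⟩
      (fun e he => Or.inl (Finset.mem_toList.2 he)) with ⟨s, hs, h⟩ | ⟨k, hk, h⟩ | ⟨k, hk, s, hs, h⟩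
    · exact Or.inl (Or.inl (Set.mem_biUnion (mem_range.2 (by omega : s < r + 1))
        ⟨hφX, h.mono hEX fun _ => id⟩))
    · exact Or.inl (Or.inr (Set.mem_biUnion (mem_range.2 (by omega : k < L + 1))
        ⟨hφX, h.mono hEX fun _ => id⟩))
    · exact Or.inr (Set.mem_biUnion (mem_range.2 hk) (Set.mem_biUnion
        (mem_range.2 (by omega : s < r + 1)) ⟨hφX, h.mono hEX fun G hG => hG ▸ hTE⟩))
  have hφsum : ∀ φ : W ↪ Fin n, μ.real (((⋃ s ∈ range (r + 1), R φ (fun _ => True) L s) ∪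
        (⋃ k ∈ range (L + 1), R φ (fun _ => True) k (r + 1))) ∪
        ⋃ k ∈ range L, ⋃ s ∈ range (r + 1), R φ T k s) ≤
      2 ^ e * A * (2 * (r + 1) + 2) * (κ + 1 / n) * (1 / n) ^ v := by
    intro φ
    have hnn : (1 / n : ℝ) * n = 1 := one_div_mul_cancel hn₀.ne'
    have hnn' : (n : ℝ) * (1 / n : ℝ) = 1 := mul_one_div_cancel hn₀.ne'
    -- the weight of a single copy
    have hw₀φ : w₀ (copyEdges H φ) ≤ (1 / n : ℝ) ^ v * (n : ℝ) ^ l := by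
      simp only [hw₀, card_copyEdges]
      have hνe : ν ^ (e - 1) = 1 / n := by field_simp; exact hνn
      calc (c * ν ^ (v - l)) ^ e ≤ (1 * ν ^ (v - l)) ^ e := by gcongr
        _ = ν ^ ((v - l) * e) := by rw [one_mul, ← pow_mul]
        _ ≤ ν ^ ((v - l) * (e - 1)) :=
            pow_le_pow_of_le_one hν.le hν₁ (by gcongr; omega)
        _ = (1 / n : ℝ) ^ (v - l) := by rw [mul_comm, pow_mul, hνe]
        _ = (1 / n : ℝ) ^ v * (n : ℝ) ^ l := by
            rw [← Nat.sub_add_cancel (by omega : l ≤ v), Nat.add_sub_cancel, pow_add, mul_assoc,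
              ← mul_pow, one_div_mul_cancel hn₀.ne', one_pow, mul_one]
    have hw₁φ : w₁ (copyEdges H φ) ≤ (1 / n : ℝ) ^ v := by
      simp only [hw₁, hsuppφ]
      exact mul_le_of_le_one_left (by positivity) (pow_le_one₀ hcpos.le hc₁)
    have b₁ : ∀ s ∈ range (r + 1), μ.real (R φ (fun _ => True) L s) ≤
        2 ^ e * A * (1 / n) * (1 / n) ^ v := by
      intro s hs
      calc _ ≤ _ := hP₀ φ L s
        _ ≤ ((1 / n : ℝ) ^ v * (n : ℝ) ^ l) * 2 ^ e * y ^ L * (A * 2 ^ L) := by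
            have h₁ : (η L * ν / ε) ^ s ≤ (η L / ε) ^ s := by
              have := hη0 L
              gcongr
              exact mul_le_of_le_one_right this hν₁
            have h₂ := h₁.trans (hbk L s (mem_range.1 hs).le)
            gcongr
        _ = 2 ^ e * A * (1 / n : ℝ) ^ v * (1 / n) * ((2 * y) ^ L * (n : ℝ) ^ (l + 1)) := by
            rw [mul_pow, pow_succ (n : ℝ)]
            linear_combination -((1 / n : ℝ) ^ v * (n : ℝ) ^ l * 2 ^ e * y ^ L * A * 2 ^ L) * hnn
        _ ≤ 2 ^ e * A * (1 / n : ℝ) ^ v * (1 / n) * 1 := by gcongr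
        _ = _ := by ring
    have b₂ : ∀ k ∈ range (L + 1), μ.real (R φ (fun _ => True) k (r + 1)) ≤
        (2 * y) ^ k * (2 ^ e * A * (1 / n) * (1 / n) ^ v) := by
      intro k _
      have hνr : ν ^ (r + 1) = (1 / n : ℝ) ^ (l + 1) := by
        have hνe : ν ^ (e - 1) = 1 / n := by field_simp; exact hνn
        rw [← hr, mul_comm, pow_mul, hνe]
      calc _ ≤ _ := hP₀ φ k (r + 1)
        _ = w₀ (copyEdges H φ) * 2 ^ e * y ^ k * ((η k / ε) ^ (r + 1) * ν ^ (r + 1)) := by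
            rw [← mul_pow]; ring
        _ ≤ ((1 / n : ℝ) ^ v * (n : ℝ) ^ l) * 2 ^ e * y ^ k *
            ((A * 2 ^ k) * (1 / n : ℝ) ^ (l + 1)) := by
            rw [hνr]
            have := hbk k (r + 1) le_rfl
            gcongr
        _ = _ := by
            have hnl : (n : ℝ) ^ l * (1 / n : ℝ) ^ l = 1 := by rw [← mul_pow, hnn', one_pow]
            rw [mul_pow 2 y, pow_succ (1 / n : ℝ)]
            linear_combination ((1 / n : ℝ) ^ v * 2 ^ e * y ^ k * A * 2 ^ k * (1 / n)) * hnl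
    have b₃ : ∀ k ∈ range L, μ.real (⋃ s ∈ range (r + 1), R φ T k s) ≤
        (2 * y) ^ k * ((r + 1) * (2 ^ e * A * κ * (1 / n) ^ v)) := by
      intro k _
      refine (measureReal_biUnion_finset_le _ _).trans ?_
      have : ∀ s ∈ range (r + 1), μ.real (R φ T k s) ≤
          (2 * y) ^ k * (2 ^ e * A * κ * (1 / n) ^ v) := by
        intro s hs
        calc _ ≤ _ := hP₁ φ k s
          _ ≤ κ * (1 / n : ℝ) ^ v * 2 ^ e * y ^ k * (A * 2 ^ k) := by
              have := hbk k s (mem_range.1 hs).le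
              gcongr
          _ = _ := by rw [mul_pow]; ring
      refine (sum_le_card_nsmul _ _ _ this).trans (le_of_eq ?_)
      rw [card_range, nsmul_eq_mul]; push_cast; ring
    have hy20 : 0 ≤ 2 * y := by positivity
    have s₁ : μ.real (⋃ s ∈ range (r + 1), R φ (fun _ => True) L s) ≤
        (r + 1) * (2 ^ e * A * (1 / n) * (1 / n) ^ v) := by
      refine (measureReal_biUnion_finset_le _ _).trans ?_
      refine (sum_le_card_nsmul _ _ _ b₁).trans (le_of_eq ?_)
      rw [card_range, nsmul_eq_mul]; push_cast; ring
    have s₂ : μ.real (⋃ k ∈ range (L + 1), R φ (fun _ => True) k (r + 1)) ≤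
        2 * (2 ^ e * A * (1 / n) * (1 / n) ^ v) := by
      refine (measureReal_biUnion_finset_le _ _).trans ((sum_le_sum b₂).trans ?_)
      rw [← sum_mul]
      gcongr
      exact sum_pow_le_two hy20 hyhalf _
    have s₃ : μ.real (⋃ k ∈ range L, ⋃ s ∈ range (r + 1), R φ T k s) ≤
        2 * ((r + 1) * (2 ^ e * A * κ * (1 / n) ^ v)) := by
      refine (measureReal_biUnion_finset_le _ _).trans ((sum_le_sum b₃).trans ?_)
      rw [← sum_mul]
      gcongr
      exact sum_pow_le_two hy20 hyhalf _
    refine (measureReal_union_le _ _).trans ((add_le_add ((measureReal_union_le _ _).trans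
      (add_le_add s₁ s₂)) s₃).trans ?_)
    have hZ : 0 ≤ 2 ^ e * A * (1 / n : ℝ) ^ v := by positivity
    have h1n : (0 : ℝ) ≤ 1 / n := by positivity
    have h₁ : 2 ^ e * A * (2 * (r + 1) + 2) * (κ + 1 / n) * (1 / n) ^ v -
        ((r + 1) * (2 ^ e * A * (1 / n) * (1 / n) ^ v) + 2 * (2 ^ e * A * (1 / n) * (1 / n) ^ v) +
        2 * ((r + 1) * (2 ^ e * A * κ * (1 / n) ^ v))) =
        (2 ^ e * A * (1 / n : ℝ) ^ v) * (2 * κ + (r + 1) * (1 / n)) := by ring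
    have h₂ : 0 ≤ (2 ^ e * A * (1 / n : ℝ) ^ v) * (2 * κ + (r + 1) * (1 / n)) := by positivity
    linarith
  have hcardφ : (Fintype.card (W ↪ Fin n) : ℝ) ≤ (n : ℝ) ^ v := by
    have : Fintype.card (W ↪ Fin n) ≤ n ^ v := by
      rw [Fintype.card_embedding_eq, Fintype.card_fin]
      exact Nat.descFactorial_le_pow _ _
    exact_mod_cast this
  calc _ ≤ _ := measureReal_mono hsub (measure_ne_top μ _)
    _ ≤ _ := measureReal_biUnion_finset_le _ _
    _ ≤ _ := sum_le_card_nsmul _ _ _ fun φ _ => hφsum φ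
    _ ≤ (n : ℝ) ^ v * (2 ^ e * A * (2 * (r + 1) + 2) * (κ + 1 / n) * (1 / n) ^ v) := by
        rw [nsmul_eq_mul, card_univ]
        gcongr
    _ = 2 ^ e * A * (2 * (r + 1) + 2) * (κ + 1 / n) * (n * (1 / n)) ^ v := by
        rw [mul_pow]; ring
    _ = _ := by rw [mul_one_div_cancel hn₀.ne', one_pow, mul_one]

end RainbowFree

/-! ### Peeling off vertices, and orientations -/

namespace RainbowFree

open Finset

variable {V W κ : Type*} [DecidableEq V] [DecidableEq W]
variable {H : Finset (Finset W)} {E : Finset (Finset V)}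

lemma twoBounded_of_card [DecidableEq κ] {c : Finset V → κ} (h : ∀ k, #{e ∈ E | c e = k} ≤ 2) :
    TwoBounded c E := by
  intro a ha b hb d hd hab hbd
  by_contra! hne
  refine absurd (h (c a)) (not_le.2 (two_lt_card.2 ⟨a, ?_, b, ?_, d, ?_, hne.1, hne.2.2, hne.2.1⟩))
    <;> simp [*]

/-- A set of at most `2 k` edges has a `2`-bounded colouring with `k` colours. -/
lemma exists_pairing {X : Finset (Finset V)} {k : ℕ} (hX : #X ≤ 2 * k) :
    ∃ c : Finset V → ℕ, (∀ e ∈ X, c e < k) ∧ TwoBounded c X := by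
  let f : Finset V → ℕ := fun e => if h : e ∈ X then (X.equivFin ⟨e, h⟩ : ℕ) else 0
  have hf : ∀ e (h : e ∈ X), f e = (X.equivFin ⟨e, h⟩ : ℕ) := fun e h => dif_pos h
  have hlt : ∀ e ∈ X, f e < #X := fun e h => by rw [hf e h]; exact Fin.is_lt _
  have hinj : ∀ a ∈ X, ∀ b ∈ X, f a = f b → a = b := by
    intro a ha b hb hab
    rw [hf a ha, hf b hb] at hab
    simpa using X.equivFin.injective (Fin.ext hab)
  refine ⟨fun e => f e / 2, fun e he => ?_, fun a ha b hb d hd hab hbd => ?_⟩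
  · have := hlt e he
    change f e / 2 < k
    omega
  · beta_reduce at hab hbd
    have h₁ := hinj a ha b hb
    have h₂ := hinj b hb d hd
    have h₃ := hinj a ha d hd
    have : f a = f b ∨ f b = f d ∨ f a = f d := by omega
    exact this.imp h₁ (Or.imp h₂ h₃)

lemma TwoBounded.glue {κ' : Type*} {A : Finset (Finset V)} {c₁ : Finset V → κ} {c₂ : Finset V → κ'}
    (h₁ : TwoBounded c₁ (E.filter (· ∈ A))) (h₂ : TwoBounded c₂ (E \ A)) :
    TwoBounded (fun e => if e ∈ A then (Sum.inl (c₁ e) : κ ⊕ κ') else Sum.inr (c₂ e)) E := by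
  intro a ha b hb d hd
  by_cases haE : a ∈ A <;> by_cases hbE : b ∈ A <;> by_cases hdE : d ∈ A <;>
    simp only [haE, hbE, hdE, if_true, if_false, Sum.inl.injEq, Sum.inr.injEq, reduceCtorEq,
      false_imp_iff, imp_true_iff]
  · exact h₁ a (by simp [*]) b (by simp [*]) d (by simp [*])
  · exact h₂ a (by simp [*]) b (by simp [*]) d (by simp [*])

lemma deg_eq_zero {x : V} (hx : x ∉ supp E) : deg E x = 0 := by
  rw [deg, card_eq_zero, filter_eq_empty_iff]
  exact fun e he hxe => hx (mem_supp.2 ⟨e, he, hxe⟩)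

/-- Double counting of incidences. -/
lemma sum_deg {l : ℕ} (hl : ∀ e ∈ E, #e = l) : ∑ x ∈ supp E, deg E x = l * #E := by
  simp only [deg, card_filter]
  rw [sum_comm, mul_comm, ← smul_eq_mul, ← sum_const]
  refine sum_congr rfl fun e he => ?_
  rw [← card_filter, filter_mem_eq_inter, inter_eq_right.2 (subset_supp he), hl e he]

/-- Deleting a vertex: its degree in a strictly balanced pattern exceeds the density. -/
lemma StrictBal.lt_deg [Fintype W] {l : ℕ} (hH : StrictBal l H) (hv : l + 2 ≤ Fintype.card W)
    (i : W) : (#H : ℤ) - 1 < deg H i * (Fintype.card W - l) := by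
  have h₁ : #(univ.erase i) = Fintype.card W - 1 := by rw [card_erase_of_mem (mem_univ _), card_univ]
  have h := hH.2.2 (univ.erase i) {h ∈ H | i ∉ h} (filter_subset _ _)
    (fun h hh x hx => by
      refine mem_erase.2 ⟨?_, mem_univ _⟩
      rintro rfl
      exact (mem_filter.1 hh).2 hx)
    (by omega) (Or.inl fun h => notMem_erase i univ (h.symm ▸ mem_univ i))
  have h₂ : deg H i + #{h ∈ H | i ∉ h} = #H := card_filter_add_card_filter_not _
  rw [h₁] at h
  zify [(by omega : 1 ≤ Fintype.card W)] at h h₂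
  nlinarith

/-- If at most `m` colours occur at the vertex `φ i`, and at least `m` edges of the pattern contain
`i`, then in a rainbow copy each of the colours is used at `φ i`. -/
lemma forall_colour_used [DecidableEq κ] {c : Finset V → κ} {φ : W ↪ V} {i : W} {m : ℕ} {C : Finset κ}
    (hC : #C ≤ m) (hm : m ≤ deg H i) (hcC : ∀ h ∈ H, i ∈ h → c (h.map φ) ∈ C)
    (hinj : ∀ h₁ ∈ H, ∀ h₂ ∈ H, i ∈ h₁ → i ∈ h₂ → c (h₁.map φ) = c (h₂.map φ) → h₁ = h₂) :
    deg H i = m ∧ ∀ k ∈ C, ∃ h ∈ H, i ∈ h ∧ c (h.map φ) = k := by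
  have h₁ : #(({h ∈ H | i ∈ h} : Finset _).image fun h => c (h.map φ)) = deg H i := by
    refine card_image_of_injOn fun a ha b hb hab => ?_
    simp only [coe_filter, Set.mem_ofPred_eq] at ha hb
    exact hinj a ha.1 b hb.1 ha.2 hb.2 hab
  have h₂ : (({h ∈ H | i ∈ h} : Finset _).image fun h => c (h.map φ)) ⊆ C := by
    intro x hx
    simp only [mem_image, mem_filter] at hx
    obtain ⟨h, hh, rfl⟩ := hx
    exact hcC h hh.1 hh.2
  have h₃ := card_le_card h₂
  refine ⟨by omega, fun k hk => ?_⟩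
  rw [← eq_of_subset_of_card_le h₂ (by omega)] at hk
  simp only [mem_image, mem_filter] at hk
  obtain ⟨h, hh, rfl⟩ := hk
  exact ⟨h, hh.1, hh.2, rfl⟩

/-- The basic peeling step in graphs. Let all degrees of the pattern be at least `k + 1`, and let
`S` be a set of vertices of the host such that at most two edges lie inside `S`, and every vertex of
`S` is in at most `2 k` other edges. Give the edges inside `S` the same colour, and pair up the other
edges at each vertex of `S`. Then every vertex in `S` sees at most `k + 1` colours, so that a rainbow
copy with a vertex in `S` uses an edge inside `S`, and both ends of this edge have degree `k + 1` in
the copy. -/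
lemma MinBad.exists_edge_of_few_edges [Finite V] (hE : MinBad H E) {k : ℕ} (hH : ∀ h ∈ H, #h = 2)
    (hk : ∀ i, k + 1 ≤ deg H i) {S : Finset V} (hS : ∃ e ∈ E, ∃ x ∈ S, x ∈ e)
    (hin : #{e ∈ E | e ⊆ S} ≤ 2) (hout : ∀ x ∈ S, #{e ∈ E | x ∈ e ∧ ¬ e ⊆ S} ≤ 2 * k) :
    (∃ e ∈ E, e ⊆ S) ∧ ∃ h ∈ H, ∀ i ∈ h, deg H i = k + 1 := by
  choose! p hp₁ hp₂ using fun x hx => exists_pairing (hout x hx)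
  have hEc : ∀ e ∈ E, #e = 2 := fun e he => hE.card_eq hH he
  -- an edge that meets `S` but is not inside `S` has exactly one vertex in `S`
  have hone : ∀ e ∈ E, ¬ e ⊆ S → ∀ x ∈ S, x ∈ e → e ∩ S = {x} := by
    intro e he heS x hx hxe
    have h₁ : #(e ∩ S) < #e := card_lt_card
      ((ssubset_iff_subset_ne).2 ⟨inter_subset_left, fun h => heS (inter_eq_left.1 h)⟩)
    have h₂ : {x} ⊆ e ∩ S := by simp [hx, hxe]
    exact (eq_of_subset_of_card_le h₂ (by rw [hEc e he] at h₁; simp; omega)).symm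
  set A : Finset (Finset V) := {e ∈ E | e ⊆ S} with hA
  set E₁ : Finset (Finset V) := {e ∈ E | ∃ x ∈ S, x ∈ e} with hE₁
  set c : Finset V → Unit ⊕ (Finset V × ℕ) := fun e =>
    if e ∈ A then Sum.inl () else Sum.inr (e ∩ S, ∑ x ∈ e ∩ S, p x e) with hc
  have hcA : ∀ e ∈ E, e ⊆ S → c e = Sum.inl () := fun e he heS => if_pos (by simp [hA, he, heS])
  have hcS : ∀ e ∈ E, ¬ e ⊆ S → ∀ x ∈ S, x ∈ e → c e = Sum.inr ({x}, p x e) := by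
    intro e he heS x hx hxe
    have : e ∉ A := by simp [hA, heS]
    simp only [hc, this, if_false, hone e he heS x hx hxe, sum_singleton]
  have hbdd : TwoBounded c E₁ := by
    refine TwoBounded.glue (fun a ha b hb d hd _ _ => ?_) (fun a ha b hb d hd hab hbd => ?_)
    · by_contra! hne
      refine absurd hin (not_le.2 (two_lt_card.2 ⟨a, ?_, b, ?_, d, ?_, hne.1, hne.2.2, hne.2.1⟩))
      · exact (mem_filter.1 ha).2
      · exact (mem_filter.1 hb).2
      · exact (mem_filter.1 hd).2
    · have hmem : ∀ e ∈ E₁ \ A, e ∈ E ∧ ¬ e ⊆ S ∧ ∃ x ∈ S, x ∈ e := by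
        intro e he
        simp only [hE₁, hA, Finset.mem_sdiff, mem_filter] at he
        exact ⟨he.1.1, fun h => he.2 ⟨he.1.1, h⟩, he.1.2⟩
      obtain ⟨haE, haS, x, hx, hxa⟩ := hmem a ha
      obtain ⟨hbE, hbS, y, hy, hyb⟩ := hmem b hb
      obtain ⟨hdE, hdS, z, hz, hzd⟩ := hmem d hd
      simp only [hone a haE haS x hx hxa, hone b hbE hbS y hy hyb, hone d hdE hdS z hz hzd,
        sum_singleton, Prod.mk.injEq, singleton_inj] at hab hbd
      obtain ⟨rfl, hab⟩ := hab
      obtain ⟨rfl, hbd⟩ := hbd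
      exact hp₂ x hx a (by simp [*]) b (by simp [*]) d (by simp [*]) hab hbd
  have hE₁ne : E₁.Nonempty := by
    obtain ⟨e, he, hx⟩ := hS
    exact ⟨e, by simp only [hE₁, mem_filter]; exact ⟨he, hx⟩⟩
  by_contra hcon
  refine hE.1 (Colourable.of_peel c hbdd (fun φ hφ hφ₁ => ?_)
    (hE.colourable_sdiff (filter_subset _ _) hE₁ne))
  by_contra! hrb
  have hE₁mem : ∀ h ∈ H, ∀ i ∈ h, φ i ∈ S → h.map φ ∈ E₁ := fun h hh i hi hiS => by
    simp only [hE₁, mem_filter]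
    exact ⟨hφ h hh, φ i, hiS, mem_map_of_mem φ hi⟩
  -- every vertex of the copy in `S` is in an edge inside `S`
  have key : ∀ i, φ i ∈ S → deg H i = k + 1 ∧ ∃ h ∈ H, i ∈ h ∧ h.map φ ⊆ S := by
    intro i hi
    have h := forall_colour_used (c := c) (φ := φ) (i := i) (m := k + 1)
      (C := insert (Sum.inl ()) ((range k).image fun j => Sum.inr ({φ i}, j))) ?_ (hk i) ?_ ?_
    · refine ⟨h.1, ?_⟩
      obtain ⟨h', hh', hih', hch'⟩ := h.2 (Sum.inl ()) (mem_insert_self _ _)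
      refine ⟨h', hh', hih', ?_⟩
      by_contra hnot
      rw [hcS _ (hφ h' hh') hnot (φ i) hi (mem_map_of_mem φ hih')] at hch'
      simp at hch'
    · exact (card_insert_le _ _).trans (by simpa using card_image_le.trans (card_range k).le)
    · intro h hh hih
      by_cases hin' : h.map φ ⊆ S
      · rw [hcA _ (hφ h hh) hin']
        exact mem_insert_self _ _
      · rw [hcS _ (hφ h hh) hin' (φ i) hi (mem_map_of_mem φ hih)]
        refine mem_insert_of_mem (mem_image.2 ⟨_, mem_range.2 (hp₁ (φ i) hi _ ?_), rfl⟩)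
        simp only [mem_filter]
        exact ⟨hφ h hh, mem_map_of_mem φ hih, hin'⟩
    · intro h₁ hh₁ h₂ hh₂ hi₁ hi₂ hc'
      by_contra hne
      exact hrb h₁ hh₁ h₂ hh₂ hne (hE₁mem h₁ hh₁ i hi₁ hi) (hE₁mem h₂ hh₂ i hi₂ hi) hc'
  obtain ⟨h, hh, hhE⟩ := hφ₁
  obtain ⟨x, hx, hxh⟩ := (mem_filter.1 hhE).2
  obtain ⟨i, hi, rfl⟩ := mem_map.1 hxh
  obtain ⟨-, h', hh', -, hS'⟩ := key i hx
  exact hcon ⟨⟨_, hφ h' hh', hS'⟩, h', hh', fun j hj => (key j (hS' (mem_map_of_mem φ hj))).1⟩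

/-- Orient the edges such that every vertex has out-degree at most `m`, and pair up the edges
leaving each vertex. A copy with `v` vertices sees at most `v ⌈m / 2⌉` colours, so it is not rainbow
if it has more edges. -/
lemma colourable_of_orientation [Fintype V] [Fintype W] {m : ℕ}
    (hE : ∀ G ⊆ E, #G ≤ m * #(supp G))
    (hH : Fintype.card W * ((m + 1) / 2) < #H) : Colourable H E := by
  have hall : ∀ s : Finset E, #s ≤ #(s.biUnion fun e => (e : Finset V) ×ˢ range m) := by
    intro s
    have h₁ : (s.biUnion fun e => (e : Finset V) ×ˢ range m) =
        supp (s.map ⟨Subtype.val, Subtype.val_injective⟩) ×ˢ range m := by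
      ext ⟨x, j⟩
      simp [supp, ← and_assoc]
    rw [h₁, card_product, card_range, mul_comm]
    refine le_trans (by rw [card_map]) (hE (s.map ⟨Subtype.val, Subtype.val_injective⟩) ?_)
    intro e he
    obtain ⟨e', -, rfl⟩ := mem_map.1 he
    exact e'.2
  obtain ⟨f, hf, hfm⟩ := (all_card_le_biUnion_card_iff_exists_injective _).1 hall
  simp only [mem_product, mem_range] at hfm
  set g : Finset V → Option (V × ℕ) := fun e =>
    if h : e ∈ E then some ((f ⟨e, h⟩).1, (f ⟨e, h⟩).2 / 2) else none with hg
  have hge : ∀ e (h : e ∈ E), g e = some ((f ⟨e, h⟩).1, (f ⟨e, h⟩).2 / 2) := fun e h => dif_pos h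
  refine colourable_of g (fun a ha b hb d hd hab hbd => ?_) (fun φ hφ => ?_)
  · rw [hge a ha, hge b hb] at hab
    rw [hge b hb, hge d hd] at hbd
    simp only [Option.some.injEq, Prod.mk.injEq] at hab hbd
    have key : ∀ x y : E, (f x).1 = (f y).1 → (f x).2 = (f y).2 → (x : Finset V) = y :=
      fun x y h₁ h₂ => congrArg Subtype.val (hf (Prod.ext h₁ h₂))
    have : (f ⟨a, ha⟩).2 = (f ⟨b, hb⟩).2 ∨ (f ⟨b, hb⟩).2 = (f ⟨d, hd⟩).2 ∨
      (f ⟨a, ha⟩).2 = (f ⟨d, hd⟩).2 := by omega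
    rcases this with h | h | h
    · exact Or.inl (key _ _ hab.1 h)
    · exact Or.inr (Or.inl (key _ _ hbd.1 h))
    · exact Or.inr (Or.inr (key _ _ (hab.1.trans hbd.1) h))
  · have hmap : ∀ h ∈ H, g (h.map φ) ∈
        ((univ.map φ) ×ˢ range ((m + 1) / 2)).image (some : V × ℕ → Option (V × ℕ)) := by
      intro h hh
      rw [hge _ (hφ h hh)]
      have h₁ := hfm ⟨h.map φ, hφ h hh⟩
      refine mem_image_of_mem _ (mem_product.2 ⟨?_, mem_range.2 ?_⟩)
      · exact map_subset_map.2 (subset_univ h) h₁.1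
      · have := h₁.2
        change _ / 2 < _
        omega
    obtain ⟨h₁, hh₁, h₂, hh₂, hne, heq⟩ := exists_ne_map_eq_of_card_lt_of_maps_to
      (lt_of_le_of_lt (card_image_le.trans (by simp)) hH) hmap
    exact ⟨h₁, hh₁, h₂, hh₂, hne, heq⟩

end RainbowFree

/-! ### Degrees in minimal bad graphs, and discharging -/

namespace RainbowFree

open Finset

variable {V W κ : Type*} [DecidableEq V] [DecidableEq W] [Fintype V]
variable {H : Finset (Finset W)} {E : Finset (Finset V)}

/-- The neighbours of `x` in the graph `E`. -/
def nbrs (E : Finset (Finset V)) (x : V) : Finset V := {y | y ≠ x ∧ {x, y} ∈ E}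

lemma mem_nbrs {x y : V} : y ∈ nbrs E x ↔ y ≠ x ∧ {x, y} ∈ E := by simp [nbrs]

lemma mem_nbrs_comm {x y : V} : y ∈ nbrs E x ↔ x ∈ nbrs E y := by
  rw [mem_nbrs, mem_nbrs, pair_comm, ne_comm]

lemma exists_eq_pair {e : Finset V} (he : #e = 2) {x : V} (hx : x ∈ e) :
    ∃ y, y ≠ x ∧ e = {x, y} := by
  obtain ⟨a, b, hab, rfl⟩ := card_eq_two.1 he
  rcases mem_insert.1 hx with rfl | h
  · exact ⟨b, hab.symm, rfl⟩
  · rw [mem_singleton] at h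
    subst h
    exact ⟨a, hab, pair_comm _ _⟩

lemma filter_mem_eq_image_nbrs (hE : ∀ e ∈ E, #e = 2) (x : V) :
    ({e ∈ E | x ∈ e} : Finset _) = (nbrs E x).image fun y => {x, y} := by
  ext e
  simp only [mem_filter, mem_image, mem_nbrs]
  constructor
  · rintro ⟨he, hx⟩
    obtain ⟨y, hy, rfl⟩ := exists_eq_pair (hE e he) hx
    exact ⟨y, ⟨hy, he⟩, rfl⟩
  · rintro ⟨y, ⟨-, hy⟩, rfl⟩
    exact ⟨hy, by simp⟩

lemma pair_left_cancel {x y z : V} (hy : y ≠ x) (h : ({x, y} : Finset V) = {x, z}) :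
    y = z := by
  have : y ∈ ({x, z} : Finset V) := h ▸ by simp
  simpa [hy] using this

lemma card_nbrs (hE : ∀ e ∈ E, #e = 2) (x : V) : #(nbrs E x) = deg E x := by
  rw [deg, filter_mem_eq_image_nbrs hE, card_image_of_injOn]
  intro y hy z _ h
  exact pair_left_cancel (mem_nbrs.1 hy).1 h

lemma mem_supp_of_mem_nbrs {x y : V} (h : y ∈ nbrs E x) : x ∈ supp E :=
  mem_supp.2 ⟨_, (mem_nbrs.1 h).2, by simp⟩

/-- If the density of `H` is at least `k + 1 / 2`, then no two vertices of degree `k + 1` are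
adjacent: deleting both would not decrease the density. -/
lemma StrictBal.not_forall_deg_eq [Fintype W] {k : ℕ} (hH : StrictBal 2 H)
    (hv : 5 ≤ Fintype.card W) (hk : (2 * k + 1) * (Fintype.card W - 2 : ℤ) ≤ 2 * (#H - 1)) :
    ¬ ∃ h ∈ H, ∀ i ∈ h, deg H i = k + 1 := by
  rintro ⟨h, hh, hdeg⟩
  obtain ⟨i, j, hij, rfl⟩ := card_eq_two.1 (hH.1 h hh)
  have hi := hdeg i (by simp)
  have hj := hdeg j (by simp)
  have h₁ : #(univ \ {i, j}) = Fintype.card W - 2 := by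
    rw [card_sdiff_of_subset (subset_univ _), card_univ, card_pair hij]
  have h₂ := hH.2.2 (univ \ {i, j}) {h ∈ H | i ∉ h ∧ j ∉ h} (filter_subset _ _)
    (fun h hh x hx => by
      have := (mem_filter.1 hh).2
      simp only [Finset.mem_sdiff, mem_univ, mem_insert, mem_singleton, true_and, not_or]
      exact ⟨fun h' => this.1 (h' ▸ hx), fun h' => this.2 (h' ▸ hx)⟩)
    (by omega) (Or.inl fun h => by
      have : i ∈ univ \ ({i, j} : Finset W) := by rw [h]; exact mem_univ i
      simp at this)
  have h₃ : #H + 1 ≤ #{h ∈ H | i ∉ h ∧ j ∉ h} + (deg H i + deg H j) := by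
    have a₁ : #{h ∈ H | i ∈ h ∨ j ∈ h} + #{h ∈ H | ¬ (i ∈ h ∨ j ∈ h)} = #H :=
      card_filter_add_card_filter_not _
    have a₂ := card_union_add_card_inter {h ∈ H | i ∈ h} {h ∈ H | j ∈ h}
    have a₃ : 1 ≤ #({h ∈ H | i ∈ h} ∩ {h ∈ H | j ∈ h}) :=
      card_pos.2 ⟨{i, j}, by simp [hh]⟩
    rw [← filter_or] at a₂
    simp only [not_or] at a₁
    simp only [deg]
    omega
  rw [h₁] at h₂
  zify [(by omega : 2 ≤ Fintype.card W)] at h₂ h₃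
  rw [hi, hj] at h₃
  push_cast at h₃
  nlinarith

/-- If all degrees of the pattern exceed `k`, then all degrees of a minimal bad graph exceed `2 k`: the
edges at a vertex of smaller degree could be paired up and deleted. -/
lemma MinBad.lt_deg (hE : MinBad H E) {k : ℕ} (hH : ∀ h ∈ H, #h = 2)
    (hk : ∀ i, k + 1 ≤ deg H i) {x : V} (hx : x ∈ supp E) : 2 * k + 1 ≤ deg E x := by
  by_contra! hlt
  obtain ⟨e, he, hxe⟩ := mem_supp.1 hx
  have hno : ∀ e ∈ E, ¬ e ⊆ {x} := fun e he h => by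
    have h₁ := card_le_card h
    rw [hE.card_eq hH he, card_singleton] at h₁
    omega
  obtain ⟨⟨e, he, heS⟩, -⟩ := hE.exists_edge_of_few_edges hH hk (S := {x})
    ⟨e, he, x, by simp, hxe⟩ (by rw [filter_false_of_mem hno]; simp) (fun y hy => by
      rw [mem_singleton.1 hy]
      refine (card_le_card (filter_subset_filter _ Subset.rfl)).trans
        (le_trans (card_le_card (t := {e ∈ E | x ∈ e}) ?_) (Nat.lt_succ_iff.1 hlt))
      intro e he
      simp only [mem_filter] at he ⊢
      exact ⟨he.1, he.2.1⟩)
  exact hno e he heS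

/-- If the pattern has no edge between two vertices of degree `k + 1`, then two vertices of degree
`2 k + 1`, the least possible one, in a minimal bad graph are not adjacent: otherwise the edges at
these two vertices could be coloured and deleted. -/
lemma MinBad.not_adjacent (hE : MinBad H E) {k : ℕ} (hH : ∀ h ∈ H, #h = 2)
    (hk : ∀ i, k + 1 ≤ deg H i) (hHk : ¬ ∃ h ∈ H, ∀ i ∈ h, deg H i = k + 1) {x y : V}
    (hx : deg E x = 2 * k + 1)
    (hy : deg E y = 2 * k + 1) : y ∉ nbrs E x := by
  intro hxy
  obtain ⟨hne, hxyE⟩ := mem_nbrs.1 hxy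
  have hin : ∀ e ∈ E, e ⊆ {x, y} → e = {x, y} := fun e he h =>
    eq_of_subset_of_card_le h (by rw [hE.card_eq hH he, card_pair hne.symm])
  refine hHk (hE.exists_edge_of_few_edges hH hk (S := {x, y})
    ⟨_, hxyE, x, by simp, by simp⟩ ?_ ?_).2
  · refine le_trans (card_le_card (t := {{x, y}}) fun e he => ?_) (by simp)
    rw [mem_singleton]
    exact hin e (mem_filter.1 he).1 (mem_filter.1 he).2
  · intro z hz
    have hz' : deg E z = 2 * k + 1 := by
      rcases mem_insert.1 hz with rfl | h
      · exact hx
      · rw [mem_singleton.1 h]; exact hy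
    have h₁ : ({e ∈ E | z ∈ e ∧ ¬ e ⊆ {x, y}} : Finset _) ⊆
        ({e ∈ E | z ∈ e} : Finset _).erase {x, y} := by
      intro e he
      simp only [mem_filter, mem_erase] at he ⊢
      exact ⟨fun h => he.2.2 h.le, he.1, he.2.1⟩
    have h₂ := card_le_card h₁
    rw [card_erase_of_mem (by simp only [mem_filter]; exact ⟨hxyE, hz⟩)] at h₂
    simp only [deg] at hz'
    omega

/-- Under the same assumption, a vertex of degree `2 k + 2` does not have two neighbours of degree
`2 k + 1`: otherwise the edges at these three vertices could be coloured and deleted. -/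
lemma MinBad.not_two_neighbours (hE : MinBad H E) {k : ℕ} (hH : ∀ h ∈ H, #h = 2)
    (hk : ∀ i, k + 1 ≤ deg H i) (hHk : ¬ ∃ h ∈ H, ∀ i ∈ h, deg H i = k + 1) {x y z : V}
    (hx : deg E x = 2 * k + 1) (hy : deg E y = 2 * k + 1)
    (hxy : x ≠ y) (hz : deg E z = 2 * k + 2) (hxz : x ∈ nbrs E z) (hyz : y ∈ nbrs E z) : False := by
  have hnxy := hE.not_adjacent hH hk hHk hx hy
  obtain ⟨hxz, hxzE⟩ := mem_nbrs.1 hxz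
  obtain ⟨hyz, hyzE⟩ := mem_nbrs.1 hyz
  set S : Finset V := {x, y, z} with hS
  have hin : ∀ e ∈ E, e ⊆ S → e = {z, x} ∨ e = {z, y} := by
    intro e he heS
    obtain ⟨a, b, hab, rfl⟩ := card_eq_two.1 (hE.card_eq hH he)
    have ha : a ∈ S := heS (by simp)
    have hb : b ∈ S := heS (by simp)
    simp only [hS, mem_insert, mem_singleton] at ha hb
    have h₁ : ({x, y} : Finset V) ∉ E := fun h => hnxy (mem_nbrs.2 ⟨hxy.symm, h⟩)
    rcases ha with rfl | rfl | rfl <;> rcases hb with rfl | rfl | rfl <;>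
      simp_all [pair_comm]
  refine hHk (hE.exists_edge_of_few_edges hH hk (S := S)
    ⟨_, hxzE, x, by simp [hS], by simp⟩ ?_ ?_).2
  · refine le_trans (card_le_card (t := {{z, x}, {z, y}}) fun e he => ?_) card_le_two
    rw [mem_insert, mem_singleton]
    exact hin e (mem_filter.1 he).1 (mem_filter.1 he).2
  · have hzx : ({z, x} : Finset V) ⊆ S := by intro t; simp [hS]; tauto
    have hzy : ({z, y} : Finset V) ⊆ S := by intro t; simp [hS]; tauto
    -- the degree of a vertex of `S`, without the edges `B` inside `S`
    have key : ∀ t (B : Finset (Finset V)), (∀ e ∈ B, e ∈ E ∧ t ∈ e ∧ e ⊆ S) →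
        #{e ∈ E | t ∈ e ∧ ¬ e ⊆ S} ≤ deg E t - #B := by
      intro t B hB
      have hB' : B ⊆ {e ∈ E | t ∈ e} := fun e he => by
        simp only [mem_filter]; exact ⟨(hB e he).1, (hB e he).2.1⟩
      rw [deg, ← card_sdiff_of_subset hB']
      refine card_le_card fun e he => ?_
      simp only [mem_filter, Finset.mem_sdiff] at he ⊢
      exact ⟨⟨he.1, he.2.1⟩, fun h => he.2.2 (hB e h).2.2⟩
    intro t ht
    simp only [hS, mem_insert, mem_singleton] at ht
    rcases ht with rfl | rfl | rfl
    · have := key t {{z, t}} (by simp [hxzE, hzx])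
      rw [card_singleton] at this
      omega
    · have := key t {{z, t}} (by simp [hyzE, hzy])
      rw [card_singleton] at this
      omega
    · have := key t {{t, x}, {t, y}} (by simp [hxzE, hyzE, hzx, hzy])
      rw [card_pair fun h => hxy (pair_left_cancel hxz h)] at this
      omega

/-- A discharging argument: with minimum degree `5`, no two adjacent vertices of degree `5`, and no
vertex of degree `6` with two neighbours of degree `5`, the average degree exceeds `17 / 3`. -/
lemma lt_card_of_deg (hE : ∀ e ∈ E, #e = 2) (hne : E.Nonempty) (h5 : ∀ x ∈ supp E, 5 ≤ deg E x)
    (hadj : ∀ x y, deg E x = 5 → deg E y = 5 → y ∉ nbrs E x)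
    (h6 : ∀ x y z, deg E x = 5 → deg E y = 5 → x ≠ y → deg E z = 6 → x ∈ nbrs E z →
      y ∉ nbrs E z) : 17 * #(supp E) < 6 * #E := by
  set A : Finset V := {x ∈ supp E | deg E x = 5} with hA
  set a : V → ℕ := fun x => #{y ∈ A | y ∈ nbrs E x} with ha
  have ha5 : ∀ x, deg E x = 5 → a x = 0 := by
    intro x hx
    rw [ha, card_eq_zero, filter_eq_empty_iff]
    exact fun y hy => hadj x y hx (mem_filter.1 hy).2
  have ha6 : ∀ x, deg E x = 6 → a x ≤ 1 := by
    intro x hx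
    refine card_le_one.2 fun y hy z hz => ?_
    simp only [hA, mem_filter] at hy hz
    by_contra hyz
    exact h6 y z x hy.1.2 hz.1.2 hyz hx hy.2 hz.2
  have hadeg : ∀ x, a x ≤ deg E x := by
    intro x
    rw [← card_nbrs hE]
    exact card_le_card fun y hy => (mem_filter.1 hy).2
  have hsum : ∑ x ∈ supp E, a x = 5 * #A := by
    simp only [ha, card_filter]
    rw [sum_comm, mul_comm, ← smul_eq_mul, ← sum_const]
    refine sum_congr rfl fun y hy => ?_
    rw [← card_filter, ← (mem_filter.1 hy).2, ← card_nbrs hE]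
    congr 1
    ext x
    rw [mem_filter, mem_nbrs_comm]
    exact ⟨fun h => h.2, fun h => ⟨mem_supp_of_mem_nbrs (mem_nbrs_comm.1 h), h⟩⟩
  have hd := sum_deg hE
  have hAsum : ∑ x ∈ supp E, (if deg E x = 5 then 10 else 0) = 10 * #A := by
    rw [← sum_filter, sum_const, smul_eq_mul, mul_comm]
  -- each vertex of degree `5` receives `2 / 15` from each of its neighbours, so that every vertex
  -- keeps at least `17 / 3`
  have hle : ∀ x ∈ supp E, 85 + 2 * a x ≤ 15 * deg E x + (if deg E x = 5 then 10 else 0) := by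
    intro x hx
    have h₁ := h5 x hx
    have h₂ := ha5 x
    have h₃ := ha6 x
    have h₄ := hadeg x
    split_ifs with h <;> omega
  -- only the vertices of degree `5` can attain equality
  have hlt : ∃ x ∈ supp E, 85 + 2 * a x < 15 * deg E x + (if deg E x = 5 then 10 else 0) := by
    obtain ⟨e, he⟩ := hne
    obtain ⟨x, y, hxy, rfl⟩ := card_eq_two.1 (hE e he)
    have hadj' : y ∈ nbrs E x := mem_nbrs.2 ⟨hxy.symm, he⟩
    have hmain : ∀ z ∈ supp E, deg E z ≠ 5 →
        85 + 2 * a z < 15 * deg E z + (if deg E z = 5 then 10 else 0) := by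
      intro z hz hz5
      have h₁ := h5 z hz
      have h₃ := ha6 z
      have h₄ := hadeg z
      rw [if_neg hz5]
      omega
    by_cases hx : deg E x = 5
    · by_cases hy : deg E y = 5
      · exact absurd hadj' (hadj x y hx hy)
      · exact ⟨y, mem_supp.2 ⟨_, he, by simp⟩, hmain y (mem_supp.2 ⟨_, he, by simp⟩) hy⟩
    · exact ⟨x, mem_supp.2 ⟨_, he, by simp⟩, hmain x (mem_supp.2 ⟨_, he, by simp⟩) hx⟩
  have h := sum_lt_sum hle hlt
  rw [sum_add_distrib, sum_add_distrib, ← mul_sum, ← mul_sum, hsum, hd, hAsum, sum_const,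
    smul_eq_mul] at h
  omega

end RainbowFree

/-! ### Regular hosts for the complete graph on four vertices -/

namespace RainbowFree

open Finset

variable {V W κ : Type*} [DecidableEq V] [DecidableEq W] [Fintype V] [Fintype W]
variable {H : Finset (Finset W)} {E : Finset (Finset V)} {q l : ℕ}

/-- If the pattern is complete, then a two-bounded partial colouring of a minimal bad graph leaves
some clique rainbow. -/
lemma MinBad.exists_clique (hE : MinBad H E) (hH : H = powersetCard l univ)
    (hW : Fintype.card W = q) {c : Finset V → κ} {E₁ : Finset (Finset V)} (h₁ : E₁ ⊆ E)
    (hne : E₁.Nonempty) (hc : TwoBounded c E₁) :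
    ∃ K, #K = q ∧ powersetCard l K ⊆ E ∧ (∃ f ∈ E₁, f ⊆ K) ∧
      ∀ f ∈ E₁, ∀ g ∈ E₁, f ⊆ K → g ⊆ K → c f = c g → f = g := by
  by_contra! hcon
  subst hH
  refine hE.1 (Colourable.of_peel c hc (fun φ hφ ⟨h, hh, hhE⟩ => ?_)
    (hE.colourable_sdiff h₁ hne))
  have hsub : ∀ f ⊆ univ.map φ, #f = l → ∃ h ∈ powersetCard l univ, h.map φ = f := by
    intro f hf hfl
    obtain ⟨h, -, rfl⟩ := subset_map_iff.1 hf
    exact ⟨h, by simpa using hfl, rfl⟩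
  obtain ⟨f, hf, g, hg, hfK, hgK, hfg, hne'⟩ := hcon (univ.map φ) (by simp [hW]) (fun f hf => by
    obtain ⟨hfK, hfl⟩ := mem_powersetCard.1 hf
    obtain ⟨h, hh, rfl⟩ := hsub f hfK hfl
    exact hφ h hh) ⟨_, hhE, map_subset_map.2 (subset_univ h)⟩
  have hl : ∀ f ∈ E₁, #f = l := fun f hf =>
    hE.card_eq (fun h hh => (mem_powersetCard.1 hh).2) (h₁ hf)
  obtain ⟨a, ha, rfl⟩ := hsub f hfK (hl f hf)
  obtain ⟨b, hb, rfl⟩ := hsub g hgK (hl g hg)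
  exact ⟨a, ha, b, hb, fun h => hne' (h ▸ rfl), hf, hg, hfg⟩

lemma pair_mem_of_mem_nbrs {x y : V} (h : y ∈ nbrs E x) : {x, y} ∈ E := (mem_nbrs.1 h).2

lemma mem_nbrs_of_clique {K : Finset V} (hK : powersetCard 2 K ⊆ E) {a b : V} (ha : a ∈ K)
    (hb : b ∈ K) (hab : a ≠ b) : b ∈ nbrs E a :=
  mem_nbrs.2 ⟨hab.symm, hK (mem_powersetCard.2 ⟨by simp [insert_subset_iff, ha, hb], card_pair hab⟩)⟩

set_option maxHeartbeats 1600000 in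
/-- In a `5`-regular minimal bad graph for `K₄`, the closed neighbourhoods are cliques. If `x` and `y`
did not span a `K₄` with the edge `u w`, then the edges at `u` and `w`, and possibly those at a
further neighbour `s` of `u`, could be coloured and deleted. -/
lemma MinBad.adj_of_regular (hE : MinBad H E) (hH : H = powersetCard 2 univ)
    (hW : Fintype.card W = 4) (hd : ∀ x ∈ supp E, deg E x = 5) {u w x y : V} (huw : w ∈ nbrs E u)
    (hx : x ∈ nbrs E u) (hy : y ∈ nbrs E u) (hxw : x ≠ w) (hyw : y ≠ w) (hxy : x ≠ y) :
    x ∈ nbrs E w ∧ y ∈ nbrs E w ∧ y ∈ nbrs E x := by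
  have hE2 : ∀ e ∈ E, #e = 2 := fun e he =>
    hE.card_eq (l := 2) (fun h hh => by rw [hH] at hh; exact (mem_powersetCard.1 hh).2) he
  have hcard : ∀ {a b}, b ∈ nbrs E a → #(nbrs E a) = 5 := fun h => by
    rw [card_nbrs hE2]; exact hd _ (mem_supp_of_mem_nbrs h)
  by_contra hcon
  obtain ⟨s, t, hst, hPst⟩ : ∃ s t, s ≠ t ∧ (((nbrs E u).erase w).erase x).erase y = {s, t} := by
    refine card_eq_two.1 ?_
    rw [card_erase_of_mem (by simp [*, hxy.symm]), card_erase_of_mem (by simp [*]),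
      card_erase_of_mem huw, hcard huw]
  have hP : ∀ z, z ∈ nbrs E u ↔ z = w ∨ z = x ∨ z = y ∨ z = s ∨ z = t := by
    intro z
    have := congrArg (z ∈ ·) hPst
    simp only [mem_erase, mem_insert, mem_singleton, eq_iff_iff] at this
    by_cases h₁ : z = w
    · simp [h₁, huw]
    by_cases h₂ : z = x
    · simp [h₂, hx]
    by_cases h₃ : z = y
    · simp [h₃, hy]
    · tauto
  have hs' : s ≠ y ∧ s ≠ x ∧ s ≠ w ∧ s ∈ nbrs E u := by
    have : s ∈ (((nbrs E u).erase w).erase x).erase y := by rw [hPst]; simp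
    simpa using this
  have ht' : t ≠ y ∧ t ≠ x ∧ t ≠ w ∧ t ∈ nbrs E u := by
    have : t ∈ (((nbrs E u).erase w).erase x).erase y := by rw [hPst]; simp
    simpa using this
  obtain ⟨hsy, hsx, hsw, hs⟩ := hs'
  obtain ⟨hty, htx, htw, ht⟩ := ht'
  have hne : ∀ {z}, z ∈ nbrs E u → z ≠ u := fun h => (mem_nbrs.1 h).1
  have hwu : u ∈ nbrs E w := mem_nbrs_comm.1 huw
  -- `Q₁` and `Q \ Q₁` are the colour classes at `w`; they are chosen such that no `K₄` through `u w`
  -- contains `x t` or `y s` and is rainbow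
  set Q := (nbrs E w).erase u with hQ
  have hQ4 : #Q = 4 := by rw [hQ, card_erase_of_mem hwu, hcard hwu]
  obtain ⟨Q₁, hQ₁, hQ₁2, hxt, hys⟩ : ∃ Q₁ ⊆ Q, #Q₁ = 2 ∧ (x ∈ Q → t ∈ Q → (x ∈ Q₁ ↔ t ∈ Q₁)) ∧
      (y ∈ Q → s ∈ Q → (y ∈ Q₁ ↔ s ∈ Q₁)) := by
    by_cases h₁ : x ∈ Q ∧ t ∈ Q
    · refine ⟨{x, t}, by simp [insert_subset_iff, h₁], card_pair htx.symm, by simp, ?_⟩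
      simp [hxy.symm, hsx, hty.symm, hst]
    by_cases h₂ : y ∈ Q ∧ s ∈ Q
    · exact ⟨{y, s}, by simp [insert_subset_iff, h₂], card_pair hsy.symm, fun a b => absurd ⟨a, b⟩ h₁, by simp⟩
    · obtain ⟨Q₁, h, h'⟩ := exists_subset_card_eq (show 2 ≤ #Q by omega)
      exact ⟨Q₁, h, h', fun a b => absurd ⟨a, b⟩ h₁, fun a b => absurd ⟨a, b⟩ h₂⟩
  -- if `s t` also spans a `K₄` with `u w`, then `s t` gets the colour of `u w`, and the remaining edges
  -- at `s` share a colour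
  set link : Prop := s ∈ nbrs E w ∧ t ∈ nbrs E w ∧ t ∈ nbrs E s with hlink
  set E₁ : Finset (Finset V) := {e ∈ E | u ∈ e ∨ w ∈ e ∨ (link ∧ s ∈ e)} with hE₁
  set c : Finset V → ℕ := fun e =>
    if u ∈ e then (if w ∈ e then 0 else if x ∈ e ∨ s ∈ e then 1 else 2)
    else if w ∈ e then (if ∃ z ∈ Q₁, z ∈ e then 3 else 4) else if t ∈ e then 0 else 5 with hc
  have hu : ∀ e ∈ E, u ∈ e → ∃ z ∈ nbrs E u, e = {u, z} := fun e he hue => by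
    have : e ∈ ({e ∈ E | u ∈ e} : Finset _) := mem_filter.2 ⟨he, hue⟩
    rw [filter_mem_eq_image_nbrs hE2] at this
    obtain ⟨z, hz, rfl⟩ := mem_image.1 this
    exact ⟨z, hz, rfl⟩
  have hwz : ∀ e ∈ E, w ∈ e → ∃ z ∈ nbrs E w, e = {w, z} := fun e he hue => by
    have : e ∈ ({e ∈ E | w ∈ e} : Finset _) := mem_filter.2 ⟨he, hue⟩
    rw [filter_mem_eq_image_nbrs hE2] at this
    obtain ⟨z, hz, rfl⟩ := mem_image.1 this
    exact ⟨z, hz, rfl⟩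
  have hsz : ∀ e ∈ E, s ∈ e → ∃ z ∈ nbrs E s, e = {s, z} := fun e he hue => by
    have : e ∈ ({e ∈ E | s ∈ e} : Finset _) := mem_filter.2 ⟨he, hue⟩
    rw [filter_mem_eq_image_nbrs hE2] at this
    obtain ⟨z, hz, rfl⟩ := mem_image.1 this
    exact ⟨z, hz, rfl⟩
  set R := (((nbrs E s).erase u).erase w).erase t with hR
  have hR2 : link → #R ≤ 2 := by
    rintro ⟨h₁, h₂, h₃⟩
    have hws : w ∈ nbrs E s := mem_nbrs_comm.1 h₁
    rw [hR, card_erase_of_mem (by simp [htw, hne ht, h₃]),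
      card_erase_of_mem (by simp [hne huw, hws]), card_erase_of_mem (mem_nbrs_comm.1 hs), hcard h₃]
  have huw' : u ≠ w := (hne huw).symm
  have hbdd : TwoBounded c E₁ := by
    refine twoBounded_of_card fun k => ?_
    have hcase : ∀ e ∈ E₁, (c e = 0 ∧ e ∈ ({{u, w}, {s, t}} : Finset (Finset V))) ∨
        (c e = 1 ∧ e ∈ ({{u, x}, {u, s}} : Finset (Finset V))) ∨
        (c e = 2 ∧ e ∈ ({{u, y}, {u, t}} : Finset (Finset V))) ∨
        (c e = 3 ∧ e ∈ Q₁.image fun z => {w, z}) ∨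
        (c e = 4 ∧ e ∈ (Q \ Q₁).image fun z => {w, z}) ∨
        (link ∧ c e = 5 ∧ e ∈ R.image fun z => {s, z}) := by
      intro e he
      obtain ⟨heE, he⟩ := mem_filter.1 he
      by_cases hue : u ∈ e
      · obtain ⟨z, hz, rfl⟩ := hu e heE hue
        rcases (hP z).1 hz with rfl | rfl | rfl | rfl | rfl
        · left; simp [hc]
        · right; left; simp [hc, huw'.symm, hxw.symm]
        · right; right; left
          simp [hc, huw'.symm, hyw.symm, (hne hx), hxy, hsy, hne hs]
        · right; left; simp [hc, huw'.symm, hsw.symm]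
        · right; right; left
          simp [hc, huw'.symm, htw.symm, (hne hx), htx.symm, hst, hne hs]
      by_cases hwe : w ∈ e
      · obtain ⟨z, hz, rfl⟩ := hwz e heE hwe
        have hzu : z ≠ u := fun h => hue (by simp [h])
        have hzQ : z ∈ Q := by simp [hQ, hz, hzu]
        have hwQ : w ∉ Q₁ := fun h => by simpa [hQ, nbrs] using hQ₁ h
        right; right; right
        by_cases hzQ₁ : z ∈ Q₁
        · left
          refine ⟨?_, mem_image_of_mem _ hzQ₁⟩
          simp only [hc, if_neg hue, if_pos hwe]
          exact if_pos ⟨z, hzQ₁, by simp⟩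
        · right; left
          refine ⟨?_, mem_image_of_mem _ (by simp [hzQ, hzQ₁])⟩
          simp only [hc, if_neg hue, if_pos hwe]
          refine if_neg ?_
          rintro ⟨z', hz', h⟩
          rcases mem_insert.1 h with rfl | h
          · exact hwQ hz'
          · exact hzQ₁ (mem_singleton.1 h ▸ hz')
      obtain ⟨hl, hse⟩ : link ∧ s ∈ e := (he.resolve_left hue).resolve_left hwe
      obtain ⟨z, hz, rfl⟩ := hsz e heE hse
      by_cases hzt : z = t
      · left; subst hzt; simp [hc, hue, hwe]
      · right; right; right; right; right
        refine ⟨hl, ?_, mem_image_of_mem _ ?_⟩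
        · simp [hc, hue, hwe, hst.symm, Ne.symm hzt]
        · simp only [mem_insert, mem_singleton, not_or] at hue hwe
          simp [hR, hzt, hz, Ne.symm hue.2, Ne.symm hwe.2]
    have hpick : ∀ A : Finset (Finset V), #A ≤ 2 → (∀ e ∈ E₁, c e = k → e ∈ A) →
        #{e ∈ E₁ | c e = k} ≤ 2 := fun A hA h =>
      (card_le_card fun e he => h e (mem_filter.1 he).1 (mem_filter.1 he).2).trans hA
    rcases Nat.lt_or_ge k 6 with hk | hk
    · interval_cases k
      · refine hpick {{u, w}, {s, t}} card_le_two fun e he hk => ?_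
        have := hcase e he; rw [hk] at this; simpa using this
      · refine hpick {{u, x}, {u, s}} card_le_two fun e he hk => ?_
        have := hcase e he; rw [hk] at this; simpa using this
      · refine hpick {{u, y}, {u, t}} card_le_two fun e he hk => ?_
        have := hcase e he; rw [hk] at this; simpa using this
      · refine hpick (Q₁.image fun z => {w, z}) (card_image_le.trans hQ₁2.le) fun e he hk => ?_
        have := hcase e he; rw [hk] at this; simpa using this
      · refine hpick ((Q \ Q₁).image fun z => {w, z})
          (card_image_le.trans (by rw [card_sdiff_of_subset hQ₁]; omega)) fun e he hk => ?_
        have := hcase e he; rw [hk] at this; simpa using this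
      · by_cases hl : link
        · refine hpick (R.image fun z => {s, z}) (card_image_le.trans (hR2 hl)) fun e he hk => ?_
          have := hcase e he; rw [hk] at this; simpa [hl] using this
        · refine hpick ∅ (by simp) fun e he hk => ?_
          have := hcase e he; rw [hk] at this; simp [hl] at this
    · refine hpick ∅ (by simp) fun e he hk' => ?_
      have := hcase e he
      omega
  obtain ⟨K, hK4, hKE, ⟨f, hf, hfK⟩, hrb⟩ := hE.exists_clique hH hW (filter_subset _ _)
    ⟨{u, w}, by simp [pair_mem_of_mem_nbrs huw]⟩ hbdd
  have hadj : ∀ {a b}, a ∈ K → b ∈ K → a ≠ b → b ∈ nbrs E a := fun ha hb hab =>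
    mem_nbrs_of_clique hKE ha hb hab
  -- two edges at `u` or `w` of the same colour do not both occur in `K`
  have hrb' : ∀ {a b d}, a ∈ K → b ∈ K → d ∈ K → a ≠ b → a ≠ d → b ≠ d →
      {a, b} ∈ E₁ → {a, d} ∈ E₁ → c {a, b} ≠ c {a, d} := fun ha hb hd hab had hbd h₁ h₂ h =>
    hbd (pair_left_cancel hab.symm (hrb _ h₁ _ h₂ (by simp [insert_subset_iff, ha, hb])
      (by simp [insert_subset_iff, ha, hd]) h))
  have hKu : u ∈ K → ¬ (x ∈ K ∧ s ∈ K) ∧ ¬ (y ∈ K ∧ t ∈ K) := by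
    intro huK
    constructor
    · rintro ⟨h₁, h₂⟩
      refine hrb' huK h₁ h₂ (hne hx).symm (hne hs).symm hsx.symm
        (by simp [hE₁, pair_mem_of_mem_nbrs hx]) (by simp [hE₁, pair_mem_of_mem_nbrs hs]) ?_
      simp [hc, huw'.symm, hxw.symm, hsw.symm]
    · rintro ⟨h₁, h₂⟩
      refine hrb' huK h₁ h₂ (hne hy).symm (hne ht).symm hty.symm
        (by simp [hE₁, pair_mem_of_mem_nbrs hy]) (by simp [hE₁, pair_mem_of_mem_nbrs ht]) ?_
      simp [hc, huw'.symm, hyw.symm, htw.symm, hne hx, hne hs, hxy, htx.symm, hsy, hst]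
  have hKw : w ∈ K → ∀ a ∈ K, ∀ b ∈ K, a ≠ b → a ∈ Q → b ∈ Q → ¬ (a ∈ Q₁ ↔ b ∈ Q₁) := by
    intro hwK a ha b hb hab haQ hbQ hiff
    have h₁ := mem_erase.1 haQ
    have h₂ := mem_erase.1 hbQ
    have hwQ : w ∉ Q₁ := fun h => by simpa [hQ, nbrs] using hQ₁ h
    have hcol : ∀ z ∈ Q, c {w, z} = if z ∈ Q₁ then 3 else 4 := by
      intro z hz
      have hzu : z ≠ u := (mem_erase.1 hz).1
      have hiff : (∃ z' ∈ Q₁, z' = w ∨ z' = z) ↔ z ∈ Q₁ := by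
        constructor
        · rintro ⟨z', hz', rfl | rfl⟩
          · exact absurd hz' hwQ
          · exact hz'
        · exact fun h => ⟨z, h, Or.inr rfl⟩
      simp [hc, huw', hzu.symm, hiff]
    refine hrb' hwK ha hb (mem_nbrs.1 h₁.2).1.symm (mem_nbrs.1 h₂.2).1.symm hab
      (by simp [hE₁, pair_mem_of_mem_nbrs h₁.2]) (by simp [hE₁, pair_mem_of_mem_nbrs h₂.2]) ?_
    rw [hcol a haQ, hcol b hbQ]
    simp only [hiff]
  have h3 : ∀ a b d : V, ¬ K ⊆ {a, b, d} := fun a b d h => by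
    have := (card_le_card h).trans card_le_three
    omega
  by_cases huK : u ∈ K
  · obtain ⟨h₁, h₂⟩ := hKu huK
    by_cases hwK : w ∈ K
    · -- `K` consists of `u`, `w` and two vertices of `P ∩ Q`
      have hmem : ∀ z ∈ K, z ≠ u → z ≠ w → (z = x ∨ z = y ∨ z = s ∨ z = t) ∧ z ∈ Q := by
        intro z hz hzu hzw
        have := (hP z).1 (hadj huK hz hzu.symm)
        exact ⟨this.resolve_left hzw, mem_erase.2 ⟨hzu, hadj hwK hz hzw.symm⟩⟩
      have h₃ : ¬ (x ∈ K ∧ t ∈ K) := by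
        rintro ⟨a, b⟩
        have hxQ := (hmem x a (hne hx) hxw).2
        have htQ := (hmem t b (hne ht) htw).2
        exact hKw hwK x a t b htx.symm hxQ htQ (hxt hxQ htQ)
      have h₄ : ¬ (y ∈ K ∧ s ∈ K) := by
        rintro ⟨a, b⟩
        have hxQ := (hmem y a (hne hy) hyw).2
        have htQ := (hmem s b (hne hs) hsw).2
        exact hKw hwK y a s b hsy.symm hxQ htQ (hys hxQ htQ)
      have h₅ : ¬ (x ∈ K ∧ y ∈ K) := fun h => hcon
        ⟨hadj hwK h.1 hxw.symm, hadj hwK h.2 hyw.symm, hadj h.1 h.2 hxy⟩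
      have h₆ : ¬ (s ∈ K ∧ t ∈ K) := by
        rintro ⟨a, b⟩
        have hl : link := ⟨hadj hwK a hsw.symm, hadj hwK b htw.symm, hadj a b hst⟩
        have := hrb {u, w} (by simp [pair_mem_of_mem_nbrs huw]) {s, t}
          (by simp only [mem_filter]; exact ⟨pair_mem_of_mem_nbrs hl.2.2, by simp [hl]⟩)
          (by simp [insert_subset_iff, *]) (by simp [insert_subset_iff, *])
          (by simp [hc, (hne hs).symm, (hne ht).symm, hsw.symm, htw.symm])
        have hmem : u ∈ ({s, t} : Finset V) := this ▸ (by simp)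
        simp [(hne hs).symm, (hne ht).symm] at hmem
      obtain ⟨a, ha, hau⟩ : ∃ a ∈ K, a ∉ ({u, w, w} : Finset V) := not_subset.1 (h3 u w w)
      obtain ⟨b, hb, hbu⟩ : ∃ b ∈ K, b ∉ ({u, w, a} : Finset V) := not_subset.1 (h3 u w a)
      simp only [mem_insert, mem_singleton, not_or] at hau hbu
      have ha' := (hmem a ha hau.1 hau.2.1).1
      have hb' := (hmem b hb hbu.1 hbu.2.1).1
      rcases ha' with rfl | rfl | rfl | rfl <;> rcases hb' with rfl | rfl | rfl | rfl <;>
        first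
        | exact hbu.2.2 rfl
        | exact h₁ ⟨ha, hb⟩
        | exact h₁ ⟨hb, ha⟩
        | exact h₂ ⟨ha, hb⟩
        | exact h₂ ⟨hb, ha⟩
        | exact h₃ ⟨ha, hb⟩
        | exact h₃ ⟨hb, ha⟩
        | exact h₄ ⟨ha, hb⟩
        | exact h₄ ⟨hb, ha⟩
        | exact h₅ ⟨ha, hb⟩
        | exact h₅ ⟨hb, ha⟩
        | exact h₆ ⟨ha, hb⟩
        | exact h₆ ⟨hb, ha⟩
    · refine h3 u (if x ∈ K then x else s) (if y ∈ K then y else t) fun z hz => ?_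
      by_cases hzu : z = u
      · simp [hzu]
      rcases (hP z).1 (hadj huK hz (Ne.symm hzu)) with rfl | rfl | rfl | rfl | rfl
      · exact absurd hz hwK
      · simp [hz]
      · simp [hz]
      · have : x ∉ K := fun h => h₁ ⟨h, hz⟩
        simp [this]
      · have : y ∉ K := fun h => h₂ ⟨h, hz⟩
        simp [this]
  by_cases hwK : w ∈ K
  · have hA : ∀ B ⊆ Q, (∀ a ∈ B, ∀ b ∈ B, a ∈ Q₁ ↔ b ∈ Q₁) → #(K ∩ B) ≤ 1 := by
      intro B hB h
      refine card_le_one.2 fun a ha b hb => ?_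
      rw [mem_inter] at ha hb
      by_contra hab
      exact hKw hwK a ha.1 b hb.1 hab (hB ha.2) (hB hb.2) (h a ha.2 b hb.2)
    have h₁ := hA Q₁ hQ₁ (fun a ha b hb => by simp [ha, hb])
    have h₂ := hA (Q \ Q₁) sdiff_subset (fun a ha b hb => by
      simp [(Finset.mem_sdiff.1 ha).2, (Finset.mem_sdiff.1 hb).2])
    have h₃ : K ⊆ {w} ∪ (K ∩ Q₁ ∪ K ∩ (Q \ Q₁)) := by
      intro z hz
      by_cases hzw : z = w
      · simp [hzw]
      have hzQ : z ∈ Q := mem_erase.2 ⟨fun h => huK (h ▸ hz), hadj hwK hz (Ne.symm hzw)⟩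
      by_cases hzQ₁ : z ∈ Q₁
      · simp [hz, hzQ₁]
      · simp [hz, hzQ, hzQ₁]
    have := (card_le_card h₃).trans ((card_union_le _ _).trans
      (Nat.add_le_add_left (card_union_le _ _) _))
    rw [card_singleton] at this
    omega
  obtain ⟨hl, hsf⟩ : link ∧ s ∈ f := by
    have := (mem_filter.1 hf).2
    have h₁ : u ∉ f := fun h => huK (hfK h)
    have h₂ : w ∉ f := fun h => hwK (hfK h)
    exact (this.resolve_left h₁).resolve_left h₂
  have hsK := hfK hsf
  have h₁ : #(K ∩ R) ≤ 1 := by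
    refine card_le_one.2 fun a ha b hb => ?_
    simp only [mem_inter, hR, mem_erase] at ha hb
    by_contra hab
    refine hrb' hsK ha.1 hb.1 (mem_nbrs.1 ha.2.2.2.2).1.symm (mem_nbrs.1 hb.2.2.2.2).1.symm hab ?_ ?_ ?_
    · simp only [hE₁, mem_filter]; exact ⟨pair_mem_of_mem_nbrs ha.2.2.2.2, by simp [hl]⟩
    · simp only [hE₁, mem_filter]; exact ⟨pair_mem_of_mem_nbrs hb.2.2.2.2, by simp [hl]⟩
    · simp [hc, (hne hs).symm, hsw.symm, ha.2.2.2.1.symm, ha.2.2.1.symm, ha.2.1.symm,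
        hb.2.2.2.1.symm, hb.2.2.1.symm, hb.2.1.symm]
  have h₂ : K ⊆ {s, t} ∪ (K ∩ R) := by
    intro z hz
    by_cases hzs : z = s
    · simp [hzs]
    by_cases hzt : z = t
    · simp [hzt]
    refine mem_union_right _ ?_
    simp only [mem_inter, hR, mem_erase]
    exact ⟨hz, hzt, fun h => hwK (h ▸ hz), fun h => huK (h ▸ hz), hadj hsK hz (Ne.symm hzs)⟩
  have := (card_le_card h₂).trans (card_union_le _ _)
  rw [card_pair hst] at this
  omega

end RainbowFree

/-! ### Sparse graphs can be coloured -/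

namespace RainbowFree

open Finset

variable {V W κ : Type*} [DecidableEq V] [DecidableEq W] [Fintype V] [Fintype W]
variable {H : Finset (Finset W)} {E : Finset (Finset V)} {q l : ℕ}

/-- A `2`-bounded colouring of `K₆` without a rainbow `K₄`: the vertices are split into three pairs
that are arranged cyclically, and the two edges from a vertex to the preceding pair have the same
colour. -/
def sixColouring (e : Finset (Fin 6)) : ℕ :=
  if e ∈ ({{0, 2}, {1, 2}} : Finset (Finset (Fin 6))) then 0
  else if e ∈ ({{0, 3}, {1, 3}} : Finset (Finset (Fin 6))) then 1
  else if e ∈ ({{2, 4}, {3, 4}} : Finset (Finset (Fin 6))) then 2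
  else if e ∈ ({{2, 5}, {3, 5}} : Finset (Finset (Fin 6))) then 3
  else if e ∈ ({{0, 4}, {0, 5}} : Finset (Finset (Fin 6))) then 4
  else if e ∈ ({{1, 4}, {1, 5}} : Finset (Finset (Fin 6))) then 5
  else if 0 ∈ e then 6 else if 2 ∈ e then 7 else 8

lemma sixColouring_bounded : ∀ a ∈ powersetCard 2 univ, ∀ b ∈ powersetCard 2 univ,
    sixColouring a = sixColouring b → a ≠ b → ∀ d ∈ powersetCard 2 univ,
    sixColouring b = sixColouring d → a = d ∨ b = d := by
  decide +kernel

lemma sixColouring_clique : ∀ K ∈ powersetCard 4 (univ : Finset (Fin 6)),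
    ∃ f ∈ powersetCard 2 K, ∃ g ∈ powersetCard 2 K, f ≠ g ∧ sixColouring f = sixColouring g := by
  decide +kernel

/-- A minimal bad graph for `K₄` is not `5`-regular: by `MinBad.adj_of_regular` a vertex and its
neighbours would form a component `K₆`, which can be coloured. -/
lemma MinBad.not_regular (hE : MinBad H E) (hH : H = powersetCard 2 univ)
    (hW : Fintype.card W = 4) (hd : ∀ x ∈ supp E, deg E x = 5) : False := by
  have hE2 : ∀ e ∈ E, #e = 2 := fun e he =>
    hE.card_eq (l := 2) (fun h hh => by rw [hH] at hh; exact (mem_powersetCard.1 hh).2) he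
  have hcard : ∀ {a b}, b ∈ nbrs E a → #(nbrs E a) = 5 := fun h => by
    rw [card_nbrs hE2]; exact hd _ (mem_supp_of_mem_nbrs h)
  obtain ⟨e, he⟩ := hE.nonempty (by
    rw [hH]; exact powersetCard_nonempty.2 (by rw [card_univ]; omega))
  obtain ⟨u, w, huw, rfl⟩ := card_eq_two.1 (hE2 e he)
  have hw : w ∈ nbrs E u := mem_nbrs.2 ⟨huw.symm, he⟩
  have huu : u ∉ nbrs E u := by simp [nbrs]
  set M := insert u (nbrs E u) with hM
  have hM6 : #M = 6 := by rw [hM, card_insert_of_notMem huu, hcard hw]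
  have hadj : ∀ a ∈ nbrs E u, ∀ b ∈ nbrs E u, a ≠ b → b ∈ nbrs E a := by
    intro a ha b hb hab
    obtain ⟨z, hz⟩ : (((nbrs E u).erase a).erase b).Nonempty := by
      refine card_pos.1 ?_
      rw [card_erase_of_mem (by simp [hab.symm, hb]), card_erase_of_mem ha, hcard hw]
      omega
    simp only [mem_erase] at hz
    exact (hE.adj_of_regular hH hW hd ha hb hz.2.2 hab.symm hz.2.1 hz.1.symm).1
  have hsub : ∀ a ∈ M, nbrs E a = M.erase a := by
    intro a ha
    have h₁ : M.erase a ⊆ nbrs E a := by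
      intro b hb
      obtain ⟨hba, hb⟩ := mem_erase.1 hb
      rcases mem_insert.1 ha with rfl | ha <;> rcases mem_insert.1 hb with rfl | hb
      · exact absurd rfl hba
      · exact hb
      · exact mem_nbrs_comm.1 ha
      · exact hadj a ha b hb hba.symm
    have h₂ : #(M.erase a) = 5 := by rw [card_erase_of_mem ha, hM6]
    obtain ⟨b, hb⟩ : (M.erase a).Nonempty := card_pos.1 (by omega)
    exact (eq_of_subset_of_card_le h₁ (by rw [h₂, hcard (h₁ hb)])).symm
  let φ : Fin 6 ↪ V := (M.equivFinOfCardEq hM6).symm.toEmbedding.trans (Function.Embedding.subtype _)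
  have hφM : univ.map φ = M := by
    ext x
    simp only [φ, Finset.mem_map, mem_univ, true_and]
    constructor
    · rintro ⟨i, rfl⟩
      exact Subtype.prop _
    · exact fun hx => ⟨M.equivFinOfCardEq hM6 ⟨x, hx⟩, by simp⟩
  set c : Finset V → ℕ := fun e => sixColouring {i | φ i ∈ e} with hc
  have hcφ : ∀ f : Finset (Fin 6), c (f.map φ) = sixColouring f := fun f => by
    simp only [hc]
    congr 1
    ext i
    simp
  have hpre : ∀ e ∈ powersetCard 2 M, ∃ f ∈ powersetCard 2 univ, f.map φ = e := by
    intro e he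
    rw [← hφM, mem_powersetCard, subset_map_iff] at he
    obtain ⟨⟨f, -, rfl⟩, hf⟩ := he
    exact ⟨f, by simpa using hf, rfl⟩
  have hsubE : powersetCard 2 M ⊆ E := by
    intro e he
    obtain ⟨heM, he2⟩ := mem_powersetCard.1 he
    obtain ⟨a, b, hab, rfl⟩ := card_eq_two.1 he2
    refine pair_mem_of_mem_nbrs (x := a) (y := b) ?_
    rw [hsub a (heM (by simp)), mem_erase]
    exact ⟨hab.symm, heM (by simp)⟩
  obtain ⟨K, hK4, hKE, ⟨f, hf, hfK⟩, hrb⟩ := hE.exists_clique (c := c) hH hW hsubE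
    (powersetCard_nonempty.2 (by omega)) (fun a ha b hb d hd hab hbd => by
      obtain ⟨a, ha', rfl⟩ := hpre a ha
      obtain ⟨b, hb', rfl⟩ := hpre b hb
      obtain ⟨d, hd', rfl⟩ := hpre d hd
      simp only [hcφ] at hab hbd
      by_cases h : a = b
      · exact Or.inl (h ▸ rfl)
      · rcases sixColouring_bounded a ha' b hb' hab h d hd' hbd with rfl | rfl <;> simp)
  have hKM : K ⊆ M := by
    obtain ⟨hfM, hf2⟩ := mem_powersetCard.1 hf
    obtain ⟨x, hx⟩ : f.Nonempty := card_pos.1 (by omega)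
    intro y hy
    by_cases hxy : x = y
    · exact hxy ▸ hfM hx
    · have := mem_nbrs_of_clique hKE (hfK hx) hy hxy
      rw [hsub x (hfM hx)] at this
      exact (mem_erase.1 this).2
  rw [← hφM, subset_map_iff] at hKM
  obtain ⟨L, -, rfl⟩ := hKM
  rw [card_map] at hK4
  obtain ⟨a, ha, b, hb, hab, hcab⟩ := sixColouring_clique L (by simp [hK4])
  have hmem : ∀ a ∈ powersetCard 2 L, a.map φ ∈ powersetCard 2 M ∧ a.map φ ⊆ L.map φ := by
    intro a ha
    obtain ⟨haL, ha2⟩ := mem_powersetCard.1 ha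
    refine ⟨mem_powersetCard.2 ⟨?_, by simpa using ha2⟩, map_subset_map.2 haL⟩
    rw [← hφM]
    exact map_subset_map.2 (subset_univ _)
  refine hab (map_injective φ (hrb _ (hmem a ha).1 _ (hmem b hb).1 (hmem a ha).2 (hmem b hb).2 ?_))
  rw [hcφ, hcφ, hcab]

lemma StrictBal.two_mul_card_le (hH : StrictBal 2 H) :
    2 * #H ≤ Fintype.card W * (Fintype.card W - 1) := by
  have h : #H ≤ (Fintype.card W).choose 2 := by
    rw [← card_univ, ← card_powersetCard]
    exact card_le_card fun h hh => mem_powersetCard.2 ⟨subset_univ _, hH.1 h hh⟩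
  rw [Nat.choose_two_right] at h
  omega

/-- The deterministic part for graphs: if every subgraph of the host is at most as dense as the
pattern, then the host can be coloured. -/
theorem StrictBal.colourable_of_two (hH : StrictBal 2 H) (hv : 4 ≤ Fintype.card W)
    (he : Fintype.card W ≤ #H) (h44 : ¬ (Fintype.card W = 4 ∧ #H = 4))
    (hE : ∀ G ⊆ E, G.Nonempty → 0 ≤ pot 2 H G) : Colourable H E := by
  by_contra hcon
  obtain ⟨E', hE'E, hmin⟩ := exists_minBad_subset hcon
  replace hE : ∀ G ⊆ E', G.Nonempty → 0 ≤ pot 2 H G := fun G hG => hE G (hG.trans hE'E)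
  have hH2 := hH.two_mul_card_le
  have hE2 : ∀ e ∈ E', #e = 2 := fun e he => hmin.card_eq hH.1 he
  have hne : E'.Nonempty := hmin.nonempty (card_pos.1 (by omega))
  obtain ⟨e, heq⟩ : ∃ e, #H = e + 1 := ⟨#H - 1, by omega⟩
  obtain ⟨v, hveq⟩ : ∃ v, Fintype.card W = v + 2 := ⟨Fintype.card W - 2, by omega⟩
  have hpot : ∀ G ⊆ E', G.Nonempty → v * #G ≤ e * #(supp G) := by
    intro G hG hGne
    have := hE G hG hGne
    simp only [pot, heq, hveq] at this
    push_cast at this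
    zify
    nlinarith
  -- the degrees of the pattern exceed its density `e / v`, so they are at least `k + 1`
  obtain ⟨k, hk⟩ : ∃ k, k = e / v := ⟨_, rfl⟩
  have hv0 : 0 < v := by omega
  have hk₁ : k * v ≤ e := hk ▸ Nat.div_mul_le_self e v
  have hk₂ : e < (k + 1) * v := by
    rw [hk, mul_comm]; exact Nat.lt_mul_div_succ e hv0
  have hdegH : ∀ i, k + 1 ≤ deg H i := by
    intro i
    have h := hH.lt_deg (by omega) i
    rw [heq, hveq] at h
    push_cast at h
    have h' : e < deg H i * v := by zify; linarith
    have := lt_of_le_of_lt hk₁ h'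
    exact Nat.lt_of_mul_lt_mul_right this
  have hsum := sum_deg hE2
  have hdegE : ∀ x ∈ supp E', 2 * k + 1 ≤ deg E' x := fun x hx => hmin.lt_deg hH.1 hdegH hx
  have hN : 0 < #(supp E') := by
    obtain ⟨f, hf⟩ := hne
    obtain ⟨x, hx⟩ : f.Nonempty := card_pos.1 (by rw [hE2 f hf]; omega)
    exact card_pos.2 ⟨x, mem_supp.2 ⟨f, hf, hx⟩⟩
  have hpE := hpot E' Subset.rfl hne
  have hlow : (2 * k + 1) * v ≤ 2 * e := by
    have h₁ := card_nsmul_le_sum _ _ _ hdegE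
    rw [hsum, smul_eq_mul] at h₁
    have h₂ : #(supp E') * ((2 * k + 1) * v) ≤ #(supp E') * (2 * e) := by nlinarith
    exact Nat.le_of_mul_le_mul_left h₂ hN
  -- since an orientation with out-degrees at most `k + 1` exists, the pattern has few edges
  have hup : e + 1 ≤ (v + 2) * ((k + 2) / 2) := by
    by_contra! hlt
    refine hmin.1 (colourable_of_orientation (m := k + 1) (fun G hG => ?_) (by rw [heq, hveq]; exact hlt))
    rcases G.eq_empty_or_nonempty with rfl | hGne
    · simp
    have h₁ := hpot G hG hGne
    have h₂ : v * #G ≤ v * ((k + 1) * #(supp G)) := by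
      calc v * #G ≤ e * #(supp G) := h₁
        _ ≤ ((k + 1) * v) * #(supp G) := by gcongr
        _ = _ := by ring
    exact Nat.le_of_mul_le_mul_left h₂ hv0
  rw [hveq, heq] at hH2 he h44
  have hH2' : 2 * (e + 1) ≤ (v + 2) * (v + 1) := hH2
  -- together with `2 * e(H) ≤ v(H) * (v(H) - 1)`, only densities `e / v` between `5 / 2` and `3` are left
  have hk2 : k = 2 := by
    rcases Nat.even_or_odd' k with ⟨j, rfl | rfl⟩
    · rw [show (2 * j + 2) / 2 = j + 1 by omega] at hup
      rcases Nat.lt_or_ge j 2 with hj | hj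
      · interval_cases j
        · omega
        · rfl
      · have hv4 : v < 4 := by nlinarith
        interval_cases v <;> omega
    · rw [show (2 * j + 1 + 2) / 2 = j + 1 by omega] at hup
      have hv4 : v < 3 := by nlinarith
      interval_cases v <;> omega
  subst hk2
  norm_num at hup hlow hk₁ hk₂
  rcases Nat.lt_or_ge v 3 with hv3 | hv3
  · -- the pattern is `K₄`, and the host is `5`-regular
    have hv2 : v = 2 := by omega
    subst hv2
    have he5 : e = 5 := by omega
    subst he5
    refine hmin.not_regular (eq_of_subset_of_card_le
      (fun h hh => mem_powersetCard.2 ⟨subset_univ _, hH.1 h hh⟩) ?_) hveq ?_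
    · rw [card_powersetCard, card_univ, hveq, heq]; decide
    · have hle : ∑ x ∈ supp E', deg E' x ≤ ∑ x ∈ supp E', 5 := by
        rw [hsum, sum_const, smul_eq_mul]; omega
      intro x hx
      exact ((sum_eq_sum_iff_of_le hdegE).1 (le_antisymm (sum_le_sum hdegE) hle) x hx).symm
  · have hfa := hH.not_forall_deg_eq (k := 2) (by omega) (by
      rw [heq, hveq]; push_cast; zify at hlow; linarith)
    have h := lt_card_of_deg hE2 hne hdegE
      (fun x y hx hy => hmin.not_adjacent hH.1 hdegH hfa (k := 2) hx hy)
      (fun x y z hx hy hxy hz hxz hyz =>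
        hmin.not_two_neighbours hH.1 hdegH hfa (k := 2) hx hy hxy hz hxz hyz)
    have h₁ : v * (17 * #(supp E')) < 6 * (e * #(supp E')) := by nlinarith
    have h₂ : #(supp E') * (17 * v) < #(supp E') * (6 * e) := by nlinarith
    -- `17 / 6 < e / v < 3` contradicts the bound on `e` from the orientation
    have := Nat.lt_of_mul_lt_mul_left h₂
    omega

/-- The deterministic part for `C₄`, where every subgraph of the host has to be sparser. -/
theorem StrictBal.colourable_of_four (hH : StrictBal 2 H) (hv : Fintype.card W = 4) (he : #H = 4)
    (hE : ∀ G ⊆ E, G.Nonempty → 0 < pot 2 H G) : Colourable H E := by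
  by_contra hcon
  obtain ⟨E', hE'E, hmin⟩ := exists_minBad_subset hcon
  have hdegH : ∀ i, 1 + 1 ≤ deg H i := by
    intro i
    have h := hH.lt_deg (by omega) i
    rw [he, hv] at h
    push_cast at h
    omega
  have h₁ := card_nsmul_le_sum _ _ _ fun x hx => hmin.lt_deg hH.1 hdegH (x := x) hx
  rw [sum_deg fun e he => hmin.card_eq hH.1 he, smul_eq_mul] at h₁
  have h₂ := hE E' hE'E (hmin.nonempty (card_pos.1 (by omega)))
  simp only [pot, he, hv] at h₂
  omega

end RainbowFree

/-! ### Shadows and crowded families -/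

namespace RainbowFree

open Finset
open scoped FinsetFamily

variable {V W κ : Type*} [DecidableEq V] [DecidableEq W]
variable {𝒜 : Finset (Finset V)} {r : ℕ}

lemma shadow_memberSubfamily (x : V) (𝒜 : Finset (Finset V)) :
    ∂ (𝒜.memberSubfamily x) = (∂ 𝒜).memberSubfamily x := by
  ext e
  simp only [mem_shadow_iff_insert_mem, mem_memberSubfamily, mem_insert, not_or]
  constructor
  · rintro ⟨y, hy, h, hxy, hx⟩
    exact ⟨⟨y, ⟨fun h => hxy h.symm, hy⟩, by rwa [insert_comm]⟩, hx⟩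
  · rintro ⟨⟨y, ⟨hyx, hy⟩, h⟩, hx⟩
    exact ⟨y, hy, by rwa [insert_comm], fun h => hyx h.symm, hx⟩

lemma deg_add_card_nonMemberSubfamily (x : V) (𝒜 : Finset (Finset V)) :
    deg 𝒜 x + #(𝒜.nonMemberSubfamily x) = #𝒜 :=
  card_filter_add_card_filter_not _

lemma card_memberSubfamily (x : V) (𝒜 : Finset (Finset V)) :
    #(𝒜.memberSubfamily x) = deg 𝒜 x := by
  have h₁ := card_memberSubfamily_add_card_nonMemberSubfamily x 𝒜
  have h₂ := deg_add_card_nonMemberSubfamily x 𝒜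
  omega

/-- The shadow splits into the part at `x`, which is the shadow of the link, and the rest. -/
lemma deg_shadow_add_le (x : V) (𝒜 : Finset (Finset V)) :
    deg (∂ 𝒜) x + #(∂ (𝒜.nonMemberSubfamily x)) ≤ #(∂ 𝒜) := by
  rw [← deg_add_card_nonMemberSubfamily x (∂ 𝒜)]
  refine Nat.add_le_add_left (card_le_card fun e he => ?_) _
  obtain ⟨y, hy, h⟩ := mem_shadow_iff_insert_mem.1 he
  simp only [mem_nonMemberSubfamily] at h ⊢
  exact ⟨mem_shadow_iff_insert_mem.2 ⟨y, hy, h.1⟩, fun hx => h.2 (mem_insert_of_mem hx)⟩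

lemma card_shadow_memberSubfamily (x : V) (𝒜 : Finset (Finset V)) :
    #(∂ (𝒜.memberSubfamily x)) = deg (∂ 𝒜) x := by
  rw [shadow_memberSubfamily, card_memberSubfamily]

lemma card_of_mem_shadow (h : ∀ e ∈ 𝒜, #e = r + 1) : ∀ e ∈ ∂ 𝒜, #e = r := by
  intro e he
  obtain ⟨s, hs, -, hc⟩ := mem_shadow_iff_exists_mem_card_add_one.1 he
  have := h s hs
  omega

lemma card_of_mem_memberSubfamily {x : V} (h : ∀ e ∈ 𝒜, #e = r + 1) :
    ∀ e ∈ 𝒜.memberSubfamily x, #e = r := by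
  intro e he
  obtain ⟨h₁, h₂⟩ := mem_memberSubfamily.1 he
  have := h _ h₁
  rw [card_insert_of_notMem h₂] at this
  omega

lemma card_of_mem_nonMemberSubfamily {x : V} (h : ∀ e ∈ 𝒜, #e = r) :
    ∀ e ∈ 𝒜.nonMemberSubfamily x, #e = r := fun e he => h e (mem_nonMemberSubfamily.1 he).1

lemma supp_shadow (h : ∀ e ∈ 𝒜, 2 ≤ #e) : supp (∂ 𝒜) = supp 𝒜 := by
  ext x
  simp only [mem_supp]
  constructor
  · rintro ⟨e, he, hx⟩
    obtain ⟨s, hs, hes⟩ := exists_subset_of_mem_shadow he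
    exact ⟨s, hs, hes hx⟩
  · rintro ⟨s, hs, hx⟩
    obtain ⟨y, hy, hyx⟩ := exists_mem_ne (h s hs) x
    exact ⟨s.erase y, erase_mem_shadow hs hy, mem_erase.2 ⟨hyx.symm, hx⟩⟩

lemma card_le_choose (h : ∀ e ∈ 𝒜, #e = r) : #𝒜 ≤ (#(supp 𝒜)).choose r := by
  rw [← card_powersetCard]
  exact card_le_card fun e he => mem_powersetCard.2 ⟨subset_supp he, h e he⟩

lemma exists_mul_deg_le (h : ∀ e ∈ 𝒜, #e = r) (hne : (supp 𝒜).Nonempty) :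
    ∃ x ∈ supp 𝒜, #(supp 𝒜) * deg 𝒜 x ≤ r * #𝒜 := by
  by_contra! hcon
  have h₁ := sum_lt_sum_of_nonempty hne hcon
  rw [sum_const, ← mul_sum, sum_deg h, smul_eq_mul] at h₁
  exact lt_irrefl _ h₁

/-- Two sets of size `r` have at most one common set in their shadows. -/
lemma card_mul_le_card_shadow (h : ∀ e ∈ 𝒜, #e = r + 1) :
    2 * (#𝒜 * (r + 1)) ≤ 2 * #(∂ 𝒜) + #𝒜 * (#𝒜 - 1) := by
  induction 𝒜 using Finset.induction_on with
  | empty => simp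
  | insert A 𝒜 hA ih =>
    have ih := ih fun e he => h e (mem_insert_of_mem he)
    have hAr : #A = r + 1 := h A (mem_insert_self _ _)
    have h₁ : ∂ 𝒜 ∪ (A.image fun a => A.erase a) ⊆ ∂ (insert A 𝒜) := by
      refine union_subset (shadow_mono (subset_insert _ _)) fun e he => ?_
      obtain ⟨a, ha, rfl⟩ := mem_image.1 he
      exact erase_mem_shadow (mem_insert_self _ _) ha
    have h₂ : ∂ 𝒜 ∩ (A.image fun a => A.erase a) ⊆ 𝒜.image fun B => A ∩ B := by
      intro e he
      obtain ⟨h₁, h₂⟩ := mem_inter.1 he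
      obtain ⟨B, hB, heB⟩ := exists_subset_of_mem_shadow h₁
      obtain ⟨a, ha, rfl⟩ := mem_image.1 h₂
      refine mem_image.2 ⟨B, hB, (eq_of_subset_of_card_le
        (subset_inter (erase_subset _ _) heB) ?_).symm⟩
      rw [card_erase_of_mem ha, hAr]
      have h₃ : A ∩ B ⊂ A := by
        refine (ssubset_iff_subset_ne).2 ⟨inter_subset_left, fun h' => hA ?_⟩
        rwa [eq_of_subset_of_card_le (inter_eq_left.1 h')
          (by rw [hAr, h B (mem_insert_of_mem hB)])]
      have := card_lt_card h₃
      omega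
    have h₃ : #(A.image fun a => A.erase a) = r + 1 := by
      rw [card_image_of_injOn (fun a ha b hb h => ?_), hAr]
      by_contra hab
      have : a ∈ A.erase b := mem_erase.2 ⟨hab, ha⟩
      exact notMem_erase a A (h ▸ this)
    have h₄ := card_union_add_card_inter (∂ 𝒜) (A.image fun a => A.erase a)
    have h₅ := card_le_card h₁
    have h₆ := (card_le_card h₂).trans card_image_le
    rw [card_insert_of_notMem hA]
    rcases Nat.eq_zero_or_pos (#𝒜) with h0 | h0
    · rw [h0] at ih h₆ ⊢
      omega
    · obtain ⟨t, ht⟩ : ∃ t, #𝒜 = t + 1 := ⟨#𝒜 - 1, by omega⟩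
      rw [ht] at ih h₆ ⊢
      simp only [Nat.add_sub_cancel] at ih ⊢
      nlinarith

lemma exists_subset_card_shadow (h : ∀ e ∈ 𝒜, #e = r + 1) {t : ℕ} (ht : t ≤ #𝒜) :
    2 * (t * (r + 1)) ≤ 2 * #(∂ 𝒜) + t * (t - 1) := by
  obtain ⟨ℬ, hℬ, rfl⟩ := exists_subset_card_eq ht
  exact (card_mul_le_card_shadow fun e he => h e (hℬ he)).trans
    (by gcongr)

lemma deg_pos {x : V} (hx : x ∈ supp 𝒜) : 0 < deg 𝒜 x := by
  obtain ⟨e, he, hxe⟩ := mem_supp.1 hx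
  exact card_pos.2 ⟨e, mem_filter.2 ⟨he, hxe⟩⟩

lemma supp_nonempty (h : ∀ e ∈ 𝒜, #e = r + 1) (hne : 𝒜.Nonempty) : (supp 𝒜).Nonempty := by
  obtain ⟨e, he⟩ := hne
  obtain ⟨x, hx⟩ : e.Nonempty := card_pos.1 (by rw [h e he]; omega)
  exact ⟨x, mem_supp.2 ⟨e, he, hx⟩⟩

/-- A vertex of small degree in the shadow. -/
lemma exists_mul_deg_shadow_le (h : ∀ e ∈ 𝒜, #e = r + 2) (hne : 𝒜.Nonempty) :
    ∃ x ∈ supp 𝒜, #(supp 𝒜) * deg (∂ 𝒜) x ≤ (r + 1) * #(∂ 𝒜) ∧ 0 < deg (∂ 𝒜) x := by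
  have hs := supp_shadow (𝒜 := 𝒜) fun e he => by rw [h e he]; omega
  obtain ⟨x, hx, hd⟩ := exists_mul_deg_le (card_of_mem_shadow h)
    (by rw [hs]; exact supp_nonempty h hne)
  exact ⟨x, hs ▸ hx, hs ▸ hd, deg_pos hx⟩

/-- The link of `x` is a graph whose vertices are the edges of the shadow at `x`, and `m` vertices span
at most `m.choose 2` edges. -/
lemma deg_le_choose (h : ∀ e ∈ 𝒜, #e = 3) (x : V) : deg 𝒜 x ≤ (deg (∂ 𝒜) x).choose 2 := by
  have h₂ : ∀ e ∈ 𝒜.memberSubfamily x, #e = 2 := card_of_mem_memberSubfamily h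
  have hs := supp_shadow (𝒜 := 𝒜.memberSubfamily x) fun e he => by rw [h₂ e he]
  have h₁ := card_le_choose h₂
  rw [card_memberSubfamily, ← hs] at h₁
  refine h₁.trans (Nat.choose_le_choose _ ?_)
  rw [← card_shadow_memberSubfamily]
  -- the shadow of a graph consists of the singletons of its vertices
  have h₃ := sum_deg (card_of_mem_shadow h₂)
  have h₄ := card_nsmul_le_sum _ (deg (∂ (𝒜.memberSubfamily x))) 1 fun y hy => deg_pos hy
  rw [h₃] at h₄
  simpa using h₄

lemma le_deg_shadow (h : ∀ e ∈ 𝒜, #e = r + 3) {x : V} (hx : 0 < deg 𝒜 x) :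
    r + 2 ≤ deg (∂ 𝒜) x := by
  rw [← card_shadow_memberSubfamily]
  rw [← card_memberSubfamily] at hx
  have := exists_subset_card_shadow (r := r + 1) (card_of_mem_memberSubfamily h) (t := 1) hx
  omega

lemma deg_pos_of_shadow {x : V} (hx : 0 < deg (∂ 𝒜) x) : 0 < deg 𝒜 x := by
  rw [← card_shadow_memberSubfamily] at hx
  rw [← card_memberSubfamily]
  obtain ⟨e, he⟩ := card_pos.1 hx
  obtain ⟨s, hs, -⟩ := exists_subset_of_mem_shadow he
  exact card_pos.2 ⟨s, hs⟩

/-- Five triangles have at least eight edges. -/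
lemma eight_le_card_shadow (h : ∀ e ∈ 𝒜, #e = 3) (ht : 5 ≤ #𝒜) : 8 ≤ #(∂ 𝒜) := by
  by_contra! hlt
  have hN : 5 ≤ #(supp 𝒜) := by
    by_contra! hN
    have := (card_le_choose h).trans (Nat.choose_le_choose 3 (Nat.lt_succ_iff.1 hN))
    have h4 : Nat.choose 4 3 = 4 := by decide
    omega
  obtain ⟨x, hx, hd, hpos⟩ := exists_mul_deg_shadow_le (r := 1) h (card_pos.1 (by omega))
  have hle : deg (∂ 𝒜) x ≤ 2 := by nlinarith
  have h₁ := deg_le_choose h x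
  have h₂ := le_deg_shadow (r := 0) h (deg_pos_of_shadow hpos)
  have h₃ := deg_shadow_add_le x 𝒜
  have h₄ := deg_add_card_nonMemberSubfamily x 𝒜
  rw [show deg (∂ 𝒜) x = 2 by omega] at h₁ h₃
  have h22 : Nat.choose 2 2 = 1 := by decide
  have := exists_subset_card_shadow (r := 2) (card_of_mem_nonMemberSubfamily (x := x) h) (t := 4)
    (by omega)
  omega

/-- Six triangles have at least nine edges. -/
lemma nine_le_card_shadow (h : ∀ e ∈ 𝒜, #e = 3) (ht : 6 ≤ #𝒜) : 9 ≤ #(∂ 𝒜) := by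
  by_contra! hlt
  have hN : 5 ≤ #(supp 𝒜) := by
    by_contra! hN
    have := (card_le_choose h).trans (Nat.choose_le_choose 3 (Nat.lt_succ_iff.1 hN))
    have h4 : Nat.choose 4 3 = 4 := by decide
    omega
  obtain ⟨x, hx, hd, hpos⟩ := exists_mul_deg_shadow_le (r := 1) h (card_pos.1 (by omega))
  have hle : deg (∂ 𝒜) x ≤ 3 := by nlinarith
  have h₁ := deg_le_choose h x
  have h₂ := le_deg_shadow (r := 0) h (deg_pos_of_shadow hpos)
  have h₃ := deg_shadow_add_le x 𝒜
  have h₄ := deg_add_card_nonMemberSubfamily x 𝒜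
  have h22 : Nat.choose 2 2 = 1 := by decide
  have h32 : Nat.choose 3 2 = 3 := by decide
  rcases (show deg (∂ 𝒜) x = 2 ∨ deg (∂ 𝒜) x = 3 by omega) with h' | h' <;> rw [h'] at h₁ h₃
  · have := eight_le_card_shadow (card_of_mem_nonMemberSubfamily (x := x) h) (by omega)
    omega
  · have := exists_subset_card_shadow (r := 2) (card_of_mem_nonMemberSubfamily (x := x) h) (t := 3)
      (by omega)
    omega

/-- A family whose shadow is less than twice as large; this is what prevents the members from
choosing two private elements of the shadow each. -/
def Crowded (𝒜 : Finset (Finset V)) : Prop := #(∂ 𝒜) < 2 * #𝒜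

lemma Crowded.exists_minimal (h : Crowded 𝒜) :
    ∃ ℬ ⊆ 𝒜, Crowded ℬ ∧ ∀ 𝒞 ⊂ ℬ, ¬ Crowded 𝒞 := by
  induction 𝒜 using Finset.strongInduction with
  | H 𝒜 ih =>
    by_cases h' : ∃ 𝒞 ⊂ 𝒜, Crowded 𝒞
    · obtain ⟨𝒞, h𝒞, hc⟩ := h'
      obtain ⟨ℬ, h₁, h₂⟩ := ih 𝒞 h𝒞 hc
      exact ⟨ℬ, h₁.trans h𝒞.1, h₂⟩
    · push Not at h'
      exact ⟨𝒜, Subset.rfl, h, h'⟩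

lemma Crowded.nonempty (h : Crowded 𝒜) : 𝒜.Nonempty :=
  card_pos.1 (by unfold Crowded at h; omega)

/-- The links of a minimal crowded family are crowded. -/
lemma Crowded.memberSubfamily (h : Crowded 𝒜) (hmin : ∀ 𝒞 ⊂ 𝒜, ¬ Crowded 𝒞) {x : V}
    (hx : x ∈ supp 𝒜) : Crowded (𝒜.memberSubfamily x) := by
  have h₁ := deg_pos hx
  have h₂ := deg_add_card_nonMemberSubfamily x 𝒜
  have h₃ := deg_shadow_add_le x 𝒜
  have h₄ := hmin (𝒜.nonMemberSubfamily x) ((ssubset_iff_subset_ne).2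
    ⟨filter_subset _ _, fun h => by rw [h] at h₂; omega⟩)
  unfold Crowded at h h₄ ⊢
  rw [card_memberSubfamily, card_shadow_memberSubfamily]
  omega

lemma Crowded.six_le (h : Crowded 𝒜) (h3 : ∀ e ∈ 𝒜, #e = 3) : 6 ≤ #(∂ 𝒜) := by
  have hb := fun t (ht : t ≤ #𝒜) => exists_subset_card_shadow (r := 2) h3 (t := t) ht
  have h₁ := hb 1
  have h₂ := hb 2
  have h₃ := hb 3
  unfold Crowded at h
  omega

/-- A crowded family of `(r + 4)`-sets has at least `r + 6` vertices: at most `r + 5` such sets fit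
on `r + 5` vertices, too few to be crowded. -/
lemma Crowded.le_card_supp (h : Crowded 𝒜) (hr : ∀ e ∈ 𝒜, #e = r + 4) :
    r + 6 ≤ #(supp 𝒜) := by
  by_contra! hN
  have h₁ := (card_le_choose hr).trans (Nat.choose_le_choose (r + 4) (Nat.lt_succ_iff.1 hN))
  rw [show r + 5 = (r + 4) + 1 by omega, Nat.choose_succ_self_right] at h₁
  have h₂ := card_mul_le_card_shadow (r := r + 3) hr
  unfold Crowded at h
  have hpos := card_pos.2 (Crowded.nonempty h)
  obtain ⟨t, ht⟩ : ∃ t, #𝒜 = t + 1 := ⟨#𝒜 - 1, by omega⟩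
  rw [ht] at h₂ h h₁
  simp only [Nat.add_sub_cancel] at h₂
  nlinarith

/-- A crowded family of `4`-sets has a shadow of size at least `16`. -/
lemma Crowded.sixteen_le (h : Crowded 𝒜) (h4 : ∀ e ∈ 𝒜, #e = 4) : 16 ≤ #(∂ 𝒜) := by
  obtain ⟨ℬ, hℬ, hc, hmin⟩ := h.exists_minimal
  refine le_trans ?_ (card_le_card (shadow_mono hℬ))
  replace h4 : ∀ e ∈ ℬ, #e = 4 := fun e he => h4 e (hℬ he)
  by_contra! hlt
  have hN := hc.le_card_supp (r := 0) h4
  obtain ⟨x, hx, hd, hpos⟩ := exists_mul_deg_shadow_le (r := 2) h4 hc.nonempty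
  have hle : deg (∂ ℬ) x ≤ 7 := by nlinarith
  have hl3 : ∀ e ∈ ℬ.memberSubfamily x, #e = 3 := card_of_mem_memberSubfamily h4
  have h₁ := (hc.memberSubfamily hmin hx).six_le hl3
  have h₂ : #(ℬ.memberSubfamily x) ≤ 4 := by
    by_contra! h'
    have := eight_le_card_shadow hl3 h'
    rw [card_shadow_memberSubfamily] at this
    omega
  rw [card_shadow_memberSubfamily] at h₁
  rw [card_memberSubfamily] at h₂
  have h₃ := deg_shadow_add_le x ℬ
  have h₄ := deg_add_card_nonMemberSubfamily x ℬ
  have hb := fun t (ht : t ≤ #ℬ) => exists_subset_card_shadow (r := 3) h4 (t := t) ht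
  have hb' := fun t (ht : t ≤ #(ℬ.nonMemberSubfamily x)) =>
    exists_subset_card_shadow (r := 3) (card_of_mem_nonMemberSubfamily (x := x) h4) (t := t) ht
  have a₁ := hb 1
  have a₂ := hb 2
  have a₃ := hb 3
  have a₄ := hb 4
  have b₂ := hb' 2
  have b₃ := hb' 3
  have b₄ := hb' 4
  unfold Crowded at hc
  omega

/-- The case of equality in `Crowded.sixteen_le`: more than ten `4`-sets have a larger shadow. -/
lemma card_le_ten (h4 : ∀ e ∈ 𝒜, #e = 4) (h16 : #(∂ 𝒜) = 16) : #𝒜 ≤ 10 := by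
  by_contra! hlt
  have hN := Crowded.le_card_supp (𝒜 := 𝒜) (r := 0) (by unfold Crowded; omega) h4
  obtain ⟨x, hx, hd, hpos⟩ := exists_mul_deg_shadow_le (r := 2) h4 (card_pos.1 (by omega))
  have hle : deg (∂ 𝒜) x ≤ 8 := by nlinarith
  have hl3 : ∀ e ∈ 𝒜.memberSubfamily x, #e = 3 := card_of_mem_memberSubfamily h4
  have h₂ : #(𝒜.memberSubfamily x) ≤ 5 := by
    by_contra! h'
    have := nine_le_card_shadow hl3 h'
    rw [card_shadow_memberSubfamily] at this
    omega
  have h₃ := deg_shadow_add_le x 𝒜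
  have h₄ := deg_add_card_nonMemberSubfamily x 𝒜
  have hn4 := card_of_mem_nonMemberSubfamily (x := x) h4
  have h₅ : ¬ Crowded (𝒜.nonMemberSubfamily x) := fun h => by
    have := h.sixteen_le hn4
    omega
  have h₆ : ¬ 2 ≤ #(𝒜.memberSubfamily x) := fun h => by
    have := exists_subset_card_shadow (r := 2) hl3 (t := 2) h
    rw [card_shadow_memberSubfamily] at this
    rw [card_memberSubfamily] at h₂
    unfold Crowded at h₅
    omega
  rw [card_memberSubfamily] at h₂ h₆
  unfold Crowded at h₅
  omega

/-- A lower bound for shadows of crowded families, by induction on the size of the sets. -/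
lemma Crowded.le_card_shadow {j : ℕ} (h : Crowded 𝒜) (hj : ∀ e ∈ 𝒜, #e = j + 4) :
    4 * (j + 6).choose 3 ≤ 5 * #(∂ 𝒜) := by
  induction j generalizing 𝒜 with
  | zero =>
    have := h.sixteen_le hj
    have h6 : Nat.choose 6 3 = 20 := by decide
    rw [Nat.zero_add, h6]
    omega
  | succ j ih =>
    obtain ⟨ℬ, hℬ, hc, hmin⟩ := h.exists_minimal
    refine le_trans ?_ (Nat.mul_le_mul_left 5 (card_le_card (shadow_mono hℬ)))
    replace hj : ∀ e ∈ ℬ, #e = j + 1 + 4 := fun e he => hj e (hℬ he)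
    have hN := hc.le_card_supp (r := j + 1) hj
    have hs := supp_shadow (𝒜 := ℬ) fun e he => by rw [hj e he]; omega
    have hdeg : ∀ x ∈ supp (∂ ℬ), 4 * (j + 6).choose 3 ≤ 5 * deg (∂ ℬ) x := by
      intro x hx
      rw [← card_shadow_memberSubfamily]
      exact ih (hc.memberSubfamily hmin (hs ▸ hx)) (card_of_mem_memberSubfamily hj)
    have h₁ := card_nsmul_le_sum _ _ _ hdeg
    rw [← mul_sum, sum_deg (card_of_mem_shadow (r := j + 4) hj), smul_eq_mul, hs] at h₁
    have h₂ := Nat.choose_mul_succ_eq (j + 6) 3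
    rw [show j + 6 + 1 - 3 = j + 4 by omega] at h₂
    have h₃ : (j + 4) * (4 * (j + 1 + 6).choose 3) ≤ (j + 4) * (5 * #(∂ ℬ)) := by
      rw [show j + 1 + 6 = j + 6 + 1 by omega]
      nlinarith
    exact Nat.le_of_mul_le_mul_left h₃ (by omega)

end RainbowFree

/-! ### Sparse hosts of complete patterns can be coloured -/

namespace RainbowFree

open Finset
open scoped FinsetFamily

variable {V W κ : Type*} [DecidableEq V] [DecidableEq W] [Fintype V] [Fintype W]
variable {E L : Finset (Finset V)} {H : Finset (Finset W)} {q l j m : ℕ}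

/-- The edges in `L` have a `2`-bounded colouring without a rainbow copy of the complete `l`-graph on
`q` vertices. There are sufficiently many finite sets of vertices to serve as colours. -/
def Good (q l : ℕ) (L : Finset (Finset V)) : Prop :=
  ∃ c : Finset V → Finset V, TwoBounded c L ∧ ∀ K, #K = q → powersetCard l K ⊆ L →
    ∃ f ∈ powersetCard l K, ∃ g ∈ powersetCard l K, f ≠ g ∧ c f = c g

lemma good_of (c : Finset V → κ) (hc : TwoBounded c L)
    (h : ∀ K, #K = q → powersetCard l K ⊆ L →
      ∃ f ∈ powersetCard l K, ∃ g ∈ powersetCard l K, f ≠ g ∧ c f = c g) : Good q l L := by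
  have hinv : ∀ e, c (Function.invFun c (c e)) = c e := fun e => Function.invFun_eq ⟨e, rfl⟩
  refine ⟨fun e => Function.invFun c (c e), fun a ha b hb d hd hab hbd => ?_, fun K hK hKL => ?_⟩
  · refine hc a ha b hb d hd ?_ ?_
    · have := congrArg c hab
      simpa only [hinv] using this
    · have := congrArg c hbd
      simpa only [hinv] using this
  · obtain ⟨f, hf, g, hg, hne, h⟩ := h K hK hKL
    exact ⟨f, hf, g, hg, hne, by simp only [h]⟩

lemma Good.colourable (h : Good q l E) (hH : H = powersetCard l univ)
    (hW : Fintype.card W = q) : Colourable H E := by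
  obtain ⟨c, hc, h⟩ := h
  subst hH
  refine colourable_of c hc fun φ hφ => ?_
  have hsub : ∀ f ∈ powersetCard l (univ.map φ), ∃ h ∈ powersetCard l univ, h.map φ = f := by
    intro f hf
    obtain ⟨hf, hfl⟩ := mem_powersetCard.1 hf
    obtain ⟨h, -, rfl⟩ := subset_map_iff.1 hf
    exact ⟨h, by simpa using hfl, rfl⟩
  obtain ⟨f, hf, g, hg, hne, hfg⟩ := h (univ.map φ) (by simp [hW]) (fun f hf => by
    obtain ⟨h, hh, rfl⟩ := hsub f hf
    exact hφ h hh)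
  obtain ⟨a, ha, rfl⟩ := hsub f hf
  obtain ⟨b, hb, rfl⟩ := hsub g hg
  exact ⟨a, ha, b, hb, fun h => hne (h ▸ rfl), hfg⟩

/-- The links of a minimal bad family are bad: otherwise a colouring of the link and one of the edges
avoiding the vertex could be combined. -/
lemma not_good_memberSubfamily (h : ¬ Good (q + 1) (l + 1) L)
    (hmin : ∀ L' ⊂ L, Good (q + 1) (l + 1) L') {x : V} (hx : x ∈ supp L) :
    ¬ Good q l (L.memberSubfamily x) := by
  rintro ⟨c₁, hc₁, hK₁⟩
  have hss : L.nonMemberSubfamily x ⊂ L := (ssubset_iff_subset_ne).2 ⟨filter_subset _ _, fun h => by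
    have h₁ := deg_pos hx
    have h₂ := deg_add_card_nonMemberSubfamily x L
    rw [h] at h₂
    omega⟩
  obtain ⟨c₂, hc₂, hK₂⟩ := hmin _ hss
  set A : Finset (Finset V) := {e ∈ L | x ∈ e} with hA
  have hAm : ∀ e, e ∈ A ↔ e ∈ L ∧ x ∈ e := fun e => mem_filter
  have hb₁ : TwoBounded (fun e => c₁ (e.erase x)) (L.filter (· ∈ A)) := by
    intro a ha b hb d hd hab hbd
    have hm : ∀ e ∈ L.filter (· ∈ A), x ∈ e ∧ e.erase x ∈ L.memberSubfamily x := by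
      intro e he
      obtain ⟨-, he⟩ := mem_filter.1 he
      obtain ⟨he, hxe⟩ := (hAm e).1 he
      exact ⟨hxe, mem_memberSubfamily.2 ⟨by rwa [insert_erase hxe], notMem_erase _ _⟩⟩
    have hinj : ∀ a b : Finset V, x ∈ a → x ∈ b → a.erase x = b.erase x → a = b :=
      fun a b ha hb h => by rw [← insert_erase ha, h, insert_erase hb]
    obtain ⟨ha₁, ha₂⟩ := hm a ha
    obtain ⟨hb₁, hb₂⟩ := hm b hb
    obtain ⟨hd₁, hd₂⟩ := hm d hd
    exact (hc₁ _ ha₂ _ hb₂ _ hd₂ hab hbd).imp (hinj _ _ ha₁ hb₁)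
      (Or.imp (hinj _ _ hb₁ hd₁) (hinj _ _ ha₁ hd₁))
  have hb₂ : TwoBounded c₂ (L \ A) := by
    have : L \ A = L.nonMemberSubfamily x := by
      ext e
      simp only [Finset.mem_sdiff, hAm, mem_nonMemberSubfamily]
      tauto
    rwa [this]
  refine h (good_of _ (TwoBounded.glue hb₁ hb₂) fun K hK hKL => ?_)
  by_cases hxK : x ∈ K
  · have hmem : ∀ f ∈ powersetCard l (K.erase x), x ∉ f ∧
        insert x f ∈ powersetCard (l + 1) K := by
      intro f hf
      obtain ⟨hfK, hfl⟩ := mem_powersetCard.1 hf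
      have hxf : x ∉ f := fun h => notMem_erase x K (hfK h)
      exact ⟨hxf, mem_powersetCard.2 ⟨insert_subset hxK (hfK.trans (erase_subset _ _)),
        by rw [card_insert_of_notMem hxf, hfl]⟩⟩
    obtain ⟨f, hf, g, hg, hne, hfg⟩ := hK₁ (K.erase x) (by rw [card_erase_of_mem hxK, hK]; rfl)
      (fun f hf => mem_memberSubfamily.2 ⟨hKL (hmem f hf).2, (hmem f hf).1⟩)
    refine ⟨_, (hmem f hf).2, _, (hmem g hg).2, fun h => hne ?_, ?_⟩
    · rw [← erase_insert (hmem f hf).1, h, erase_insert (hmem g hg).1]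
    · rw [if_pos ((hAm _).2 ⟨hKL (hmem f hf).2, mem_insert_self _ _⟩),
        if_pos ((hAm _).2 ⟨hKL (hmem g hg).2, mem_insert_self _ _⟩),
        erase_insert (hmem f hf).1, erase_insert (hmem g hg).1, hfg]
  · have hnot : ∀ f ∈ powersetCard (l + 1) K, x ∉ f := fun f hf hxf =>
      hxK ((mem_powersetCard.1 hf).1 hxf)
    obtain ⟨f, hf, g, hg, hne, hfg⟩ := hK₂ K hK
      (fun f hf => mem_nonMemberSubfamily.2 ⟨hKL hf, hnot f hf⟩)
    refine ⟨f, hf, g, hg, hne, ?_⟩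
    rw [if_neg fun h => hnot f hf ((hAm _).1 h).2, if_neg fun h => hnot g hg ((hAm _).1 h).2, hfg]

lemma exists_minimal_not_good (h : ¬ Good q l L) :
    ∃ L' ⊆ L, ¬ Good q l L' ∧ ∀ L'' ⊂ L', Good q l L'' := by
  obtain ⟨L', h₁, h₂, h₃⟩ := exists_minimal_le_of_wellFoundedLT (fun L => ¬ Good q l L) L h
  refine ⟨L', h₁, h₂, fun L'' h => ?_⟩
  by_contra hc
  exact h.2 (h₃ hc h.1)

lemma supp_nonempty_of_not_good (h : ¬ Good q (l + 1) L) (hlq : l + 1 ≤ q)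
    (hL : ∀ e ∈ L, #e = l + 1) : (supp L).Nonempty := by
  refine supp_nonempty hL (nonempty_iff_ne_empty.2 fun h0 => h ?_)
  subst h0
  refine ⟨id, by simp [TwoBounded], fun K hK hKL => ?_⟩
  rw [subset_empty, powersetCard_eq_empty] at hKL
  omega

/-- A bad family has at least as many members as the complete `(j + 1)`-graph on `2 m + 1 + j` vertices.
The induction is on the size of the edges, as all links of a minimal bad family are bad; for
`j = 0`, a family of at most `2 m` singletons can be coloured with `m` colours. -/
lemma le_card_of_not_good (hL : ∀ e ∈ L, #e = j + 1) (h : ¬ Good (m + 1 + j) (j + 1) L) :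
    (2 * m + 1 + j).choose (j + 1) ≤ #L ∧ 2 * m + 1 + j ≤ #(supp L) := by
  induction j generalizing L with
  | zero =>
    have h₁ : 2 * m + 1 ≤ #L := by
      by_contra! hlt
      obtain ⟨c, hc, hb⟩ := exists_pairing (Nat.lt_succ_iff.1 hlt)
      refine h (good_of c hb fun K hK hKL => ?_)
      obtain ⟨f, hf, g, hg, hne, hfg⟩ := exists_ne_map_eq_of_card_lt_of_maps_to
        (s := powersetCard 1 K) (t := range m) (f := c)
        (by rw [card_powersetCard, hK, card_range, Nat.choose_one_right]; omega)
        (fun f hf => mem_coe.2 (mem_range.2 (hc f (hKL hf))))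
      exact ⟨f, hf, g, hg, hne, hfg⟩
    have h₂ := sum_deg hL
    have h₃ := card_le_choose hL
    rw [Nat.zero_add, Nat.choose_one_right] at h₃ ⊢
    exact ⟨h₁, by omega⟩
  | succ j ih =>
    obtain ⟨L', hL', hbad, hmin⟩ := exists_minimal_not_good h
    replace hL : ∀ e ∈ L', #e = j + 1 + 1 := fun e he => hL e (hL' he)
    have hlink : ∀ x ∈ supp L', (2 * m + 1 + j).choose (j + 1) ≤ deg L' x ∧
        2 * m + 1 + j ≤ #(supp (L'.memberSubfamily x)) := by
      intro x hx
      rw [← card_memberSubfamily]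
      exact ih (card_of_mem_memberSubfamily hL) (not_good_memberSubfamily hbad hmin hx)
    obtain ⟨x, hx⟩ := supp_nonempty_of_not_good hbad (by omega) hL
    have hN : 2 * m + 1 + j + 1 ≤ #(supp L') := by
      have h₁ : supp (L'.memberSubfamily x) ⊆ (supp L').erase x := by
        intro y hy
        obtain ⟨e, he, hye⟩ := mem_supp.1 hy
        obtain ⟨he, hxe⟩ := mem_memberSubfamily.1 he
        exact mem_erase.2 ⟨fun h => hxe (h ▸ hye), mem_supp.2 ⟨_, he, mem_insert_of_mem hye⟩⟩
      have h₂ := card_le_card h₁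
      rw [card_erase_of_mem hx] at h₂
      have h₃ := (hlink x hx).2
      have h₄ := card_pos.2 ⟨x, hx⟩
      omega
    refine ⟨?_, hN.trans (card_le_card (supp_mono hL'))⟩
    have h₁ := card_nsmul_le_sum _ _ _ fun x hx => (hlink x hx).1
    rw [sum_deg hL, smul_eq_mul] at h₁
    have h₂ := Nat.add_one_mul_choose_eq (2 * m + 1 + j) (j + 1)
    refine le_trans ?_ (card_le_card hL')
    refine Nat.le_of_mul_le_mul_left (c := j + 1 + 1) ?_ (by omega)
    rw [show 2 * m + 1 + (j + 1) = 2 * m + 1 + j + 1 by omega]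
    nlinarith

/-- If every clique on `j + 1` vertices could choose two private edges, then giving these two the same
colour would leave no rainbow clique. So, by Hall's theorem, there is a crowded family of cliques. -/
lemma exists_crowded_of_not_good (h : ¬ Good (j + 1) j L) :
    ∃ 𝒮 : Finset (Finset V), (∀ K ∈ 𝒮, #K = j + 1) ∧ ∂ 𝒮 ⊆ L ∧ Crowded 𝒮 := by
  by_contra! hcon
  set 𝒦 : Finset (Finset V) := {K ∈ powersetCard (j + 1) univ | powersetCard j K ⊆ L} with h𝒦
  have hm : ∀ {K}, K ∈ 𝒦 ↔ #K = j + 1 ∧ powersetCard j K ⊆ L := by simp [h𝒦]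
  have hall : ∀ s : Finset (𝒦 × Fin 2), #s ≤ #(s.biUnion fun i => powersetCard j (i.1 : Finset V)) := by
    intro s
    set 𝒮 := s.image fun i => (i.1 : Finset V) with h𝒮
    have h𝒮m : ∀ K ∈ 𝒮, K ∈ 𝒦 := by
      intro K hK
      obtain ⟨i, -, rfl⟩ := mem_image.1 hK
      exact i.1.2
    have h₁ : ∂ 𝒮 = s.biUnion fun i => powersetCard j (i.1 : Finset V) := by
      ext e
      simp only [mem_shadow_iff_exists_mem_card_add_one, mem_biUnion, mem_powersetCard]
      constructor
      · rintro ⟨K, hK, heK, hc⟩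
        obtain ⟨i, hi, rfl⟩ := mem_image.1 hK
        have := (hm.1 i.1.2).1
        exact ⟨i, hi, heK, by omega⟩
      · rintro ⟨i, hi, heK, hc⟩
        exact ⟨i.1, mem_image_of_mem _ hi, heK, by rw [(hm.1 i.1.2).1, hc]⟩
    have h₂ : #s ≤ 2 * #𝒮 := by
      have hsub : s.image (fun i => ((i.1 : Finset V), i.2)) ⊆ 𝒮 ×ˢ univ := by
        intro p hp
        obtain ⟨i, hi, rfl⟩ := mem_image.1 hp
        simp only [mem_product, mem_univ, and_true]
        exact mem_image_of_mem _ hi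
      have := card_le_card hsub
      rw [card_image_of_injective _ (fun a b hab => by
        simp only [Prod.mk.injEq, Subtype.coe_inj] at hab
        exact Prod.ext hab.1 hab.2), card_product, card_univ, Fintype.card_fin] at this
      omega
    have h₃ := hcon 𝒮 (fun K hK => (hm.1 (h𝒮m K hK)).1) (by
      rw [h₁]
      refine biUnion_subset.2 fun i _ => (hm.1 i.1.2).2)
    unfold Crowded at h₃
    rw [← h₁]
    omega
  obtain ⟨f, hf, hfm⟩ := (all_card_le_biUnion_card_iff_exists_injective _).1 hall
  classical
  set c : Finset V → 𝒦 ⊕ Finset V := fun e =>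
    if h : ∃ i, f i = e then Sum.inl h.choose.1 else Sum.inr e with hc
  have hcf : ∀ i, c (f i) = Sum.inl i.1 := by
    intro i
    have hex : ∃ i', f i' = f i := ⟨i, rfl⟩
    simp only [hc, dif_pos hex]
    rw [hf hex.choose_spec]
  have hcn : ∀ e, (¬ ∃ i, f i = e) → c e = Sum.inr e := fun e he => dif_neg he
  refine h (good_of c (fun a _ b _ d _ hab hbd => ?_) fun K hK hKL => ?_)
  · have hnot : ∀ a b, c a = c b → (¬ ∃ i, f i = a) → a = b := by
      intro a b hab ha
      rw [hcn a ha] at hab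
      by_cases hb : ∃ i, f i = b
      · obtain ⟨i, rfl⟩ := hb
        rw [hcf] at hab
        simp at hab
      · rw [hcn b hb] at hab
        exact Sum.inr_injective hab
    by_cases ha : ∃ i, f i = a
    · by_cases hb : ∃ i, f i = b
      · by_cases hd : ∃ i, f i = d
        · obtain ⟨⟨K, i⟩, rfl⟩ := ha
          obtain ⟨⟨K', i'⟩, rfl⟩ := hb
          obtain ⟨⟨K'', i''⟩, rfl⟩ := hd
          rw [hcf, hcf] at hab hbd
          obtain rfl := Sum.inl_injective hab
          obtain rfl := Sum.inl_injective hbd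
          have : i = i' ∨ i' = i'' ∨ i = i'' := by omega
          rcases this with rfl | rfl | rfl <;> simp
        · exact Or.inr (Or.inl (hnot d b hbd.symm hd).symm)
      · exact Or.inl (hnot b a hab.symm hb).symm
    · exact Or.inl (hnot a b hab ha)
  · have hK𝒦 : K ∈ 𝒦 := hm.2 ⟨hK, hKL⟩
    refine ⟨_, hfm (⟨K, hK𝒦⟩, 0), _, hfm (⟨K, hK𝒦⟩, 1), fun h => ?_, by rw [hcf, hcf]⟩
    have := hf h
    simp at this

/-- A family in which all degrees are at least the number of edges in `le_card_of_not_good` is denser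
than the complete `(j + 1)`-graph on `m + 1 + j` vertices; for `j = 1` and `m = 2` the
inequality fails. -/
lemma choose_mul_le (hj : 2 ≤ j) (hm : 2 ≤ m) :
    (j + 1) * (m + 1 + j).choose (j + 1) ≤ m * (2 * m + j).choose j := by
  induction m, hm using Nat.le_induction with
  | base =>
    have h₁ : (j + 3).choose (j + 1) = (j + 3).choose 2 := Nat.choose_symm_of_eq_add (by omega)
    have h₂ : (j + 4).choose j = (j + 4).choose 4 := Nat.choose_symm_of_eq_add (by omega)
    have a₁ := Nat.add_one_mul_choose_eq (j + 2) 1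
    have a₂ := Nat.add_one_mul_choose_eq (j + 3) 3
    have a₃ := Nat.add_one_mul_choose_eq (j + 2) 2
    have a₄ := Nat.add_one_mul_choose_eq (j + 1) 1
    rw [Nat.choose_one_right] at a₁ a₄
    rw [show 2 + 1 + j = j + 3 by omega, show 2 * 2 + j = j + 4 by omega, h₁, h₂]
    norm_num at a₁ a₂ a₃ a₄
    refine Nat.le_of_mul_le_mul_left (c := 24) ?_ (by omega)
    have e₁ : 24 * ((j + 1) * (j + 3).choose 2) = 12 * (j + 1) * ((j + 3) * (j + 2)) := by
      rw [a₁]; ring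
    have e₂ : 24 * (2 * (j + 4).choose 4) = 2 * ((j + 4) * ((j + 3) * ((j + 2) * (j + 1)))) := by
      rw [a₄, show (j + 3) * ((j + 2).choose 2 * 2) = 2 * ((j + 3) * (j + 2).choose 2) by ring, a₃,
        show (j + 4) * (2 * ((j + 3).choose 3 * 3)) = 6 * ((j + 4) * (j + 3).choose 3) by ring, a₂]
      ring
    rw [e₁, e₂]
    calc 12 * (j + 1) * ((j + 3) * (j + 2)) = 2 * (6 * ((j + 3) * ((j + 2) * (j + 1)))) := by ring
      _ ≤ _ := by gcongr; omega
  | succ m hm ih =>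
    set D := (m + 1 + j).choose (j + 1)
    set D' := (m + 1 + 1 + j).choose (j + 1)
    set C := (2 * m + j).choose j
    set C' := (2 * (m + 1) + j).choose j
    have h₁ : D * (m + 2 + j) = D' * (m + 1) := by
      have := Nat.choose_mul_succ_eq (m + 1 + j) (j + 1)
      rw [show m + 1 + j + 1 = m + 1 + 1 + j by omega,
        show m + 1 + 1 + j - (j + 1) = m + 1 by omega] at this
      rw [show m + 2 + j = m + 1 + 1 + j by omega]
      exact this
    have h₂ : C * ((2 * m + j + 1) * (2 * m + j + 2)) = C' * ((2 * m + 1) * (2 * m + 2)) := by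
      have a₁ := Nat.choose_mul_succ_eq (2 * m + j) j
      have a₂ := Nat.choose_mul_succ_eq (2 * m + j + 1) j
      rw [show 2 * m + j + 1 - j = 2 * m + 1 by omega] at a₁
      rw [show 2 * m + j + 1 + 1 - j = 2 * m + 2 by omega,
        show 2 * m + j + 1 + 1 = 2 * (m + 1) + j by omega] at a₂
      rw [← mul_assoc, a₁, mul_right_comm, show 2 * m + j + 2 = 2 * (m + 1) + j by omega, a₂]
      ring
    refine Nat.le_of_mul_le_mul_left (c := (m + 1) * ((2 * m + 1) * (2 * m + 2))) ?_ (by positivity)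
    have h₃ : m * (m + 2 + j) * ((2 * m + 1) * (2 * m + 2)) ≤
        (m + 1) * (m + 1) * ((2 * m + j + 1) * (2 * m + j + 2)) := by
      zify
      nlinarith [mul_nonneg (Int.natCast_nonneg m) (Int.natCast_nonneg j), Int.natCast_nonneg m,
        Int.natCast_nonneg j, mul_nonneg (mul_nonneg (Int.natCast_nonneg m) (Int.natCast_nonneg j))
        (Int.natCast_nonneg m), sq_nonneg ((m : ℤ) * j), sq_nonneg (m : ℤ), sq_nonneg (j : ℤ)]
    calc (m + 1) * ((2 * m + 1) * (2 * m + 2)) * ((j + 1) * D')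
        = (j + 1) * (D' * (m + 1)) * ((2 * m + 1) * (2 * m + 2)) := by ring
      _ = ((j + 1) * D) * ((m + 2 + j) * ((2 * m + 1) * (2 * m + 2))) := by rw [← h₁]; ring
      _ ≤ (m * C) * ((m + 2 + j) * ((2 * m + 1) * (2 * m + 2))) := by gcongr
      _ = C * (m * (m + 2 + j) * ((2 * m + 1) * (2 * m + 2))) := by ring
      _ ≤ C * ((m + 1) * (m + 1) * ((2 * m + j + 1) * (2 * m + j + 2))) := by gcongr
      _ = (m + 1) * (m + 1) * (C * ((2 * m + j + 1) * (2 * m + j + 2))) := by ring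
      _ = (m + 1) * (m + 1) * (C' * ((2 * m + 1) * (2 * m + 2))) := by rw [h₂]
      _ = _ := by ring

/-- The shadow of a minimal crowded family of `(j + 5)`-sets is denser than the complete
`(j + 4)`-graph on `j + 5` vertices, whose density is `j + 4`. -/
lemma Crowded.lt_card_shadow {j : ℕ} {𝒜 : Finset (Finset V)} (h : Crowded 𝒜)
    (hmin : ∀ 𝒞 ⊂ 𝒜, ¬ Crowded 𝒞) (hj : ∀ e ∈ 𝒜, #e = j + 5) :
    (j + 4) * #(supp 𝒜) < #(∂ 𝒜) := by
  by_contra! hle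
  have hs := supp_shadow (𝒜 := 𝒜) fun e he => by rw [hj e he]; omega
  have hsum := sum_deg (card_of_mem_shadow (r := j + 4) hj)
  rw [hs] at hsum
  have hN : 0 < #(supp 𝒜) := card_pos.2 (supp_nonempty hj h.nonempty)
  have hlink : ∀ x ∈ supp 𝒜, Crowded (𝒜.memberSubfamily x) := fun x hx =>
    h.memberSubfamily hmin hx
  have hlj : ∀ x, ∀ e ∈ 𝒜.memberSubfamily x, #e = j + 4 := fun x => card_of_mem_memberSubfamily hj
  rcases Nat.eq_zero_or_pos j with rfl | hj0
  · -- all degrees in the shadow are exactly `16`, so the links have few members by `card_le_ten`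
    have hdeg : ∀ x ∈ supp 𝒜, 16 ≤ deg (∂ 𝒜) x := fun x hx => by
      rw [← card_shadow_memberSubfamily]
      exact (hlink x hx).sixteen_le (hlj x)
    have hle' : ∑ x ∈ supp 𝒜, deg (∂ 𝒜) x ≤ ∑ x ∈ supp 𝒜, 16 := by
      rw [hsum, sum_const, smul_eq_mul]; omega
    have heq := (sum_eq_sum_iff_of_le hdeg).1 (le_antisymm (sum_le_sum hdeg) hle')
    have hten : ∀ x ∈ supp 𝒜, deg 𝒜 x ≤ 10 := fun x hx => by
      rw [← card_memberSubfamily]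
      exact card_le_ten (hlj x) (by rw [card_shadow_memberSubfamily]; exact (heq x hx).symm)
    have h₁ := sum_le_card_nsmul _ _ _ hten
    rw [sum_deg hj, smul_eq_mul] at h₁
    have h₂ := card_nsmul_le_sum _ _ _ hdeg
    rw [hsum, smul_eq_mul] at h₂
    unfold Crowded at h
    omega
  · have hdeg : ∀ x ∈ supp 𝒜, 4 * (j + 6).choose 3 ≤ 5 * deg (∂ 𝒜) x := fun x hx => by
      rw [← card_shadow_memberSubfamily]
      exact (hlink x hx).le_card_shadow (hlj x)
    have h₁ := card_nsmul_le_sum _ _ _ hdeg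
    rw [← mul_sum, hsum, smul_eq_mul] at h₁
    have h₂ : #(supp 𝒜) * (4 * (j + 6).choose 3) ≤ #(supp 𝒜) * (5 * ((j + 4) * (j + 4))) := by
      nlinarith
    have h₃ := Nat.le_of_mul_le_mul_left h₂ hN
    have a₁ := Nat.add_one_mul_choose_eq (j + 5) 2
    have a₂ := Nat.add_one_mul_choose_eq (j + 4) 1
    rw [Nat.choose_one_right] at a₂
    norm_num at a₁ a₂
    have a₃ : 6 * (j + 6).choose 3 = (j + 6) * ((j + 5) * (j + 4)) := by
      rw [a₂, show (j + 6) * ((j + 5).choose 2 * 2) = 2 * ((j + 6) * (j + 5).choose 2) by ring, a₁]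
      ring
    have h₄ : (j + 4) * (4 * ((j + 6) * (j + 5))) ≤ (j + 4) * (30 * (j + 4)) := by nlinarith
    have h₅ := Nat.le_of_mul_le_mul_left h₄ (by omega)
    nlinarith

/-- The deterministic part for complete patterns: if every subgraph of the host is at most as dense as
the pattern, then the host can be coloured. -/
theorem colourable_of_complete {r : ℕ} (hH : H = powersetCard l univ) (hW : Fintype.card W = r)
    (hl : 3 ≤ l) (hr : l + 1 ≤ r) (hlr : (l, r) ≠ (3, 4))
    (hE : ∀ G ⊆ E, G.Nonempty → 0 ≤ pot l H G) : Colourable H E := by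
  by_contra hcon
  obtain ⟨E', hE'E, hmin⟩ := exists_minBad_subset hcon
  have hE' : ∀ e ∈ E', #e = l := fun e he =>
    hmin.card_eq (fun h hh => by rw [hH] at hh; exact (mem_powersetCard.1 hh).2) he
  have hbad : ¬ Good r l E' := fun h => hmin.1 (h.colourable hH hW)
  have hcardH : #H = r.choose l := by rw [hH, card_powersetCard, card_univ, hW]
  have hdens : ∀ G ⊆ E', G.Nonempty → (r - l) * #G + #(supp G) ≤ r.choose l * #(supp G) := by
    intro G hG hne
    have := hE G (hG.trans hE'E) hne
    simp only [pot, hcardH, hW] at this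
    zify [(by omega : l ≤ r)]
    nlinarith
  obtain ⟨j, rfl⟩ : ∃ j, l = j + 1 := ⟨l - 1, by omega⟩
  obtain ⟨m, rfl⟩ : ∃ m, r = m + 1 + j := ⟨r - j - 1, by omega⟩
  rcases Nat.lt_or_ge m 2 with hm | hm
  · -- the patterns with `r = l + 1`
    obtain rfl : m = 1 := by omega
    obtain ⟨i, rfl⟩ : ∃ i, j = i + 3 := ⟨j - 3, by
      have : j ≠ 2 := fun h => hlr (by subst h; rfl)
      omega⟩
    rw [show 1 + 1 + (i + 3) = i + 4 + 1 by omega] at hbad hdens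
    obtain ⟨𝒮, h𝒮, h𝒮E, hc⟩ := exists_crowded_of_not_good hbad
    obtain ⟨ℬ, hℬ, hcr, hminℬ⟩ := hc.exists_minimal
    replace h𝒮 : ∀ e ∈ ℬ, #e = i + 5 := fun e he => h𝒮 e (hℬ he)
    have hlt := hcr.lt_card_shadow hminℬ h𝒮
    have h₁ := hdens (∂ ℬ) ((shadow_mono hℬ).trans h𝒮E) (card_pos.1 (by omega))
    rw [supp_shadow fun e he => by rw [h𝒮 e he]; omega, Nat.choose_succ_self_right,
      show i + 4 + 1 - (i + 3 + 1) = 1 by omega] at h₁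
    nlinarith
  · obtain ⟨L, hL, hLbad, hLmin⟩ := exists_minimal_not_good hbad
    have hLc : ∀ e ∈ L, #e = j + 1 := fun e he => hE' e (hL he)
    have hsup := supp_nonempty_of_not_good hLbad (by omega) hLc
    obtain ⟨i, rfl⟩ : ∃ i, j = i + 1 := ⟨j - 1, by omega⟩
    have hdeg : ∀ x ∈ supp L, (2 * m + 1 + i).choose (i + 1) ≤ deg L x := fun x hx => by
      rw [← card_memberSubfamily]
      exact (le_card_of_not_good (card_of_mem_memberSubfamily hLc)
        (not_good_memberSubfamily hLbad hLmin hx)).1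
    have h₁ := card_nsmul_le_sum _ _ _ hdeg
    rw [sum_deg hLc, smul_eq_mul] at h₁
    have h₂ := hdens L hL (by
      obtain ⟨x, hx⟩ := hsup
      obtain ⟨e, he, -⟩ := mem_supp.1 hx
      exact ⟨e, he⟩)
    rw [show m + 1 + (i + 1) - (i + 1 + 1) = m by omega] at h₂
    have h₃ := choose_mul_le (j := i + 1) (by omega) hm
    rw [show 2 * m + (i + 1) = 2 * m + 1 + i by omega] at h₃
    have hN := card_pos.2 hsup
    set N := #(supp L)
    set C := (2 * m + 1 + i).choose (i + 1)
    set D := (m + 1 + (i + 1)).choose (i + 1 + 1)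
    have h₄ : m * (N * C) ≤ m * ((i + 1 + 1) * #L) := Nat.mul_le_mul_left m h₁
    have h₅ : N * ((i + 1 + 1) * D) ≤ N * (m * C) := Nat.mul_le_mul_left N h₃
    have h₆ : (i + 1 + 1) * (m * #L + N) ≤ (i + 1 + 1) * (D * N) := Nat.mul_le_mul_left _ h₂
    have h₇ : 0 < (i + 1 + 1) * N := by positivity
    nlinarith

end RainbowFree

/-! ### Hypergraphs as families of finite sets -/

namespace RainbowFree

open Finset Hypergraph

variable {α β V : Type*} {G : Hypergraph α} {ℓ : ℕ}

/-- The edges of a hypergraph, as finite sets of its vertices. -/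
noncomputable def edges (G : Hypergraph α) [Fintype G.vertexSet] : Finset (Finset G.vertexSet) :=
  open scoped Classical in {s | Subtype.val '' (s : Set G.vertexSet) ∈ G.edgeSet}

section

variable [Fintype G.vertexSet]

lemma mem_edges {s : Finset G.vertexSet} :
    s ∈ edges G ↔ Subtype.val '' (s : Set G.vertexSet) ∈ G.edgeSet := by
  simp [edges]

lemma injective_image_val :
    Function.Injective fun s : Finset G.vertexSet => Subtype.val '' (s : Set G.vertexSet) :=
  fun _ _ h => coe_injective (Set.image_injective.2 Subtype.val_injective h)

lemma image_edges :
    (fun s : Finset G.vertexSet => Subtype.val '' (s : Set G.vertexSet)) '' edges G = G.edgeSet := by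
  classical
  ext e
  constructor
  · rintro ⟨s, hs, rfl⟩
    exact mem_edges.1 hs
  · intro he
    have h : Subtype.val '' (((Subtype.val ⁻¹' e : Set G.vertexSet).toFinset : Finset G.vertexSet) :
        Set G.vertexSet) = e := by
      rw [Set.coe_toFinset, Subtype.image_preimage_coe,
        Set.inter_eq_right.2 (G.subset_vertexSet_of_mem_edgeSet he)]
    exact ⟨_, mem_coe.2 (mem_edges.2 (by rwa [h])), h⟩

lemma card_edges : #(edges G) = G.edgeSet.ncard := by
  rw [← image_edges, Set.ncard_image_of_injective _ injective_image_val, Set.ncard_coe_finset]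

lemma card_vertexSet : Fintype.card G.vertexSet = G.vertexSet.ncard := by
  rw [← Nat.card_eq_fintype_card, Nat.card_coe_set_eq]

lemma strictBal_edges [DecidableEq G.vertexSet] (hG : G.IsLGraph ℓ) (hbal : G.IsStrictlyBalanced ℓ) :
    StrictBal ℓ (edges G) := by
  refine ⟨fun h hh => ?_, by rw [card_vertexSet]; exact hbal.1, fun S T hT hTS hS hne => ?_⟩
  · rw [← hG.2 _ (mem_edges.1 hh), Set.ncard_image_of_injective _ Subtype.val_injective,
      Set.ncard_coe_finset]
  · set J : Hypergraph α :=
      { vertexSet := Subtype.val '' (S : Set G.vertexSet)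
        edgeSet := (fun s : Finset G.vertexSet => Subtype.val '' (s : Set G.vertexSet)) '' T
        subset_vertexSet_of_mem_edgeSet' := by
          rintro _ ⟨s, hs, rfl⟩
          exact Set.image_mono (coe_subset.2 (hTS s hs)) } with hJ
    have hJv : J.vertexSet.ncard = #S := by
      rw [hJ, Set.ncard_image_of_injective _ Subtype.val_injective, Set.ncard_coe_finset]
    have hJe : J.edgeSet.ncard = #T := by
      rw [hJ, Set.ncard_image_of_injective _ injective_image_val, Set.ncard_coe_finset]
    have hJG : J.edgeSet ⊆ G.edgeSet := by
      rw [← image_edges (G := G)]; exact Set.image_mono (coe_subset.2 hT)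
    have h := hbal.2.2 J ⟨Subtype.coe_image_subset _ _, hJG⟩ (fun h => ?_) (by rw [hJv]; exact hS)
    · rw [hbal.2.1, lDensity, lDensity, hJv, hJe, ← card_edges, ← card_vertexSet] at h
      have h₁ : (0 : ℝ) < #S - ℓ := by
        rw [sub_pos]; exact_mod_cast hS
      have h₂ : (0 : ℝ) < Fintype.card G.vertexSet - ℓ := by
        rw [sub_pos, card_vertexSet]; exact_mod_cast hbal.1
      rw [div_lt_div_iff₀ h₁ h₂] at h
      exact_mod_cast h
    · rcases hne with hne | hne
      · refine hne (coe_injective (Set.image_injective.2 Subtype.val_injective ?_))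
        rw [coe_univ, Subtype.coe_image_univ]
        exact congrArg Hypergraph.vertexSet h
      · refine hne (coe_injective (Set.image_injective.2 injective_image_val ?_))
        rw [image_edges]
        exact congrArg Hypergraph.edgeSet h

lemma exists_equiv_of_isIso {E : Set (Set V)} (h : G.IsIso (onUniv E)) :
    ∃ f : G.vertexSet ≃ V, ∀ s : Finset G.vertexSet,
      s ∈ edges G ↔ ((s.map f.toEmbedding : Finset V) : Set V) ∈ E := by
  obtain ⟨f, hf⟩ := h
  refine ⟨f.trans (Equiv.Set.univ V), fun s => ?_⟩
  rw [mem_edges, hf, coe_map]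
  simp only [Set.image_image, onUniv]
  rfl

lemma isIso_of_equiv {E : Set (Set V)} (f : G.vertexSet ≃ V) (hf : ∀ s : Finset G.vertexSet,
    s ∈ edges G ↔ ((s.map f.toEmbedding : Finset V) : Set V) ∈ E) : G.IsIso (onUniv E) := by
  classical
  refine ⟨f.trans (Equiv.Set.univ V).symm, fun s => ?_⟩
  have h := hf s.toFinset
  rw [mem_edges, coe_map, Set.coe_toFinset] at h
  rw [h]
  simp only [Set.image_image, onUniv]
  rfl

end

lemma isIso_symm {G' : Hypergraph β} (h : G.IsIso G') : G'.IsIso G := by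
  obtain ⟨f, hf⟩ := h
  refine ⟨f.symm, fun s => ?_⟩
  rw [hf, ← Set.image_comp f, Equiv.self_comp_symm, Set.image_id]

/-- The densities of subgraphs of `G` are densities of subgraphs of an isomorphic copy. -/
lemma densities_subset_of_isIso {G' : Hypergraph β} (h : G.IsIso G') :
    {d : ℝ | ∃ J : Hypergraph α, J.IsSubgraph G ∧ ℓ + 1 ≤ J.vertexSet.ncard ∧ d = J.lDensity ℓ} ⊆
    {d : ℝ | ∃ J : Hypergraph β, J.IsSubgraph G' ∧ ℓ + 1 ≤ J.vertexSet.ncard ∧ d = J.lDensity ℓ} := by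
  obtain ⟨f, hf⟩ := h
  rintro d ⟨J, ⟨hJv, hJe⟩, hJ, rfl⟩
  set φ : Set α → Set β := fun A => Subtype.val '' (f '' (Subtype.val ⁻¹' A)) with hφ
  have hφn : ∀ A ⊆ G.vertexSet, (φ A).ncard = A.ncard := by
    intro A hA
    rw [hφ, Set.ncard_image_of_injective _ Subtype.val_injective,
      Set.ncard_image_of_injective _ f.injective]
    have : A = Subtype.val '' (Subtype.val ⁻¹' A : Set G.vertexSet) := by
      rw [Subtype.image_preimage_coe, Set.inter_eq_right.2 hA]
    conv_rhs => rw [this]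
    rw [Set.ncard_image_of_injective _ Subtype.val_injective]
  have hφi : Set.InjOn φ J.edgeSet := by
    intro A hA B hB hAB
    have h₁ := Set.image_injective.2 f.injective (Set.image_injective.2 Subtype.val_injective hAB)
    have hsub : ∀ A ∈ J.edgeSet, A ⊆ G.vertexSet := fun A hA =>
      (J.subset_vertexSet_of_mem_edgeSet hA).trans hJv
    exact (Set.preimage_eq_preimage' (by simpa using hsub A hA) (by simpa using hsub B hB)).1 h₁
  set J' : Hypergraph β :=
    { vertexSet := φ J.vertexSet
      edgeSet := φ '' J.edgeSet
      subset_vertexSet_of_mem_edgeSet' := by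
        rintro _ ⟨e, he, rfl⟩
        exact Set.image_mono (Set.image_mono (Set.preimage_mono
          (J.subset_vertexSet_of_mem_edgeSet he))) } with hJ'
  refine ⟨J', ⟨Subtype.coe_image_subset _ _, ?_⟩, ?_, ?_⟩
  · rintro _ ⟨e, he, rfl⟩
    refine (hf _).1 ?_
    rw [Subtype.image_preimage_coe,
      Set.inter_eq_right.2 ((J.subset_vertexSet_of_mem_edgeSet he).trans hJv)]
    exact hJe he
  · rw [hJ', hφn _ hJv]
    exact hJ
  · rw [lDensity, lDensity, hJ', hφn _ hJv, hφi.ncard_image]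

lemma maxLDensity_eq_of_isIso {G' : Hypergraph β} (h : G.IsIso G') :
    G.maxLDensity ℓ = G'.maxLDensity ℓ :=
  congrArg sSup ((densities_subset_of_isIso h).antisymm (densities_subset_of_isIso (isIso_symm h)))

end RainbowFree

/-! ### Cycles, anti-Ramsey hosts and random sets -/

namespace RainbowFree

open Finset Hypergraph

variable {α β V W : Type*} {G : Hypergraph α} {ℓ r : ℕ}

section

variable [Fintype G.vertexSet]

lemma edges_of_isIso_complete (h : G.IsIso (complete ℓ r)) :
    Fintype.card G.vertexSet = r ∧ edges G = powersetCard ℓ univ := by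
  obtain ⟨f, hf⟩ := exists_equiv_of_isIso h
  refine ⟨by rw [Fintype.card_congr f, Fintype.card_fin], ?_⟩
  ext s
  rw [hf, mem_powersetCard, Set.mem_ofPred_eq, Set.ncard_coe_finset, card_map]
  simp

lemma isIso_complete (hr : Fintype.card G.vertexSet = r) (h : edges G = powersetCard ℓ univ) :
    G.IsIso (complete ℓ r) := by
  refine isIso_of_equiv (Fintype.equivFinOfCardEq hr) fun s => ?_
  rw [h, mem_powersetCard, Set.mem_ofPred_eq, Set.ncard_coe_finset, card_map]
  simp

lemma card_of_isIso_cycle_four (h : G.IsIso (cycle 4)) :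
    Fintype.card G.vertexSet = 4 ∧ #(edges G) = 4 := by
  obtain ⟨f, hf⟩ := exists_equiv_of_isIso h
  refine ⟨by rw [Fintype.card_congr f, Fintype.card_fin], ?_⟩
  have h₁ : #({s | ∃ u v, (SimpleGraph.cycleGraph 4).Adj u v ∧ s = {u, v}} :
      Finset (Finset (Fin 4))) = 4 := by decide +kernel
  rw [← h₁]
  refine card_equiv (Equiv.finsetCongr f) fun s => ?_
  rw [hf, mem_filter, Equiv.finsetCongr_apply, Set.mem_ofPred_eq]
  simp only [mem_univ, true_and]
  refine exists_congr fun u => exists_congr fun v => and_congr_right fun _ => ?_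
  rw [← coe_pair, coe_inj]

end

section Cycle

variable [Fintype W] [DecidableEq W] {H : Finset (Finset W)}

/-- A strictly balanced graph with a cycle of length `k + 3` is either this cycle, or it is denser than
the cycle. -/
lemma StrictBal.cycle_lt_or (hH : StrictBal 2 H) {k : ℕ} (g : Fin (k + 3) ↪ W)
    (hg : ∀ u v, (SimpleGraph.cycleGraph (k + 3)).Adj u v → {g u, g v} ∈ H) :
    ((k + 2 : ℤ) * (Fintype.card W - 2) < (#H - 1) * (k + 1)) ∨
      (Fintype.card W = k + 3 ∧ #H = k + 3 ∧ ∀ s ∈ H, ∃ u v,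
        (SimpleGraph.cycleGraph (k + 3)).Adj u v ∧ s = {g u, g v}) := by
  have hadj : ∀ i, (SimpleGraph.cycleGraph (k + 3)).Adj i (i + 1) := by
    intro i
    rw [SimpleGraph.cycleGraph_adj]
    right
    simp
  set T : Finset (Finset W) := univ.image fun i : Fin (k + 3) => {g i, g (i + 1)} with hT
  have hT3 : #T = k + 3 := by
    rw [hT, card_image_of_injective, card_univ, Fintype.card_fin]
    intro i j hij
    have h₁ : g i ∈ ({g j, g (j + 1)} : Finset W) := by
      have : g i ∈ ({g i, g (i + 1)} : Finset W) := by simp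
      exact (show ({g i, g (i + 1)} : Finset W) = {g j, g (j + 1)} from hij) ▸ this
    have h₂ : g j ∈ ({g i, g (i + 1)} : Finset W) := by
      have : g j ∈ ({g j, g (j + 1)} : Finset W) := by simp
      exact (show ({g i, g (i + 1)} : Finset W) = {g j, g (j + 1)} from hij) ▸ this
    simp only [mem_insert, mem_singleton, g.injective.eq_iff] at h₁ h₂
    rcases h₁ with h₁ | h₁
    · exact h₁
    rcases h₂ with h₂ | h₂
    · exact h₂.symm
    · rw [h₂, add_assoc] at h₁
      have h₃ : (1 + 1 : Fin (k + 3)) = 0 := by simpa using h₁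
      have := congrArg Fin.val h₃
      simp only [Fin.val_add, Fin.val_one, Fin.val_zero] at this
      rw [Nat.mod_eq_of_lt (by omega)] at this
      omega
  have hTH : T ⊆ H := by
    intro s hs
    obtain ⟨i, -, rfl⟩ := mem_image.1 hs
    exact hg _ _ (hadj i)
  have hS3 : #(univ.map g) = k + 3 := by simp
  by_cases h : univ.map g ≠ univ ∨ T ≠ H
  · left
    have := hH.2.2 (univ.map g) T hTH (fun h hh => by
      obtain ⟨i, -, rfl⟩ := mem_image.1 hh
      simp [insert_subset_iff]) (by rw [hS3]; omega) h
    rw [hT3, hS3] at this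
    push_cast at this
    linarith
  · right
    push Not at h
    refine ⟨by rw [← card_univ, ← h.1, hS3], by rw [← h.2, hT3], fun s hs => ?_⟩
    rw [← h.2] at hs
    obtain ⟨i, -, rfl⟩ := mem_image.1 hs
    exact ⟨i, i + 1, hadj i, rfl⟩

end Cycle

/-- A strictly balanced graph that contains a cycle has at least as many edges as vertices, and if it is
neither `K₃` nor `C₄` then it has more than three vertices and differs from `C₄` in these numbers. -/
lemma edges_of_not_isAcyclic [Fintype G.vertexSet] [DecidableEq G.vertexSet]
    (hH : StrictBal 2 (edges G)) (hc : ¬ G.toSimpleGraph.IsAcyclic)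
    (h3 : ¬ G.IsIso (complete 2 3)) (h4 : ¬ G.IsIso (cycle 4)) :
    4 ≤ Fintype.card G.vertexSet ∧ Fintype.card G.vertexSet ≤ #(edges G) ∧
      ¬ (Fintype.card G.vertexSet = 4 ∧ #(edges G) = 4) := by
  rw [SimpleGraph.isAcyclic_iff_free_cycleGraph] at hc
  push Not at hc
  obtain ⟨n, hn, hfree⟩ := hc
  obtain ⟨k, rfl⟩ : ∃ k, n = k + 3 := ⟨n - 3, by omega⟩
  obtain ⟨φ⟩ := hfree
  set g : Fin (k + 3) ↪ G.vertexSet := ⟨φ.toHom, φ.injective⟩ with hgdef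
  have hg : ∀ u v, (SimpleGraph.cycleGraph (k + 3)).Adj u v → {g u, g v} ∈ edges G := by
    intro u v huv
    have := (φ.toHom.map_adj huv).2
    rw [mem_edges, coe_pair, Set.image_pair]
    exact this
  have hcard : k + 3 ≤ Fintype.card G.vertexSet := by
    simpa using Fintype.card_le_of_embedding g
  have hv3 : Fintype.card G.vertexSet ≤ #(edges G) := by
    rcases hH.cycle_lt_or g hg with h | h
    · by_contra! hlt
      zify at hlt hcard
      nlinarith
    · omega
  refine ⟨?_, hv3, ?_⟩
  · by_contra! hlt
    have hv : Fintype.card G.vertexSet = 3 := by omega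
    refine h3 (isIso_complete hv (eq_of_subset_of_card_le
      (fun h hh => mem_powersetCard.2 ⟨subset_univ _, hH.1 h hh⟩) ?_))
    rw [card_powersetCard, card_univ, hv]
    have h32 : Nat.choose 3 2 = 3 := by decide
    omega
  · rintro ⟨hv, he⟩
    rcases hH.cycle_lt_or g hg with h | ⟨h₁, -, h₃⟩
    · rw [hv, he] at h
      push_cast at h
      omega
    · obtain rfl : k = 1 := by omega
      have hbij : Function.Bijective g :=
        (Fintype.bijective_iff_injective_and_card g).2 ⟨g.injective, by simp [hv]⟩
      refine h4 (isIso_of_equiv (Equiv.ofBijective g hbij).symm fun s => ?_)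
      have hsymm : ∀ i, (Equiv.ofBijective g hbij).symm (g i) = i := fun i =>
        (Equiv.ofBijective g hbij).symm_apply_apply i
      constructor
      · intro hs
        obtain ⟨u, v, huv, rfl⟩ := h₃ s hs
        refine ⟨u, v, huv, ?_⟩
        rw [coe_map, coe_pair, Set.image_pair]
        simp only [Equiv.coe_toEmbedding, hsymm]
      · rintro ⟨u, v, huv, h⟩
        have : s = {g u, g v} := by
          refine map_injective (Equiv.ofBijective g hbij).symm.toEmbedding (coe_injective ?_)
          rw [h, coe_map, coe_pair, Set.image_pair]
          simp only [Equiv.coe_toEmbedding, hsymm]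
        rw [this]
        exact hg u v huv

/-- A `2`-bounded colouring of a host graph without a rainbow copy of a subgraph of `F` has no rainbow
copy of `F` either. -/
lemma not_colourable_of_antiRamsey [Fintype V] [DecidableEq V] {F F' : Hypergraph α}
    [Fintype F'.vertexSet] (hsub : F'.IsSubgraph F) {E : Set (Set V)} {A : Finset (Finset V)}
    (hA : ∀ e, e ∈ A ↔ (e : Set V) ∈ E) (h : (onUniv E).AntiRamsey 2 F) :
    ¬ Colourable (edges F') A := by
  classical
  rintro ⟨c, hc, hcopy⟩
  obtain ⟨J, hJ, ⟨f, hf⟩, hinj⟩ := h (fun e => c e.toFinset) fun k => by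
    have h₁ : {e ∈ (onUniv E).edgeSet | c e.toFinset = k} ⊆
        ((A.filter fun e => c e = k).image fun e : Finset V => (e : Set V) : Finset (Set V)) := by
      rintro e ⟨he, hk⟩
      refine mem_coe.2 (mem_image.2 ⟨e.toFinset, mem_filter.2 ⟨(hA _).2 ?_, hk⟩, Set.coe_toFinset e⟩)
      rw [Set.coe_toFinset]
      exact he
    refine (Set.encard_le_encard h₁).trans ?_
    rw [Set.encard_coe_eq_coe_finsetCard]
    have h₂ : #(A.filter fun e => c e = k) ≤ 2 := by
      by_contra! hlt
      obtain ⟨a, ha, b, hb, d, hd, hab, had, hbd⟩ := two_lt_card.1 hlt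
      simp only [mem_filter] at ha hb hd
      rcases hc a ha.1 b hb.1 d hd.1 (ha.2.trans hb.2.symm) (hb.2.trans hd.2.symm) with h | h | h
      · exact hab h
      · exact hbd h
      · exact had h
    exact_mod_cast card_image_le.trans h₂
  set φ : F'.vertexSet ↪ V := ⟨fun w => f ⟨w, hsub.1 w.2⟩, fun a b hab => by
    have := f.injective (Subtype.val_injective hab)
    exact Subtype.ext (congrArg (Subtype.val : F.vertexSet → α) this)⟩ with hφ
  have hmap : ∀ h ∈ edges F', ((h.map φ : Finset V) : Set V) ∈ J.edgeSet := by
    intro h hh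
    have h₁ := (hf ((fun w : F'.vertexSet => (⟨w, hsub.1 w.2⟩ : F.vertexSet)) '' h)).1 (by
      rw [Set.image_image]
      exact hsub.2 (mem_edges.1 hh))
    rw [Set.image_image, Set.image_image] at h₁
    rw [coe_map]
    exact h₁
  obtain ⟨a, ha, b, hb, hab, hcab⟩ := hcopy φ fun h hh => (hA _).2 (hJ.2 (hmap h hh))
  refine hab (map_injective φ (coe_injective (hinj (hmap a ha) (hmap b hb) ?_)))
  simpa only [Finset.toFinset_coe] using hcab

open MeasureTheory ProbabilityTheory in
/-- In the random set each element of `s` is present with probability at most `p` (with probability `0`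
if it is not in `u`), independently of the others. -/
lemma setBernoulli_subset_le {ι : Type*} [Countable ι] (u : Set ι) (p : I) (s : Finset ι) :
    (setBernoulli u p).real {S | (s : Set ι) ⊆ S} ≤ (p : ℝ) ^ #s := by
  have h : setBernoulli u p {S | (s : Set ι) ⊆ S} ≤ (ENNReal.ofReal p) ^ #s := by
    rw [setBernoulli_apply']
    have hpre : (fun q : ι → Prop => {i | q i}) ⁻¹' {S | (s : Set ι) ⊆ S} =
        Set.pi s fun _ => {True} := by
      ext q
      simp [Set.subset_def, Set.pi]
    rw [hpre, Measure.infinitePi_pi]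
    · rw [← prod_const]
      refine prod_le_prod' fun i _ => ?_
      simp only [Measure.coe_add, Measure.coe_nnreal_smul_apply, Pi.add_apply, Measure.dirac_apply]
      rw [Set.indicator_of_notMem (s := {True}) (a := False) (by simp), mul_zero, add_zero]
      calc _ ≤ (unitInterval.toNNReal p : ENNReal) * 1 := by
            gcongr
            exact Set.indicator_le_self _ _ _
        _ = ENNReal.ofReal p := by
            rw [mul_one, ENNReal.ofReal, Real.toNNReal_of_nonneg p.2.1]; rfl
    · exact fun i _ => MeasurableSet.of_discrete
  refine ENNReal.toReal_le_of_le_ofReal (by positivity [p.2.1]) ?_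
  rwa [ENNReal.ofReal_pow p.2.1]

end RainbowFree

/-! ### The random hypergraph below the threshold -/

namespace RainbowFree

open Finset Hypergraph

variable {α W : Type*} {F F' : Hypergraph α} {ℓ : ℕ}

open MeasureTheory ProbabilityTheory in
/-- `StrictBal.exists_measure_le` for the random hypergraph: a minimal bad host is present with
probability at most `C (κ + 1 / n)`, where `κ` relates the probability `p ^ e(E)` of a fixed minimal
bad host `E` to its weight. -/
lemma exists_le_randomProb [Fintype F'.vertexSet] [DecidableEq F'.vertexSet]
    (hH : StrictBal ℓ (edges F')) (hHs : supp (edges F') = univ) (hℓ : 1 ≤ ℓ)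
    (he : 2 ≤ #(edges F')) (hsub : F'.IsSubgraph F) :
    ∃ c : ℝ, 0 < c ∧ ∃ C : ℝ, ∀ (n : ℕ), 1 ≤ n → ∀ (p : I) (ν κ : ℝ), 0 < ν →
      ν ^ (#(edges F') - 1) * n = 1 → p ≤ c * ν ^ (Fintype.card F'.vertexSet - ℓ) → 0 ≤ κ →
      (∀ E : Finset (Finset (Fin n)), MinBad (edges F') E →
        (p : ℝ) ^ #E ≤ κ * (c ^ #E * (1 / (n : ℝ)) ^ #(supp E))) →
      1 - C * (κ + 1 / n) ≤ randomProb ℓ n p fun G => ¬ G.AntiRamsey 2 F := by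
  classical
  obtain ⟨c, hc, -, C, -, h⟩ := hH.exists_measure_le hHs hℓ he
  refine ⟨c, hc, C, fun n hn p ν κ hν hνn hp hκ hE => ?_⟩
  set μ := setBernoulli {e : Set (Fin n) | e.ncard = ℓ} p with hμ
  set X : Set (Set (Fin n)) → Set (Finset (Fin n)) := fun E => {e | (e : Set (Fin n)) ∈ E} with hX
  have h₁ := h n hn μ X p ν κ (fun E => (p : ℝ) ^ #E ≤ κ * (c ^ #E * (1 / (n : ℝ)) ^ #(supp E)))
    p.2.1 hν hνn hp hκ (fun G => ?_) (fun _ h => h)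
  · have h₂ : {E | (onUniv E).AntiRamsey 2 F} ⊆ {ω | ∃ E : Finset (Finset (Fin n)),
        (E : Set (Finset (Fin n))) ⊆ X ω ∧ MinBad (edges F') E ∧
          (p : ℝ) ^ #E ≤ κ * (c ^ #E * (1 / (n : ℝ)) ^ #(supp E))} := by
      intro ω hω
      have hnc := not_colourable_of_antiRamsey hsub
        (A := ({e : Finset (Fin n) | (e : Set (Fin n)) ∈ ω} : Finset _))
        (by simp) hω
      obtain ⟨E, hEA, hmin⟩ := exists_minBad_subset hnc
      exact ⟨E, fun e he => (mem_filter.1 (hEA he)).2, hmin, hE E hmin⟩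
    have h₃ : randomProb ℓ n p (fun G => ¬ G.AntiRamsey 2 F) =
        1 - μ.real {E | (onUniv E).AntiRamsey 2 F} := by
      rw [← probReal_compl_eq_one_sub MeasurableSet.of_discrete]
      rfl
    rw [h₃]
    have := measureReal_mono (μ := μ) h₂
    linarith
  · have h₂ := setBernoulli_subset_le {e : Set (Fin n) | e.ncard = ℓ} p
      (G.map ⟨fun e : Finset (Fin n) => (e : Set (Fin n)), coe_injective⟩)
    rw [card_map] at h₂
    refine le_trans (le_of_eq ?_) h₂
    congr 1
    ext ω
    simp [hX, Set.subset_def]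

section

variable {V : Type*} [Fintype V] [DecidableEq V] [Fintype W] [DecidableEq W]
variable {H : Finset (Finset W)} {E : Finset (Finset V)}

lemma MinBad.pot_neg (hE : MinBad H E) (hH : StrictBal ℓ H) (he : 2 ≤ #H)
    (hcol : (∀ G ⊆ E, G.Nonempty → 0 ≤ pot ℓ H G) → Colourable H E) : pot ℓ H E < 0 := by
  by_contra! hlt
  exact hE.1 (hcol fun G hG hne => hlt.trans (hE.pot_le hH (by omega) hG hne))

lemma MinBad.pot_nonpos (hE : MinBad H E) (hH : StrictBal ℓ H) (he : 2 ≤ #H)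
    (hcol : (∀ G ⊆ E, G.Nonempty → 0 < pot ℓ H G) → Colourable H E) : pot ℓ H E ≤ 0 := by
  by_contra! hlt
  exact hE.1 (hcol fun G hG hne => hlt.trans_le (hE.pot_le hH (by omega) hG hne))

lemma supp_eq_univ (h : ∀ i, 0 < deg H i) : supp H = univ := by
  ext i
  by_contra hi
  simp only [mem_univ, iff_true] at hi
  exact (h i).ne' (deg_eq_zero hi)

variable {p c δ ν : ℝ} {n : ℕ}

/-- If `E` has negative potential, then its potential is at most `-1`, and this gains a factor `ν` over
the weight `c ^ e(E) n ^ (- v(E))`. -/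
lemma pow_le_of_pot_neg (hH : StrictBal ℓ H) (he : 2 ≤ #H) (hp : 0 ≤ p) (hc : 0 < c) (hν : 0 < ν)
    (hν1 : ν ≤ 1) (hn : 1 ≤ n) (hνn : ν ^ (#H - 1) * n = 1)
    (hpc : p ≤ c * ν ^ (Fintype.card W - ℓ)) (hpot : pot ℓ H E < 0) :
    p ^ #E ≤ ν * (c ^ #E * (1 / (n : ℝ)) ^ #(supp E)) := by
  have hn' : (1 / (n : ℝ)) = ν ^ (#H - 1) := by
    have : (0 : ℝ) < n := by exact_mod_cast hn
    field_simp
    linarith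
  have hexp : 1 + (#H - 1) * #(supp E) ≤ (Fintype.card W - ℓ) * #E := by
    have := hH.2.1
    simp only [pot] at hpot
    zify [(by omega : 1 ≤ #H), (by omega : ℓ ≤ Fintype.card W)]
    linarith
  calc p ^ #E ≤ (c * ν ^ (Fintype.card W - ℓ)) ^ #E := by gcongr
    _ = c ^ #E * ν ^ ((Fintype.card W - ℓ) * #E) := by rw [mul_pow, pow_mul]
    _ ≤ c ^ #E * ν ^ (1 + (#H - 1) * #(supp E)) := by
        gcongr ?_ * ?_
        exact pow_le_pow_of_le_one hν.le hν1 hexp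
    _ = _ := by rw [hn', pow_add, pow_mul, pow_one]; ring

/-- If `E` has potential at most `0`, then the factor `δ / c` is gained since `p` is below the threshold
by this factor. -/
lemma pow_le_of_pot_nonpos (hH : StrictBal ℓ H) (he : 2 ≤ #H) (hp : 0 ≤ p) (hc : 0 < c) (hν : 0 < ν)
    (hν1 : ν ≤ 1) (hn : 1 ≤ n) (hνn : ν ^ (#H - 1) * n = 1) (hδ : 0 ≤ δ) (hδc : δ ≤ c)
    (hpc : p ≤ δ * ν ^ (Fintype.card W - ℓ)) (hpot : pot ℓ H E ≤ 0) (hne : E.Nonempty) :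
    p ^ #E ≤ δ / c * (c ^ #E * (1 / (n : ℝ)) ^ #(supp E)) := by
  have hn' : (1 / (n : ℝ)) = ν ^ (#H - 1) := by
    have : (0 : ℝ) < n := by exact_mod_cast hn
    field_simp
    linarith
  have hexp : (#H - 1) * #(supp E) ≤ (Fintype.card W - ℓ) * #E := by
    have := hH.2.1
    simp only [pot] at hpot
    zify [(by omega : 1 ≤ #H), (by omega : ℓ ≤ Fintype.card W)]
    linarith
  have hδE : δ ^ #E ≤ δ / c * c ^ #E := by
    have h₁ : (δ / c) ^ #E ≤ δ / c :=
      pow_le_of_le_one (by positivity) ((div_le_one hc).2 hδc) (card_pos.2 hne).ne'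
    calc δ ^ #E = (δ / c) ^ #E * c ^ #E := by rw [← mul_pow, div_mul_cancel₀ _ hc.ne']
      _ ≤ _ := by gcongr
  calc p ^ #E ≤ (δ * ν ^ (Fintype.card W - ℓ)) ^ #E := by gcongr
    _ = δ ^ #E * ν ^ ((Fintype.card W - ℓ) * #E) := by rw [mul_pow, pow_mul]
    _ ≤ (δ / c * c ^ #E) * ν ^ ((#H - 1) * #(supp E)) := by
        gcongr ?_ * ?_
        · exact pow_le_pow_of_le_one hν.le hν1 hexp
    _ = _ := by rw [hn', pow_mul]; ring

end

/-- For `ν = n ^ (-1 / (e - 1))` the threshold `n ^ (-1 / d)` with `d = (e - 1) / (v - ℓ)` is an integer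
power of `ν`. -/
lemma scale_facts {e v : ℕ} (he : 2 ≤ e) (hv : ℓ < v) {n : ℕ} (hn : 1 ≤ n) :
    let ν : ℝ := (n : ℝ) ^ (-(1 / ((e : ℝ) - 1)))
    0 < ν ∧ ν ≤ 1 ∧ ν ^ (e - 1) * n = 1 ∧
      (n : ℝ) ^ (-1 / (((e : ℝ) - 1) / ((v : ℝ) - ℓ))) = ν ^ (v - ℓ) := by
  have hn0 : (0 : ℝ) < n := by exact_mod_cast hn
  have hn1 : (1 : ℝ) ≤ n := by exact_mod_cast hn
  have he0 : (0 : ℝ) < (e : ℝ) - 1 := by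
    have : (2 : ℝ) ≤ e := by exact_mod_cast he
    linarith
  refine ⟨by positivity, Real.rpow_le_one_of_one_le_of_nonpos hn1 ?_, ?_, ?_⟩
  · have : (0 : ℝ) < 1 / ((e : ℝ) - 1) := by positivity
    linarith
  · rw [← Real.rpow_natCast, ← Real.rpow_mul hn0.le, Nat.cast_sub (by omega), Nat.cast_one,
      neg_mul, one_div, inv_mul_cancel₀ he0.ne', Real.rpow_neg_one, inv_mul_cancel₀ hn0.ne']
  · rw [← Real.rpow_natCast, ← Real.rpow_mul hn0.le, Nat.cast_sub hv.le]
    congr 1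
    rw [div_div_eq_mul_div, neg_mul, neg_mul, neg_div]
    ring

lemma tendsto_scale {e : ℕ} (he : 2 ≤ e) :
    Tendsto (fun n : ℕ => (n : ℝ) ^ (-(1 / ((e : ℝ) - 1)))) atTop (𝓝 0) := by
  have he0 : (0 : ℝ) < (e : ℝ) - 1 := by
    have : (2 : ℝ) ≤ e := by exact_mod_cast he
    linarith
  exact (tendsto_rpow_neg_atTop (by positivity)).comp tendsto_natCast_atTop_atTop

open MeasureTheory ProbabilityTheory in
lemma tendsto_one_of_le {p : ℕ → I} {P : ∀ n, Hypergraph (Fin n) → Prop} {κ : ℕ → ℝ} {C : ℝ}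
    (hκ : Tendsto κ atTop (𝓝 0))
    (h : ∀ᶠ n : ℕ in atTop, 1 - C * (κ n + 1 / n) ≤ randomProb ℓ n (p n) (P n)) :
    Tendsto (fun n : ℕ => randomProb ℓ n (p n) (P n)) atTop (𝓝 1) := by
  have hlim : Tendsto (fun n : ℕ => 1 - C * (κ n + 1 / n)) atTop (𝓝 1) := by
    have := ((hκ.add tendsto_one_div_atTop_nhds_zero_nat).const_mul C).const_sub 1
    simpa using this
  exact tendsto_of_tendsto_of_tendsto_of_le_of_le' hlim tendsto_const_nhds h
    (Eventually.of_forall fun n => measureReal_le_one)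

lemma edges_complete_facts [Fintype W] [DecidableEq W] {H : Finset (Finset W)} {r : ℕ}
    (hW : Fintype.card W = r) (hr : ℓ + 1 ≤ r) (hℓ : 1 ≤ ℓ) (hH : H = powersetCard ℓ univ) :
    supp H = univ ∧ 2 ≤ #H := by
  constructor
  · ext w
    simp only [mem_univ, iff_true, mem_supp, hH, mem_powersetCard, subset_univ, true_and]
    obtain ⟨s, h₁, -, h₂⟩ := exists_subsuperset_card_eq (subset_univ {w}) (n := ℓ)
      (by simpa using hℓ) (by rw [card_univ]; omega)
    exact ⟨s, h₂, h₁ (mem_singleton_self w)⟩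
  · rw [hH, card_powersetCard, card_univ, hW]
    have := Nat.choose_le_choose ℓ hr
    rw [Nat.choose_succ_self_right] at this
    omega

end RainbowFree

theorem theorem1p5 {α : Type*} (ℓ : ℕ) (hℓ : 2 ≤ ℓ)
    (F F' : Hypergraph α) (hF : F.IsLGraph ℓ) (hsub : F'.IsSubgraph F)
    (hbal : F'.IsStrictlyBalanced ℓ) (hm : F'.maxLDensity ℓ = F.maxLDensity ℓ) :
    ∃ c : ℝ, 0 < c ∧ ∀ p : ℕ → I,
      ((ℓ = 2 ∧ ¬ F'.toSimpleGraph.IsAcyclic ∧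
          ¬ F'.IsIso (Hypergraph.complete 2 3) ∧ ¬ F'.IsIso (Hypergraph.cycle 4) ∧
          ∀ᶠ n : ℕ in atTop, (p n : ℝ) ≤ c * (n : ℝ) ^ (-1 / F.maxLDensity 2)) ∨
       (ℓ = 2 ∧ F'.IsIso (Hypergraph.cycle 4) ∧
          (fun n : ℕ => (p n : ℝ)) =o[atTop]
            fun n : ℕ => (n : ℝ) ^ (-1 / (Hypergraph.cycle 4).maxLDensity 2)) ∨
       (3 ≤ ℓ ∧ ∃ r : ℕ, ℓ + 1 ≤ r ∧ (ℓ, r) ≠ (3, 4) ∧ F'.IsIso (Hypergraph.complete ℓ r) ∧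
          ∀ᶠ n : ℕ in atTop,
            (p n : ℝ) ≤ c * (n : ℝ) ^ (-1 / (Hypergraph.complete ℓ r).maxLDensity ℓ))) →
      Tendsto (fun n : ℕ => Hypergraph.randomProb ℓ n (p n) fun G => ¬ G.AntiRamsey 2 F)
        atTop (𝓝 1) := by
  classical
  open RainbowFree Finset in
    have := (hF.1.subset hsub.1).fintype
    have hH := strictBal_edges ⟨hF.1.subset hsub.1, fun e he => hF.2 e (hsub.2 he)⟩ hbal
    set H := edges F' with hHdef
    set v := Fintype.card F'.vertexSet with hv
    have hvℓ : ℓ < v := hH.2.1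
    have hd : F'.maxLDensity ℓ = ((#H : ℝ) - 1) / ((v : ℝ) - ℓ) := by
      rw [hbal.2.1, Hypergraph.lDensity, ← card_edges, ← card_vertexSet]
    -- each of the three conditions implies that the pattern has no isolated vertices
    have hgraph : ℓ = 2 → 4 ≤ v → v ≤ #H → supp H = Finset.univ ∧ 2 ≤ #H := by
      rintro rfl hv4 he
      refine ⟨supp_eq_univ fun i => ?_, by omega⟩
      have h := hH.lt_deg hv4 i
      by_contra! h0
      rw [Nat.le_zero.1 h0] at h
      push_cast at h
      omega
    by_cases hgood : supp H = Finset.univ ∧ 2 ≤ #H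
    · obtain ⟨hHs, he⟩ := hgood
      obtain ⟨c, hc, C, hmain⟩ := exists_le_randomProb hH hHs (by omega) he hsub
      refine ⟨c, hc, fun p hp => ?_⟩
      set ν : ℕ → ℝ := fun n => (n : ℝ) ^ (-(1 / ((#H : ℝ) - 1))) with hν
      have hsc : ∀ n : ℕ, 1 ≤ n → 0 < ν n ∧ ν n ≤ 1 ∧ ν n ^ (#H - 1) * n = 1 ∧
          (n : ℝ) ^ (-1 / F'.maxLDensity ℓ) = ν n ^ (v - ℓ) := fun n hn => by
        rw [hd]
        exact scale_facts he hvℓ hn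
      -- sparse hosts can be coloured, and dense hosts do not occur
      have hsparse : (∀ n : ℕ, ∀ E : Finset (Finset (Fin n)),
          (∀ G ⊆ E, G.Nonempty → 0 ≤ pot ℓ H G) → Colourable H E) →
          (∀ᶠ n : ℕ in atTop, (p n : ℝ) ≤ c * (n : ℝ) ^ (-1 / F'.maxLDensity ℓ)) →
          Tendsto (fun n : ℕ => Hypergraph.randomProb ℓ n (p n) fun G => ¬ G.AntiRamsey 2 F)
            atTop (𝓝 1) := by
        intro hcol hple
        refine tendsto_one_of_le (C := C) (tendsto_scale he) ?_
        filter_upwards [hple, eventually_ge_atTop 1] with n hpn hn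
        obtain ⟨h₁, h₂, h₃, h₄⟩ := hsc n hn
        rw [h₄] at hpn
        exact hmain n hn (p n) (ν n) (ν n) h₁ h₃ hpn h₁.le fun E hE =>
          pow_le_of_pot_neg hH he (p n).2.1 hc h₁ h₂ hn h₃ hpn (hE.pot_neg hH he (hcol n E))
      rcases hp with ⟨rfl, hcyc, h3, h4, hple⟩ | ⟨rfl, hiso, hple⟩ | ⟨hℓ3, r, hr, hne, hiso, hple⟩
      · obtain ⟨hv4, hve, h44⟩ := edges_of_not_isAcyclic hH hcyc h3 h4
        exact hsparse (fun n E hE => hH.colourable_of_two hv4 hve h44 hE) (by rw [hm]; exact hple)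
      · obtain ⟨hv4, he4⟩ := card_of_isIso_cycle_four hiso
        rw [← maxLDensity_eq_of_isIso hiso] at hple
        set δ : ℕ → ℝ := fun n => p n / (n : ℝ) ^ (-1 / F'.maxLDensity 2) with hδ
        have hδ0 : Tendsto δ atTop (𝓝 0) := hple.tendsto_div_nhds_zero
        refine tendsto_one_of_le (C := C) (κ := fun n => δ n / c) (by simpa using hδ0.div_const c) ?_
        filter_upwards [hδ0.eventually_le_const hc, eventually_ge_atTop 1] with n hδc hn
        obtain ⟨h₁, h₂, h₃, h₄⟩ := hsc n hn
        have hpos : 0 < ν n ^ (v - 2) := by positivity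
        have hδn : 0 ≤ δ n := by
          rw [hδ]
          simp only [h₄]
          exact div_nonneg (p n).2.1 hpos.le
        have hpn : (p n : ℝ) ≤ δ n * ν n ^ (v - 2) := by
          rw [hδ]
          simp only [h₄]
          rw [div_mul_cancel₀ _ hpos.ne']
        refine hmain n hn (p n) (ν n) (δ n / c) h₁ h₃ (hpn.trans (by gcongr)) (by positivity)
          fun E hE => ?_
        exact pow_le_of_pot_nonpos hH he (p n).2.1 hc h₁ h₂ hn h₃ hδn hδc hpn
          (hE.pot_nonpos hH he fun h => hH.colourable_of_four hv4 he4 h)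
          (hE.nonempty (Finset.card_pos.1 (by omega)))
      · obtain ⟨hvr, hHc⟩ := edges_of_isIso_complete hiso
        exact hsparse (fun n E hE => colourable_of_complete hHc hvr hℓ3 hr hne hE)
          (by rw [maxLDensity_eq_of_isIso hiso]; exact hple)
    · refine ⟨1, one_pos, fun p hp => absurd ?_ hgood⟩
      rcases hp with ⟨rfl, hcyc, h3, h4, -⟩ | ⟨rfl, hiso, -⟩ | ⟨hℓ3, r, hr, -, hiso, -⟩
      · obtain ⟨hv4, hve, -⟩ := edges_of_not_isAcyclic hH hcyc h3 h4
        exact hgraph rfl hv4 hve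
      · obtain ⟨hv4, he4⟩ := card_of_isIso_cycle_four hiso
        exact hgraph rfl hv4.ge (hv4.trans he4.symm).le
      · obtain ⟨hvr, hHc⟩ := edges_of_isIso_complete hiso
        exact edges_complete_facts hvr hr (by omega) hHc
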